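/- **The Lie algebra of type $E_6$.** Let $Q=\bigoplus_{i=1}^6\mathbb Z\alpha_i$ be the root lattice of type $E_6$ with its form $(\cdot,\cdot)$, $(\alpha_i,\alpha_i)=2$, for the Dynkin diagram with edges $1-3$, $3-4$, $4-2$, $4-5$, $5-6$; let $\Phi=\{\alpha\in Q\mid(\alpha,\alpha)=2\}$, $H=\bigoplus_i\mathbb C\alpha_i$ (with the form extended bilinearly) and $$F\Big(\sum_i k_i\alpha_i,\sum_j l_j\alpha_j\Big)=(-1)^{\sum_i k_il_i+k_1l_3+k_4l_2+k_3l_4+k_5l_4+k_6l_5}.$$ Let $\mathcal G=H\oplus\bigoplus_{\alpha\in\Phi}\mathbb CE_\alpha$ be the simple Lie algebra of type $E_6$ with $[H,H]=0$, $[h,E_\alpha]=-[E_\alpha,h]=(h,\alpha)E_\alpha$, $[E_\alpha,E_{-\alpha}]=-\alpha$, $[E_\alpha,E_\beta]=F(\alpha,\beta)E_{\alpha+\beta}$ if $\alpha+\beta\in\Phi$, and $[E_\alpha,E_\beta]=0$ if $\alpha+\beta\notin\Phi\cup\{0\}$. Let $\gamma_1,\dots,\gamma_{16}$ be the positive roots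 with $\alpha_6$-coefficient $1$, in the order (the word $k_1\dots k_6$ stands for $\sum_i k_i\alpha_i$) $$000001,\ 000011,\ 000111,\ 001111,\ 010111,\ 011111,\ 101111,\ 111111,$$ $$011211,\ 111211,\ 011221,\ 112211,\ 111221,\ 112221,\ 112321,\ 122321,$$ and put $\xi_i=E_{\gamma_i}$, $\eta_i=E_{-\gamma_i}$, $\mathcal G_+=\sum_i\mathbb C\xi_i$, $\mathcal G_-=\sum_i\mathbb C\eta_i$, $\mathcal G_0=H\oplus\bigoplus\{\mathbb CE_\alpha\mid\alpha\in\Phi\cap\sum_{i\le5}\mathbb Z\alpha_i\}$. Then $\mathcal G=\mathcal G_-\oplus\mathcal G_0\oplus\mathcal G_+$ and $\mathcal G_0=\mathcal G^{D_5}\oplus\mathbb C\widehat\alpha$, where $\mathcal G^{D_5}=\sum_{i\le5}\mathbb C\alpha_i+\sum\{\mathbb CE_\alpha\mid\alpha\in\Phi\cap\sum_{i\le5}\mathbb Z\alpha_i\}$ and $\widehat\alpha=2\alpha_1+3\alpha_2+4\alpha_3+6\alpha_4+5\alpha_5+4\alpha_6$ is central in $\mathcal G_0$. **The Lie algebra $o(10)$.**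 For $a\in\{1,\dots,10\}$ let $a'=a+5$ if $a\le5$ and $a'=a-5$ otherwise, and let $o(10)$ be the Lie algebra of complex $10\times10$ matrices spanned by all $B_{a,b}=E_{a,b}-E_{b',a'}$. Let $\nu:o(10)\to\mathcal G^{D_5}$ be the Lie algebra isomorphism with $B_{1,2},B_{2,3},B_{3,4},B_{4,5},B_{4,10}\mapsto E_{\alpha_1},E_{\alpha_3},E_{\alpha_4},E_{\alpha_5},E_{\alpha_2}$ and $B_{2,1},B_{3,2},B_{4,3},B_{5,4},B_{10,4}\mapsto -E_{-\alpha_1},-E_{-\alpha_3},-E_{-\alpha_4},-E_{-\alpha_5},-E_{-\alpha_2}$. With respect to the Cartan subalgebra spanned by the $B_{i,i}$, $i\le5$, with dual basis $\varepsilon_1,\dots,\varepsilon_5$, weights are written $\mu=\sum_i\mu_i\varepsilon_i$, with $(\varepsilon_i,\varepsilon_j)=\delta_{i,j}$. A weight $\mu$ with rational coordinates is dominant integral if $\mu_i-\mu_{i+1}\in\mathbb N=\{0,1,2,\dots\}$ for $i\le4$ and $\mu_4+\mu_5\in\mathbb N$; the positive roots are $\varepsilon_i\pm\varepsilon_j$,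 $i<j$. A singular vector of weight $\mu$ is a nonzero vector of weight $\mu$ that is killed by $B_{i,j}$ and $B_{i,5+j}$ for all $1\le i<j\le5$. **The modules.** Let $\mathcal A=\mathbb C[x_1,\dots,x_{16}]$. For $u\in\mathcal G_0$ write $[u,\eta_i]=\sum_j\varphi_{i,j}(u)\eta_j$ and let $u$ act on $\mathcal A$ by $u|_{\mathcal A}=\sum_{i,j}\varphi_{i,j}(u)x_j\partial_{x_i}$. Let $P_i=\frac12\sum_{r=1}^{16}x_r\,[\xi_r,\eta_i]|_{\mathcal A}$; this is the vector field with quadratic coefficients determined by $[\partial_{x_r},P_i]=[\xi_r,\eta_i]|_{\mathcal A}$ for all $r$. Given $c\in\mathbb C$ and an $o(10)$-module $M$, let $\mathcal G_0$ act on $M$ by $\varrho(\nu(B))=B$ for $B\in o(10)$ and $\varrho(\widehat\alpha)=2c$. Then $\widehat M=\mathcal A\otimes M$ is a $\mathcal G$-module with $$\xi_i\mapsto\partial_{x_i}\otimes1,\qquad u\mapsto u|_{\mathcal A}\otimes1+1\otimes\varrho(u)\ (u\in\mathcal G_0),\qquad \eta_i\mapsto P_i\otimes1+\sum_{r=1}^{16}x_r\otimes\varrho([\xi_r,\eta_i]).$$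 **The two numbers.** Let $\lambda$ be a dominant integral weight and let $V(\lambda)$ be the finite-dimensional irreducible $o(10)$-module with highest weight $\lambda$. Let $\rho=4\varepsilon_1+3\varepsilon_2+2\varepsilon_3+\varepsilon_4$ and $\lambda_4=\frac12(\varepsilon_1+\varepsilon_2+\varepsilon_3+\varepsilon_4-\varepsilon_5)$. Let $\Upsilon(\lambda)$ be the set of dominant integral weights $\lambda+\mu$ with $\mu=\frac12\sum_i(\pm\varepsilon_i)$ having an odd number of minus signs, and $$\ell_\omega(\lambda)=\min\Big\{\tfrac12\big[(\lambda'+2\rho,\lambda')-(\lambda+2\rho,\lambda)-(\lambda_4+2\rho,\lambda_4)\big]\ \Big|\ \lambda'\in\Upsilon(\lambda)\Big\}.$$ Let $$\begin{aligned} \zeta_1&=x_1x_{11}+x_2x_9-x_3x_6+x_4x_5,&\zeta_2&=x_1x_{13}+x_2x_{10}-x_3x_8+x_5x_7,\\ \zeta_3&=x_1x_{14}+x_2x_{12}-x_4x_8+x_6x_7,&\zeta_4&=x_1x_{15}-x_3x_{12}+x_4x_{10}-x_7x_9,\\ \zeta_5&=-x_2x_{15}-x_3x_{14}+x_4x_{13}-x_7x_{11},&\zeta_6&=x_7x_{16}+x_8x_{15}+x_{10}x_{14}-x_{12}x_{13},\\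 \zeta_7&=-x_4x_{16}-x_6x_{15}-x_9x_{14}+x_{11}x_{12},&\zeta_8&=x_3x_{16}+x_5x_{15}+x_9x_{13}-x_{10}x_{11},\\ \zeta_9&=x_2x_{16}-x_5x_{14}+x_6x_{13}-x_8x_{11},&\zeta_{10}&=x_1x_{16}+x_5x_{12}-x_6x_{10}+x_8x_9; \end{aligned}$$ their span $U$ is the natural $o(10)$-module inside $\mathcal A$, on which $o(10)$ acts through $\nu$. For $v\in V(\lambda)$ and $a\in\{1,\dots,10\}$ let $T'_a(v)=\sum_{b=1}^{10}\zeta_b\otimes B_{a,b}v$. Let $\Upsilon'(\lambda)$ be the set of dominant integral weights among $\lambda\pm\varepsilon_1,\dots,\lambda\pm\varepsilon_5$. For $\lambda'\in\Upsilon'(\lambda)$ let $\flat_{\lambda'}$ be the scalar such that $\sum_aT'_a(u_a)=\flat_{\lambda'}u$ for a singular vector $u=\sum_a\zeta_a\otimes u_a$ of weight $\lambda'$ in the tensor product module $U\otimes V(\lambda)$, and let $\flat(\lambda)=\min\{\flat_{\lambda'}\mid\lambda'\in\Upsilon'(\lambda)\}$. **Theorem.** Let $\lambda$ be a dominant integral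 weight of $o(10)$. The minima $\flat(\lambda)$ and $\ell_\omega(\lambda)$ exist, and for every $$c\in\mathbb C\setminus\big((\flat(\lambda)-6+\mathbb N)\cup(2\ell_\omega(\lambda)+2\mathbb N)\big)$$ the $\mathcal G$-module $\widehat{V(\lambda)}=\mathcal A\otimes V(\lambda)$ with parameter $c$ is irreducible. -/

import Mathlib

namespace E6Ext

/-- The root lattice of type `E₆`; the coordinate `i` is the coefficient of `α_{i+1}`. -/
abbrev Lat := Fin 6 → ℤ

/-- The form of the Dynkin diagram with edges `1-3`, `3-4`, `4-2`, `4-5`, `5-6`. -/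
def form (x y : Lat) : ℤ :=
  2 * (x 0 * y 0 + x 1 * y 1 + x 2 * y 2 + x 3 * y 3 + x 4 * y 4 + x 5 * y 5)
    - (x 0 * y 2 + x 2 * y 0) - (x 2 * y 3 + x 3 * y 2) - (x 3 * y 1 + x 1 * y 3)
    - (x 3 * y 4 + x 4 * y 3) - (x 4 * y 5 + x 5 * y 4)

/-- The exponent of the sign `F`. -/
def cocycleExp (k l : Lat) : ℤ :=
  (k 0 * l 0 + k 1 * l 1 + k 2 * l 2 + k 3 * l 3 + k 4 * l 4 + k 5 * l 5)
    + k 0 * l 2 + k 3 * l 1 + k 2 * l 3 + k 4 * l 3 + k 5 * l 4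

/-- The bimultiplicative sign `F(k,l) = (-1)^{cocycleExp k l}`. -/
def F (k l : Lat) : ℤ := if cocycleExp k l % 2 = 0 then 1 else -1

/-- The root system `Φ_{E₆}`. -/
abbrev Root := {α : Lat // form α α = 2}

lemma form_comm (x y : Lat) : form x y = form y x := by simp only [form]; ring

lemma form_add_left (x y z : Lat) : form (x + y) z = form x z + form y z := by
  simp only [form, Pi.add_apply]; ring

lemma form_add_right (x y z : Lat) : form x (y + z) = form x y + form x z := by
  simp only [form, Pi.add_apply]; ring

lemma form_neg_left (x y : Lat) : form (-x) y = -form x y := by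
  simp only [form, Pi.neg_apply]; ring

lemma form_neg_right (x y : Lat) : form x (-y) = -form x y := by
  simp only [form, Pi.neg_apply]; ring

lemma form_zero_left (x : Lat) : form 0 x = 0 := by simp [form]

lemma six_form (x : Lat) : 6 * form x x =
    3 * (2 * x 0 - x 2) ^ 2 + 3 * (2 * x 5 - x 4) ^ 2 + 3 * (2 * x 1 - x 3) ^ 2
      + (3 * x 2 - 2 * x 3) ^ 2 + (3 * x 4 - 2 * x 3) ^ 2 + x 3 ^ 2 := by
  simp only [form]; ring

lemma form_self_nonneg (x : Lat) : 0 ≤ form x x := by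
  have h := six_form x
  have : 0 ≤ 6 * form x x := by rw [h]; positivity
  omega

lemma eq_zero_of_form_self (x : Lat) (hx : form x x = 0) : x = 0 := by
  have h := six_form x
  rw [hx] at h
  have h3 : x 3 = 0 := by
    have : x 3 ^ 2 = 0 := by
      nlinarith [sq_nonneg (2 * x 0 - x 2), sq_nonneg (2 * x 5 - x 4),
        sq_nonneg (2 * x 1 - x 3), sq_nonneg (3 * x 2 - 2 * x 3), sq_nonneg (3 * x 4 - 2 * x 3),
        sq_nonneg (x 3)]
    exact pow_eq_zero_iff (two_ne_zero) |>.1 this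
  rw [h3] at h
  have h2 : x 2 = 0 := by
    have : x 2 ^ 2 = 0 := by
      nlinarith [sq_nonneg (2 * x 0 - x 2), sq_nonneg (2 * x 5 - x 4),
        sq_nonneg (x 1), sq_nonneg (x 2), sq_nonneg (x 4)]
    exact pow_eq_zero_iff (two_ne_zero) |>.1 this
  have h4 : x 4 = 0 := by
    have : x 4 ^ 2 = 0 := by
      nlinarith [sq_nonneg (2 * x 0 - x 2), sq_nonneg (2 * x 5 - x 4),
        sq_nonneg (x 1), sq_nonneg (x 2), sq_nonneg (x 4)]
    exact pow_eq_zero_iff (two_ne_zero) |>.1 this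
  rw [h2, h4] at h
  have h0 : x 0 = 0 := by
    have : x 0 ^ 2 = 0 := by
      nlinarith [sq_nonneg (x 0), sq_nonneg (x 5), sq_nonneg (x 1)]
    exact pow_eq_zero_iff (two_ne_zero) |>.1 this
  have h5 : x 5 = 0 := by
    have : x 5 ^ 2 = 0 := by
      nlinarith [sq_nonneg (x 0), sq_nonneg (x 5), sq_nonneg (x 1)]
    exact pow_eq_zero_iff (two_ne_zero) |>.1 this
  have h1 : x 1 = 0 := by
    have : x 1 ^ 2 = 0 := by
      nlinarith [sq_nonneg (x 0), sq_nonneg (x 5), sq_nonneg (x 1)]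
    exact pow_eq_zero_iff (two_ne_zero) |>.1 this
  funext i
  fin_cases i <;> assumption

lemma form_sum_self (x y : Lat) :
    form (x + y) (x + y) = form x x + 2 * form x y + form y y := by
  simp only [form, Pi.add_apply]; ring

lemma Root.form_ge (α β : Root) : -2 ≤ form α.1 β.1 := by
  have h := form_self_nonneg (α.1 + β.1)
  rw [form_sum_self, α.2, β.2] at h
  omega

lemma Root.add_eq_zero_iff (α β : Root) : α.1 + β.1 = 0 ↔ form α.1 β.1 = -2 := by
  constructor
  · intro h
    have h' : form (α.1 + β.1) (α.1 + β.1) = 0 := by rw [h, form_zero_left]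
    rw [form_sum_self, α.2, β.2] at h'
    omega
  · intro h
    apply eq_zero_of_form_self
    rw [form_sum_self, α.2, β.2, h]
    norm_num

lemma Root.add_root_iff (α β : Root) :
    form (α.1 + β.1) (α.1 + β.1) = 2 ↔ form α.1 β.1 = -1 := by
  rw [form_sum_self, α.2, β.2]; omega

lemma cocycleExp_add_left (x y z : Lat) :
    cocycleExp (x + y) z = cocycleExp x z + cocycleExp y z := by
  simp only [cocycleExp, Pi.add_apply]; ring

lemma cocycleExp_add_right (x y z : Lat) :
    cocycleExp x (y + z) = cocycleExp x y + cocycleExp x z := by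
  simp only [cocycleExp, Pi.add_apply]; ring

lemma F_mul_of_exp {a b c d e f : Lat} (h : cocycleExp a b = cocycleExp c d + cocycleExp e f) :
    F a b = F c d * F e f := by
  unfold F
  rw [h]
  split_ifs <;> first | rfl | omega

lemma F_add_left (x y z : Lat) : F (x + y) z = F x z * F y z :=
  F_mul_of_exp (cocycleExp_add_left x y z)

lemma F_add_right (x y z : Lat) : F x (y + z) = F x y * F x z :=
  F_mul_of_exp (cocycleExp_add_right x y z)

lemma F_neg_left (x y : Lat) : F (-x) y = F x y := by
  have h : cocycleExp (-x) y = -cocycleExp x y := by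
    simp only [cocycleExp, Pi.neg_apply]; ring
  unfold F
  rw [h]
  split_ifs <;> first | rfl | omega

lemma F_neg_right (x y : Lat) : F x (-y) = F x y := by
  have h : cocycleExp x (-y) = -cocycleExp x y := by
    simp only [cocycleExp, Pi.neg_apply]; ring
  unfold F
  rw [h]
  split_ifs <;> first | rfl | omega

lemma F_sq (x y : Lat) : F x y * F x y = 1 := by
  unfold F
  split_ifs <;> norm_num

lemma exp_add_exp_swap (x y : Lat) : cocycleExp x y + cocycleExp y x =
    form x y + 2 * (x 0 * y 2 + x 2 * y 0 + x 2 * y 3 + x 3 * y 2 + x 3 * y 1 + x 1 * y 3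
      + x 3 * y 4 + x 4 * y 3 + x 4 * y 5 + x 5 * y 4) := by
  simp only [cocycleExp, form]; ring

lemma F_swap_of_even {x y : Lat} (h : form x y % 2 = 0) : F y x = F x y := by
  have := exp_add_exp_swap x y
  unfold F
  split_ifs <;> first | rfl | omega

lemma F_swap_of_odd {x y : Lat} (h : form x y % 2 = 1) : F y x = -F x y := by
  have := exp_add_exp_swap x y
  unfold F
  split_ifs <;> first | rfl | omega

lemma F_self (α : Root) : F α.1 α.1 = -1 := by
  have h := α.2
  have h2 : 2 * cocycleExp α.1 α.1 = form α.1 α.1 + 2 * (2 * (α.1 0 * α.1 2 + α.1 2 * α.1 3 + α.1 3 * α.1 1 + α.1 3 * α.1 4 + α.1 4 * α.1 5)) := by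
    simp only [cocycleExp, form]; ring
  unfold F
  rw [if_neg]
  omega

end E6Ext

noncomputable section

namespace E6Ext

/-- The Lie algebra `𝒢^{E₆} = H ⊕ ⨁_{α ∈ Φ} ℂ E_α`, where `H = ⨁ ℂ α_i`. -/
def E6 := (Fin 6 → ℂ) × (Root →₀ ℂ)

instance : AddCommGroup E6 := inferInstanceAs (AddCommGroup ((Fin 6 → ℂ) × (Root →₀ ℂ)))
instance : Module ℂ E6 := inferInstanceAs (Module ℂ ((Fin 6 → ℂ) × (Root →₀ ℂ)))

/-- The inclusion of the Cartan subalgebra `H`. -/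
def ofH : (Fin 6 → ℂ) →ₗ[ℂ] E6 := LinearMap.inl ℂ (Fin 6 → ℂ) (Root →₀ ℂ)

/-- The span of the root vectors. -/
def ofR : (Root →₀ ℂ) →ₗ[ℂ] E6 := LinearMap.inr ℂ (Fin 6 → ℂ) (Root →₀ ℂ)

/-- The component in `H`. -/
def hPart : E6 →ₗ[ℂ] (Fin 6 → ℂ) := LinearMap.fst ℂ (Fin 6 → ℂ) (Root →₀ ℂ)

/-- The coefficients of the root vectors. -/
def rPart : E6 →ₗ[ℂ] (Root →₀ ℂ) := LinearMap.snd ℂ (Fin 6 → ℂ) (Root →₀ ℂ)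

/-- The root vector `E_α`. -/
def E (α : Root) : E6 := ofR (Finsupp.single α 1)

/-- `E_v` if the lattice vector `v` is a root, and `0` otherwise. -/
def Ev (v : Lat) : E6 := if h : form v v = 2 then E ⟨v, h⟩ else 0

/-- The coefficient of `E_v` if the lattice vector `v` is a root, and `0` otherwise. -/
def coef (v : Lat) : E6 →ₗ[ℂ] ℂ :=
  if h : form v v = 2 then (Finsupp.lapply ⟨v, h⟩).comp rPart else 0

/-- A lattice vector as an element of `H`. -/
def toH (v : Lat) : Fin 6 → ℂ := fun i => (v i : ℂ)

/-- The `ℂ`-bilinear extension of the form: `(h, v)` for `h ∈ H` and `v` in the lattice. -/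
def hform (v : Lat) : (Fin 6 → ℂ) →ₗ[ℂ] ℂ :=
  ∑ i, ((form (Pi.single i 1) v : ℤ) : ℂ) • LinearMap.proj i

/-- `[E_α, E_β]`. -/
def rootBracket (α β : Root) : E6 :=
  if α.1 + β.1 = 0 then -ofH (toH α.1) else (F α.1 β.1 : ℂ) • Ev (α.1 + β.1)

/-- `h ↦ (E_β ↦ [h, E_β])`, extended linearly to the span of the root vectors. -/
def cartanAct : (Fin 6 → ℂ) →ₗ[ℂ] (Root →₀ ℂ) →ₗ[ℂ] E6 :=
  (Finsupp.lsum ℂ (fun β : Root =>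
    (hform β.1).smulRight (LinearMap.toSpanSingleton ℂ E6 (E β)) |>.flip)).flip

/-- The bilinear extension of `rootBracket`. -/
def rootPairing : (Root →₀ ℂ) →ₗ[ℂ] (Root →₀ ℂ) →ₗ[ℂ] E6 :=
  Finsupp.lsum ℂ (fun α : Root => LinearMap.toSpanSingleton ℂ ((Root →₀ ℂ) →ₗ[ℂ] E6)
    (Finsupp.lsum ℂ (fun β : Root => LinearMap.toSpanSingleton ℂ E6 (rootBracket α β))))

/-- The bracket determined by `[H, H] = 0`, `[h, E_α] = -[E_α, h] = (h, α) E_α`,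
`[E_α, E_{-α}] = -α`, and `[E_α, E_β] = F(α,β) E_{α+β}` if `α + β` is a root, `0` if `α + β` is
neither a root nor zero. -/
instance : Bracket E6 E6 where
  bracket x y := cartanAct (hPart x) (rPart y) - cartanAct (hPart y) (rPart x)
    + rootPairing (rPart x) (rPart y)

lemma bracket_def (x y : E6) : ⁅x, y⁆ = cartanAct (hPart x) (rPart y)
    - cartanAct (hPart y) (rPart x) + rootPairing (rPart x) (rPart y) := rfl

@[simp] lemma hPart_ofH (h : Fin 6 → ℂ) : hPart (ofH h) = h := rfl
@[simp] lemma rPart_ofH (h : Fin 6 → ℂ) : rPart (ofH h) = 0 := rfl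
@[simp] lemma hPart_E (α : Root) : hPart (E α) = 0 := rfl
@[simp] lemma rPart_E (α : Root) : rPart (E α) = Finsupp.single α 1 := rfl

@[simp] lemma cartanAct_single (h : Fin 6 → ℂ) (β : Root) (b : ℂ) :
    cartanAct h (Finsupp.single β b) = (hform β.1 h * b) • E β := by
  simp [cartanAct, mul_comm, smul_smul]

@[simp] lemma rootPairing_single (α β : Root) :
    rootPairing (Finsupp.single α 1) (Finsupp.single β 1) = rootBracket α β := by
  simp [rootPairing]

lemma E6_induction {p : E6 → Prop} (hH : ∀ h, p (ofH h)) (hE : ∀ α, p (E α))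
    (hadd : ∀ x y, p x → p y → p (x + y)) (hsmul : ∀ (a : ℂ) x, p x → p (a • x)) (x : E6) :
    p x := by
  have hx : x = ofH (hPart x) + ofR (rPart x) := by
    rcases x with ⟨h, r⟩
    exact Prod.ext (add_zero h).symm (zero_add r).symm
  rw [hx]
  refine hadd _ _ (hH _) ?_
  induction rPart x using Finsupp.induction_linear with
  | zero => simpa using hsmul 0 _ (hH 0)
  | add f g hf hg => rw [map_add]; exact hadd _ _ hf hg
  | single α a =>
    have : ofR (Finsupp.single α a) = a • E α := by
      rw [E, ← map_smul, Finsupp.smul_single, smul_eq_mul, mul_one]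
    rw [this]
    exact hsmul _ _ (hE α)

lemma br_add (x y z : E6) : ⁅x, y + z⁆ = ⁅x, y⁆ + ⁅x, z⁆ := by
  simp only [bracket_def, map_add, LinearMap.add_apply]; abel

lemma add_br (x y z : E6) : ⁅x + y, z⁆ = ⁅x, z⁆ + ⁅y, z⁆ := by
  simp only [bracket_def, map_add, LinearMap.add_apply]; abel

lemma br_smul (a : ℂ) (x y : E6) : ⁅x, a • y⁆ = a • ⁅x, y⁆ := by
  simp only [bracket_def, map_smul, LinearMap.smul_apply, smul_sub, smul_add]

lemma smul_br (a : ℂ) (x y : E6) : ⁅a • x, y⁆ = a • ⁅x, y⁆ := by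
  simp only [bracket_def, map_smul, LinearMap.smul_apply, smul_sub, smul_add]

lemma br_HH (h k : Fin 6 → ℂ) : ⁅ofH h, ofH k⁆ = 0 := by simp [bracket_def]

lemma br_HE (h : Fin 6 → ℂ) (α : Root) : ⁅ofH h, E α⁆ = hform α.1 h • E α := by
  simp [bracket_def]

lemma br_EH (h : Fin 6 → ℂ) (α : Root) : ⁅E α, ofH h⁆ = -(hform α.1 h • E α) := by
  simp [bracket_def]

lemma br_EE (α β : Root) : ⁅E α, E β⁆ = rootBracket α β := by
  simp [bracket_def]

lemma Ev_root (α : Root) : Ev α.1 = E α := by simp [Ev, α.2]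

lemma Ev_of_ne {v : Lat} (h : form v v ≠ 2) : Ev v = 0 := by simp [Ev, h]

lemma hform_toH (u v : Lat) : hform v (toH u) = (form u v : ℂ) := by
  simp [hform, toH, form, Fin.sum_univ_succ, Pi.single_apply]
  ring

lemma hform_add (u v : Lat) (h : Fin 6 → ℂ) : hform (u + v) h = hform u h + hform v h := by
  simp [hform, form_add_right, add_mul, Finset.sum_add_distrib]

lemma br_H_Ev (h : Fin 6 → ℂ) (v : Lat) : ⁅ofH h, Ev v⁆ = hform v h • Ev v := by
  by_cases hv : form v v = 2
  · simp [Ev, hv, br_HE]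
  · simp [Ev, hv, bracket_def]

lemma rootBracket_self (α : Root) : rootBracket α α = 0 := by
  have h1 := Root.add_eq_zero_iff α α
  have h2 := Root.add_root_iff α α
  rw [α.2] at h1 h2
  rw [rootBracket, if_neg (by rw [h1]; norm_num), Ev_of_ne (by rw [Ne, h2]; norm_num), smul_zero]

lemma rootBracket_swap (α β : Root) : rootBracket β α = -rootBracket α β := by
  have hc : β.1 + α.1 = α.1 + β.1 := add_comm _ _
  unfold rootBracket
  rw [hc]
  by_cases h0 : α.1 + β.1 = 0
  · rw [if_pos h0, if_pos h0]
    have : β.1 = -α.1 := by rw [eq_neg_iff_add_eq_zero, add_comm]; exact h0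
    rw [this]
    have : toH (-α.1) = -toH α.1 := by funext i; simp [toH]
    rw [this, map_neg]
  · rw [if_neg h0, if_neg h0]
    by_cases h1 : form α.1 β.1 = -1
    · rw [F_swap_of_odd (x := α.1) (y := β.1) (by omega)]
      push_cast
      rw [neg_smul]
    · rw [Ev_of_ne (by rw [Ne, Root.add_root_iff]; exact h1)]
      simp

lemma br_swap (x y : E6) : ⁅y, x⁆ = -⁅x, y⁆ := by
  induction x using E6_induction with
  | hadd a b ha hb => rw [br_add, add_br, ha, hb]; abel
  | hsmul a b hb => rw [br_smul, smul_br, hb, smul_neg]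
  | hH h =>
    induction y using E6_induction with
    | hadd a b ha hb => rw [br_add, add_br, ha, hb]; abel
    | hsmul a b hb => rw [br_smul, smul_br, hb, smul_neg]
    | hH k => simp [br_HH]
    | hE α => rw [br_HE, br_EH]
  | hE β =>
    induction y using E6_induction with
    | hadd a b ha hb => rw [br_add, add_br, ha, hb]; abel
    | hsmul a b hb => rw [br_smul, smul_br, hb, smul_neg]
    | hH k => rw [br_HE, br_EH, neg_neg]
    | hE α => rw [br_EE, br_EE, rootBracket_swap]

lemma br_self (x : E6) : ⁅x, x⁆ = 0 := by
  have h := br_swap x x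
  have h2 : (2 : ℂ) • ⁅x, x⁆ = 0 := by
    rw [two_smul]; nth_rewrite 1 [h]; exact neg_add_cancel _
  exact (smul_eq_zero.1 h2).resolve_left two_ne_zero

/-- The Jacobi identity for three elements. -/
def Jac (x y z : E6) : Prop := ⁅x, ⁅y, z⁆⁆ = ⁅⁅x, y⁆, z⁆ + ⁅y, ⁅x, z⁆⁆

lemma Jac.swap12 {x y z : E6} (h : Jac x y z) : Jac y x z := by
  unfold Jac at *
  rw [h, br_swap x y]
  have : ⁅-⁅x, y⁆, z⁆ = -⁅⁅x, y⁆, z⁆ := by simpa using smul_br (-1) ⁅x, y⁆ z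
  rw [this]; abel

lemma br_neg (x y : E6) : ⁅x, -y⁆ = -⁅x, y⁆ := by simpa using br_smul (-1) x y
lemma neg_br (x y : E6) : ⁅-x, y⁆ = -⁅x, y⁆ := by simpa using smul_br (-1) x y
lemma br_zero (x : E6) : ⁅x, (0 : E6)⁆ = 0 := by simpa using br_smul 0 x 0
lemma zero_br (x : E6) : ⁅(0 : E6), x⁆ = 0 := by simpa using smul_br 0 0 x

lemma Jac.swap23 {x y z : E6} (h : Jac x y z) : Jac x z y := by
  unfold Jac at *
  rw [br_swap y z, br_neg, h, br_swap ⁅x, y⁆ z, br_swap ⁅x, z⁆ y]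
  abel

lemma jac_HHE (h k : Fin 6 → ℂ) (α : Root) : Jac (ofH h) (ofH k) (E α) := by
  unfold Jac
  rw [br_HE, br_smul, br_HE, br_HH, zero_br, br_smul, br_HE, zero_add, smul_smul, smul_smul,
    mul_comm]

lemma jac_HEE (h : Fin 6 → ℂ) (α β : Root) : Jac (ofH h) (E α) (E β) := by
  unfold Jac
  rw [br_HE, br_HE, smul_br, br_smul, br_EE, ← add_smul, ← hform_add, rootBracket]
  by_cases h0 : α.1 + β.1 = 0
  · rw [if_pos h0, br_neg, br_HH, h0]
    simp [hform, form]
  · rw [if_neg h0, br_smul, br_H_Ev, smul_comm]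

lemma rootBracket_of_ne {α β : Root} (h1 : form α.1 β.1 ≠ -1) (h2 : form α.1 β.1 ≠ -2) :
    rootBracket α β = 0 := by
  rw [rootBracket, if_neg (by rwa [Root.add_eq_zero_iff]), Ev_of_ne (by rwa [Ne, Root.add_root_iff]),
    smul_zero]

lemma rootBracket_of_eq {α β γ : Root} (h : γ.1 = α.1 + β.1) :
    rootBracket α β = (F α.1 β.1 : ℂ) • E γ := by
  have h1 : form (α.1 + β.1) (α.1 + β.1) = 2 := by rw [← h]; exact γ.2
  rw [rootBracket, if_neg, ← h, Ev_root]
  intro h0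
  rw [h0, form_zero_left] at h1
  omega

/-- The negative of a root. -/
def Root.neg (α : Root) : Root := ⟨-α.1, by rw [form_neg_left, form_neg_right, neg_neg]; exact α.2⟩

lemma rootBracket_neg (α : Root) : rootBracket α α.neg = -ofH (toH α.1) := by
  rw [rootBracket, if_pos]
  simp [Root.neg]

lemma eq_neg_of_form {α β : Root} (h : form α.1 β.1 = -2) : β = α.neg := by
  apply Subtype.ext
  have := (Root.add_eq_zero_iff α β).2 h
  exact (eq_neg_of_add_eq_zero_right this)

/-- The Jacobi identity when two of the three roots are opposite. -/
lemma jac_neg (α β : Root) : Jac (E α) (E β) (E β.neg) := by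
  unfold Jac
  have hb : F β.1 β.1 = -1 := F_self β
  have hab : form α.1 β.neg.1 = -form α.1 β.1 := form_neg_right _ _
  rw [br_EE β, rootBracket_neg, br_neg, br_EH, hform_toH, neg_neg, br_EE, br_EE, form_comm β.1]
  have hge := α.form_ge β
  have hge' := α.form_ge β.neg
  rw [hab] at hge'
  have hcases : form α.1 β.1 = -2 ∨ form α.1 β.1 = -1 ∨ form α.1 β.1 = 0 ∨ form α.1 β.1 = 1 ∨
      form α.1 β.1 = 2 := by omega
  rcases hcases with h | h | h | h | h
  · have hα : β = α.neg := eq_neg_of_form h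
    subst hα
    have hn : α.neg.neg = α := Subtype.ext (neg_neg _)
    rw [h, rootBracket_neg, hn, rootBracket_self, br_zero, add_zero, neg_br, br_HE, hform_toH, α.2]
    push_cast
    rw [neg_smul]
  · obtain ⟨γ, hγ⟩ : ∃ γ : Root, γ.1 = α.1 + β.1 := ⟨⟨_, (Root.add_root_iff α β).2 h⟩, rfl⟩
    have hα : α.1 = γ.1 + β.neg.1 := by simp [hγ, Root.neg]
    rw [h, rootBracket_of_eq hγ, rootBracket_of_ne (β := β.neg) (by omega) (by omega), br_zero, add_zero,
      smul_br, br_EE, rootBracket_of_eq hα, smul_smul]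
    congr 1
    have : F γ.1 β.neg.1 = F γ.1 β.1 := F_neg_right _ _
    rw [this, hγ, F_add_left, hb]
    have := F_sq α.1 β.1
    push_cast
    have : (F α.1 β.1 : ℂ) * F α.1 β.1 = 1 := by exact_mod_cast this
    linear_combination this
  · rw [h, rootBracket_of_ne (by omega) (by omega), rootBracket_of_ne (by omega) (by omega)]
    simp [zero_br, br_zero]
  · obtain ⟨γ, hγ⟩ : ∃ γ : Root, γ.1 = α.1 + β.neg.1 :=
      ⟨⟨_, (Root.add_root_iff α β.neg).2 (by omega)⟩, rfl⟩
    have hα : α.1 = β.1 + γ.1 := by simp [hγ, Root.neg]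
    rw [h, rootBracket_of_eq hγ, rootBracket_of_ne (β := β) (by omega) (by omega), zero_br, zero_add,
      br_smul, br_EE, rootBracket_of_eq hα, smul_smul]
    congr 1
    have h1 : F α.1 β.neg.1 = F α.1 β.1 := F_neg_right _ _
    have h2 : F β.1 β.neg.1 = F β.1 β.1 := F_neg_right _ _
    have h3 : F β.1 α.1 = -F α.1 β.1 := F_swap_of_odd (by omega)
    rw [h1, hγ, F_add_right, h2, h3, hb]
    have : (F α.1 β.1 : ℂ) * F α.1 β.1 = 1 := by exact_mod_cast F_sq α.1 β.1
    push_cast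
    linear_combination -this
  · have hα : β.neg = α.neg := eq_neg_of_form (by omega)
    have hα : β = α := Subtype.ext (neg_injective (congrArg Subtype.val hα))
    subst hα
    rw [h, rootBracket_neg, rootBracket_self, zero_br, zero_add, br_neg, br_EH, hform_toH, β.2, neg_neg]

lemma br_E_root {α β γ δ : Root} (hδ : δ.1 = β.1 + γ.1) :
    ⁅E α, rootBracket β γ⁆ = (F β.1 γ.1 : ℂ) • rootBracket α δ := by
  rw [rootBracket_of_eq hδ, br_smul, br_EE]

lemma br_E_rootBracket {α β γ : Root} (h2 : form β.1 γ.1 ≠ -2)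
    (h0 : α.1 + β.1 + γ.1 ≠ 0) :
    ⁅E α, rootBracket β γ⁆ = (if form β.1 γ.1 = -1 then
      (F α.1 β.1 * F α.1 γ.1 * F β.1 γ.1 : ℂ) else 0) • Ev (α.1 + β.1 + γ.1) := by
  by_cases h : form β.1 γ.1 = -1
  · obtain ⟨δ, hδ⟩ : ∃ δ : Root, δ.1 = β.1 + γ.1 := ⟨⟨_, (Root.add_root_iff β γ).2 h⟩, rfl⟩
    rw [if_pos h, br_E_root hδ, rootBracket, hδ, if_neg (by rwa [← add_assoc]), F_add_right, smul_smul,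
      add_assoc]
    congr 1
    push_cast
    ring
  · rw [if_neg h, rootBracket_of_ne h h2, br_zero, zero_smul]

lemma jac_EEE (α β γ : Root) : Jac (E α) (E β) (E γ) := by
  by_cases h1 : form α.1 β.1 = -2
  · rw [eq_neg_of_form h1]
    exact (jac_neg γ α).swap12.swap23
  by_cases h2 : form β.1 γ.1 = -2
  · rw [eq_neg_of_form h2]
    exact jac_neg α β
  by_cases h3 : form α.1 γ.1 = -2
  · rw [eq_neg_of_form h3]
    exact (jac_neg β α).swap12
  have h1' := α.form_ge β
  have h2' := β.form_ge γ
  have h3' := α.form_ge γ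
  unfold Jac
  rw [br_EE, br_EE, br_EE, br_swap (E γ)]
  by_cases h0 : α.1 + β.1 + γ.1 = 0
  · have e1 : γ.1 = -(α.1 + β.1) := eq_neg_of_add_eq_zero_right h0
    have e2 := γ.2
    rw [e1, form_neg_left, form_neg_right, neg_neg, Root.add_root_iff] at e2
    have e3 : form α.1 γ.1 = -1 := by rw [e1, form_neg_right, form_add_right, α.2, e2]; norm_num
    have e4 : form β.1 γ.1 = -1 := by
      rw [e1, form_neg_right, form_add_right, β.2, form_comm, e2]; norm_num
    have d1 : α.neg.1 = β.1 + γ.1 := by simp [Root.neg, e1]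
    have d2 : β.neg.1 = α.1 + γ.1 := by simp [Root.neg, e1]
    have d3 : γ.neg.1 = α.1 + β.1 := by simp [Root.neg, e1]
    rw [br_E_root d1, br_E_root d2, br_E_root d3, rootBracket_neg, rootBracket_neg, rootBracket_neg]
    have f1 : F β.1 γ.1 = F α.1 β.1 := by
      rw [e1, F_neg_right, F_add_right, F_self, F_swap_of_odd (x := α.1) (y := β.1) (by omega)]
      ring
    have f2 : F α.1 γ.1 = -F α.1 β.1 := by
      rw [e1, F_neg_right, F_add_right, F_self]
      ring
    have f3 : toH γ.1 = -toH α.1 - toH β.1 := by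
      rw [e1]; funext i; simp [toH]; ring
    rw [f1, f2, f3, map_sub, map_neg]
    push_cast
    module
  · rw [br_E_rootBracket h2 h0,
      br_E_rootBracket (α := γ) (β := α) (γ := β) h1
        (by rwa [add_assoc, add_comm]),
      br_E_rootBracket (α := β) (β := α) (γ := γ) h3
        (by rwa [add_comm β.1])]
    have a1 : γ.1 + α.1 + β.1 = α.1 + β.1 + γ.1 := by abel
    have a2 : β.1 + α.1 + γ.1 = α.1 + β.1 + γ.1 := by abel
    rw [a1, a2, ← neg_smul, ← add_smul]
    by_cases hr : form (α.1 + β.1 + γ.1) (α.1 + β.1 + γ.1) = 2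
    · congr 1
      rw [form_sum_self, form_sum_self, form_add_left, γ.2, α.2, β.2] at hr
      have sAB : ∀ {x y : Lat}, form x y = -1 → F y x = -F x y := fun h => F_swap_of_odd (by omega)
      have sAB0 : ∀ {x y : Lat}, form x y = 0 → F y x = F x y := fun h => F_swap_of_even (by omega)
      have nn : ∀ x y : Root, form x.1 y.1 ≠ 2 ∨ x = y := by
        intro x y
        by_cases h : form x.1 y.1 = 2
        · right
          have : y.neg = x.neg := eq_neg_of_form (by
            have : form x.1 y.neg.1 = -form x.1 y.1 := form_neg_right _ _
            omega)
          exact (Subtype.ext (neg_injective (congrArg Subtype.val this))).symm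
        · exact Or.inl h
      have u1 : form α.1 β.1 ≠ 2 := by
        intro h
        rcases nn α β with h' | h'
        · exact h' h
        · subst h'; omega
      have u2 : form β.1 γ.1 ≠ 2 := by
        intro h
        rcases nn β γ with h' | h'
        · exact h' h
        · subst h'; omega
      have u3 : form α.1 γ.1 ≠ 2 := by
        intro h
        rcases nn α γ with h' | h'
        · exact h' h
        · subst h'; rw [form_comm β.1] at *; omega
      have l1 : form α.1 β.1 ≤ 2 := by
        have := α.form_ge β.neg
        have h : form α.1 β.neg.1 = -form α.1 β.1 := form_neg_right _ _
        omega
      have l2 : form β.1 γ.1 ≤ 2 := by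
        have := β.form_ge γ.neg
        have h : form β.1 γ.neg.1 = -form β.1 γ.1 := form_neg_right _ _
        omega
      have l3 : form α.1 γ.1 ≤ 2 := by
        have := α.form_ge γ.neg
        have h : form α.1 γ.neg.1 = -form α.1 γ.1 := form_neg_right _ _
        omega
      have hc : (form α.1 β.1 = -1 ∧ form β.1 γ.1 = -1 ∧ form α.1 γ.1 = 0) ∨
          (form α.1 β.1 = -1 ∧ form β.1 γ.1 = 0 ∧ form α.1 γ.1 = -1) ∨
          (form α.1 β.1 = 0 ∧ form β.1 γ.1 = -1 ∧ form α.1 γ.1 = -1) := by omega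
      rcases hc with ⟨c1, c2, c3⟩ | ⟨c1, c2, c3⟩ | ⟨c1, c2, c3⟩
      · rw [if_pos c2, if_pos c1, if_neg (by omega), sAB0 c3, sAB c2]
        push_cast; ring
      · rw [if_neg (by omega), if_pos c1, if_pos c3, sAB c3, sAB0 c2, sAB c1]
        push_cast; ring
      · rw [if_pos c2, if_neg (by omega), if_pos c3, sAB0 c1]
        ring
    · rw [Ev_of_ne hr, smul_zero, smul_zero]

lemma Jac.of_all {x y : E6} (hH : ∀ h, Jac x y (ofH h)) (hE : ∀ α, Jac x y (E α)) (z : E6) :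
    Jac x y z := by
  unfold Jac at *
  induction z using E6_induction with
  | hH h => exact hH h
  | hE α => exact hE α
  | hadd a b ha hb => rw [br_add, br_add, br_add, br_add, br_add, ha, hb]; abel
  | hsmul a b hb => rw [br_smul, br_smul, br_smul, br_smul, br_smul, hb, smul_add]

lemma jacobi (x y z : E6) : Jac x y z := by
  refine Jac.of_all (fun h => ?_) (fun α => ?_) z
  · refine (Jac.of_all (fun k => ?_) (fun β => ?_) y).swap23
    · refine (Jac.of_all (fun l => ?_) (fun γ => ?_) x).swap12.swap23.swap12
      · unfold Jac; simp [br_HH, br_zero, zero_br]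
      · exact jac_HHE k h γ
    · refine (Jac.of_all (fun l => ?_) (fun γ => ?_) x).swap12.swap23.swap12
      · exact (jac_HHE h l β).swap23.swap12
      · exact (jac_HEE h β γ).swap12
  · refine (Jac.of_all (fun k => ?_) (fun β => ?_) y).swap23
    · refine (Jac.of_all (fun l => ?_) (fun γ => ?_) x).swap12.swap23.swap12
      · exact (jac_HHE k l α).swap23
      · exact (jac_HEE k α γ)
    · refine (Jac.of_all (fun l => ?_) (fun γ => ?_) x).swap12.swap23.swap12
      · exact (jac_HEE l β α).swap12.swap23
      · exact (jac_EEE β α γ)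

instance : LieRing E6 where
  add_lie := add_br
  lie_add := br_add
  lie_self := br_self
  leibniz_lie := jacobi

instance : LieAlgebra ℂ E6 where
  lie_smul := br_smul

end E6Ext

end

noncomputable section

namespace E6Ext

/-- Row and column indices of `10 × 10` matrices: `inl i` stands for `i + 1` and `inr i` for
`5 + (i + 1)`. -/
abbrev Idx := Fin 5 ⊕ Fin 5

/-- The Lie algebra `o(10, ℂ)` of matrices that are skew for the form with matrix
`((0, 1), (1, 0))`. -/
abbrev o10 := LieAlgebra.Orthogonal.typeD (Fin 5) ℂ

lemma mem_o10_iff (M : Matrix Idx Idx ℂ) :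
    M ∈ o10 ↔ ∀ a b : Idx, M b.swap a.swap = -M a b := by
  have key : M ∈ o10 ↔ ∀ a b : Idx, M b.swap a = -M a.swap b := by
    rw [o10, LieAlgebra.Orthogonal.typeD, mem_skewAdjointMatricesLieSubalgebra,
      mem_skewAdjointMatricesSubmodule, Matrix.IsSkewAdjoint, Matrix.IsAdjointPair,
      ← Matrix.ext_iff]
    refine forall_congr' fun a => forall_congr' fun b => ?_
    have h1 : (Matrix.transpose M * LieAlgebra.Orthogonal.JD (Fin 5) ℂ) a b = M b.swap a := by
      rcases b with b | b <;>
      simp [Matrix.mul_apply, LieAlgebra.Orthogonal.JD, Matrix.one_apply]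
    have h2 : (LieAlgebra.Orthogonal.JD (Fin 5) ℂ * (-M)) a b = -M a.swap b := by
      rcases a with a | a <;>
      simp [Matrix.mul_apply, LieAlgebra.Orthogonal.JD, Matrix.one_apply]
    rw [h1, h2]
  rw [key]
  constructor
  · intro h a b
    simpa using h a.swap b
  · intro h a b
    simpa using h a.swap b

/-- The element `E_{a,b} - E_{b',a'}` of `o(10, ℂ)`, where `i' = 5 + i` and `(5 + i)' = i`. -/
def so (a b : Idx) : o10 :=
  ⟨Matrix.single a b 1 - Matrix.single b.swap a.swap 1, by
    rw [mem_o10_iff]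
    intro c d
    simp only [Matrix.sub_apply, Matrix.single_apply, neg_sub]
    have e1 : (a = d.swap ∧ b = c.swap) ↔ (b.swap = c ∧ a.swap = d) := by
      rw [and_comm]
      refine and_congr ⟨?_, ?_⟩ ⟨?_, ?_⟩ <;> intro h
      · rw [h, Sum.swap_swap]
      · rw [← h, Sum.swap_swap]
      · rw [h, Sum.swap_swap]
      · rw [← h, Sum.swap_swap]
    have e2 : (b.swap = d.swap ∧ a.swap = c.swap) ↔ (a = c ∧ b = d) := by
      rw [and_comm]
      refine and_congr ⟨?_, ?_⟩ ⟨?_, ?_⟩ <;> intro h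
      · simpa using congrArg Sum.swap h
      · rw [h]
      · simpa using congrArg Sum.swap h
      · rw [h]
    simp only [e1, e2]⟩

/-- The weight of the `a`-th standard basis vector in terms of `ε_1, …, ε_5`. -/
def wt : Idx → Fin 5 → ℤ
  | .inl i => Pi.single i 1
  | .inr i => -Pi.single i 1

/-- The element `∑ e_i ε_i` of the root lattice of `D₅` in terms of `α_1, …, α_5`, where
`α_1 = ε_1 - ε_2`, `α_3 = ε_2 - ε_3`, `α_4 = ε_3 - ε_4`, `α_5 = ε_4 - ε_5`, `α_2 = ε_4 + ε_5`. -/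
def ofEps (e : Fin 5 → ℤ) : Lat :=
  ![e 0, (e 0 + e 1 + e 2 + e 3 + e 4) / 2, e 0 + e 1, e 0 + e 1 + e 2,
    (e 0 + e 1 + e 2 + e 3 - e 4) / 2, 0]

/-- The weight of `E_{a,b} - E_{b',a'}`; it is a root if `a ≠ b` and `a ≠ b'`. -/
def diff (a b : Idx) : Lat := ofEps (wt a - wt b)

/-- Signs `s_{a,b}` with `ν(E_{a,b} - E_{b',a'}) = s_{a,b} E_γ` for the root `γ` of
`E_{a,b} - E_{b',a'}`, when `a ≠ b, b'`. -/
def nuSign (a b : Idx) : ℤ :=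
  Matrix.fromBlocks
    !![0, 1, -1, 1, 1; -1, 0, 1, -1, -1; 1, -1, 0, 1, 1; -1, 1, -1, 0, 1; -1, 1, -1, -1, 0]
    !![0, -1, 1, 1, -1; 1, 0, -1, -1, 1; -1, 1, 0, 1, -1; -1, 1, -1, 0, 1; 1, -1, 1, -1, 0]
    !![0, -1, 1, 1, -1; 1, 0, -1, -1, 1; -1, 1, 0, 1, -1; -1, 1, -1, 0, 1; 1, -1, 1, -1, 0]
    !![0, 1, -1, 1, 1; -1, 0, 1, -1, -1; 1, -1, 0, 1, 1; -1, 1, -1, 0, 1; -1, 1, -1, -1, 0]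
    a b

set_option maxRecDepth 100000

lemma diff_add (a b c : Idx) : diff a b + diff b c = diff a c := by
  revert a b c; decide +kernel

lemma nuSign_swap (a b : Idx) : nuSign b.swap a.swap = -nuSign a b := by
  revert a b; decide +kernel

lemma nuSign_neg (a b : Idx) : nuSign b a = -nuSign a b := by
  revert a b; decide +kernel

lemma form_diff (a b : Idx) : form (diff a b) (diff a b) = 2 ↔ a ≠ b ∧ a ≠ b.swap := by
  revert a b; decide +kernel

lemma nuSign_sq (a b : Idx) (h : a ≠ b ∧ a ≠ b.swap) : nuSign a b * nuSign a b = 1 := by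
  revert a b; decide +kernel

lemma nuSign_mul (a b c : Idx) (h1 : a ≠ b ∧ a ≠ b.swap) (h2 : b ≠ c ∧ b ≠ c.swap)
    (h3 : a ≠ c ∧ a ≠ c.swap) :
    nuSign a b * nuSign b c = F (diff a b) (diff b c) * nuSign a c := by
  revert a b c; decide +kernel

lemma diff_swap (a b : Idx) : diff b.swap a.swap = diff a b := by
  revert a b; decide +kernel

/-- The Gram matrix of the weights of the standard basis vectors. -/
def gram (a b : Idx) : ℤ := if a = b then 1 else if a = b.swap then -1 else 0

lemma form_diff_aux (a c : Idx) : form (diff a (.inl 0)) (diff c (.inl 0)) =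
    gram a c - gram a (.inl 0) - gram (.inl 0) c + 1 := by
  revert a c; decide +kernel

lemma form_diff_diff (a b c d : Idx) : form (diff a b) (diff c d) =
    gram a c - gram a d - gram b c + gram b d := by
  have h1 := diff_add a b (.inl 0)
  have h2 := diff_add c d (.inl 0)
  have k1 := form_diff_aux a c
  have k2 := form_diff_aux a d
  have k3 := form_diff_aux b c
  have k4 := form_diff_aux b d
  rw [← h1, ← h2, form_add_left, form_add_right, form_add_right] at k1
  rw [← h1, form_add_left] at k2
  rw [← h2, form_add_right] at k3
  omega

lemma diff_inj (a b c d : Idx) (h : a ≠ b ∧ a ≠ b.swap) (h' : diff c d = diff a b) :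
    (c = a ∧ d = b) ∨ (c = b.swap ∧ d = a.swap) := by
  have h2 := (form_diff a b).2 h
  have h3 : c ≠ d ∧ c ≠ d.swap := by rw [← form_diff, h']; exact h2
  nth_rewrite 2 [← h'] at h2
  rw [form_diff_diff] at h2
  have hs : ∀ x : Idx, x.swap.swap = x := Sum.swap_swap
  unfold gram at h2
  grind

lemma form_diff_neg (a b c d : Idx) (h0 : form (diff a b) (diff c d) < 0) :
    b = c ∨ d = a ∨ b = d.swap ∨ c.swap = a := by
  rw [form_diff_diff] at h0
  have hs : ∀ x : Idx, x.swap.swap = x := Sum.swap_swap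
  unfold gram at h0
  grind

/-- `∑ h_i ε_i`-coordinates: for `h ∈ H` with `α_6`-coefficient `0`, the numbers `e_r` with
`ν⁻¹(h) = ∑ e_r (E_{r,r} - E_{5+r,5+r})`. -/
def epsCoord : (Fin 6 → ℂ) →ₗ[ℂ] (Fin 5 → ℂ) where
  toFun h := ![h 0, h 2 - h 0, h 3 - h 2, h 1 + h 4 - h 3, h 1 - h 4]
  map_add' h k := by
    funext i; fin_cases i <;> simp <;> ring
  map_smul' a h := by
    funext i; fin_cases i <;> simp <;> ring

/-- `α̂ = 2α_1 + 3α_2 + 4α_3 + 6α_4 + 5α_5 + 4α_6`, which spans the centre of `𝒢_0`. -/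
def alphaHat : Fin 6 → ℂ := ![2, 3, 4, 6, 5, 4]

/-- The `𝒢^{D₅}`-component of `h ∈ H = (H ∩ 𝒢^{D₅}) ⊕ ℂ α̂`. -/
def cartanD5 : (Fin 6 → ℂ) →ₗ[ℂ] (Fin 6 → ℂ) :=
  LinearMap.id - ((1 / 4 : ℂ) • LinearMap.proj 5).smulRight alphaHat

/-- The diagonal entry at `a` of `ν⁻¹` of the `𝒢^{D₅}`-component of `h`. -/
def diagEntry : Idx → (Fin 6 → ℂ) →ₗ[ℂ] ℂ
  | .inl i => (LinearMap.proj i).comp (epsCoord.comp cartanD5)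
  | .inr i => -(LinearMap.proj i).comp (epsCoord.comp cartanD5)

/-- The linear map `𝒢^{E₆} → 𝒢^{D₅} → o(10, ℂ)`, the projection along `ℂ α̂ ⊕ 𝒢_+ ⊕ 𝒢_-` followed
by `ν⁻¹`. -/
def nuInv : E6 →ₗ[ℂ] o10 where
  toFun u := ⟨Matrix.of fun a b => if a = b then diagEntry a (hPart u)
      else nuSign a b * coef (diff a b) u, by
    rw [mem_o10_iff]
    intro a b
    by_cases h : a = b
    · subst h
      rcases a with a | a <;> simp [diagEntry]
    · have h' : b.swap ≠ a.swap := fun h' => h (by simpa using (congrArg Sum.swap h').symm)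
      simp only [Matrix.of_apply, if_neg h, if_neg h', nuSign_swap, diff_swap]
      push_cast
      ring⟩
  map_add' u v := by
    apply Subtype.ext
    ext a b
    by_cases h : a = b <;> simp [h, mul_add]
  map_smul' c u := by
    apply Subtype.ext
    ext a b
    by_cases h : a = b <;> simp [h]; ring

lemma nuInv_apply (u : E6) (a b : Idx) : (nuInv u : Matrix Idx Idx ℂ) a b =
    if a = b then diagEntry a (hPart u) else nuSign a b * coef (diff a b) u := rfl

lemma so_apply (a b c d : Idx) : (so a b : Matrix Idx Idx ℂ) c d =
    (if a = c ∧ b = d then 1 else 0) - (if b.swap = c ∧ a.swap = d then 1 else 0) := by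
  simp [so, Matrix.single_apply]

lemma smul_o10_apply (x : ℂ) (M : o10) (a b : Idx) :
    ((x • M : o10) : Matrix Idx Idx ℂ) a b = x * (M : Matrix Idx Idx ℂ) a b := rfl

lemma sub_o10_apply (M N : o10) (a b : Idx) : ((M - N : o10) : Matrix Idx Idx ℂ) a b =
    (M : Matrix Idx Idx ℂ) a b - (N : Matrix Idx Idx ℂ) a b := rfl

lemma sub_o10_coe (M N : o10) : ((M - N : o10) : Matrix Idx Idx ℂ) =
    (M : Matrix Idx Idx ℂ) - (N : Matrix Idx Idx ℂ) := rfl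

lemma lie_o10_coe (M N : o10) : ((⁅M, N⁆ : o10) : Matrix Idx Idx ℂ) =
    (M : Matrix Idx Idx ℂ) * (N : Matrix Idx Idx ℂ)
      - (N : Matrix Idx Idx ℂ) * (M : Matrix Idx Idx ℂ) := rfl

lemma coef_E (v : Lat) (α : Root) : coef v (E α) = if v = α.1 then 1 else 0 := by
  unfold coef
  by_cases h : form v v = 2
  · simp [h, Finsupp.single_apply, Subtype.ext_iff, eq_comm]
  · have : v ≠ α.1 := fun h' => h (h' ▸ α.2)
    simp [h, this]

lemma coef_ofH (v : Lat) (h : Fin 6 → ℂ) : coef v (ofH h) = 0 := by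
  unfold coef
  split_ifs <;> simp

lemma nuInv_E {a b : Idx} (h : a ≠ b ∧ a ≠ b.swap) {α : Root} (hα : α.1 = diff a b) :
    nuInv (E α) = (nuSign a b : ℂ) • so a b := by
  apply Subtype.ext
  ext c d
  have hs : ∀ x : Idx, x.swap.swap = x := Sum.swap_swap
  rw [nuInv_apply, coef_E, hα]
  rw [smul_o10_apply, so_apply, hPart_E, map_zero]
  by_cases h1 : c = a ∧ d = b
  · obtain ⟨rfl, rfl⟩ := h1
    rw [if_neg h.1, if_pos rfl, if_pos ⟨rfl, rfl⟩, if_neg (by grind)]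
    ring
  · by_cases h2 : c = b.swap ∧ d = a.swap
    · obtain ⟨rfl, rfl⟩ := h2
      rw [if_neg (by grind), if_pos (diff_swap a b), if_neg (by grind), if_pos ⟨rfl, rfl⟩, nuSign_swap]
      push_cast
      ring
    · have h3 : diff c d ≠ diff a b := fun h' => by
        rcases diff_inj a b c d h h' with h'' | h''
        · exact h1 h''
        · exact h2 h''
      have g1 : ¬(a = c ∧ b = d) := fun h' => h1 ⟨h'.1.symm, h'.2.symm⟩
      have g2 : ¬(b.swap = c ∧ a.swap = d) := fun h' => h2 ⟨h'.1.symm, h'.2.symm⟩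
      rw [if_neg h3, if_neg g1, if_neg g2]
      simp

lemma diagEntry_sub (a b : Idx) (h : Fin 6 → ℂ) :
    diagEntry a h - diagEntry b h = hform (diff a b) h := by
  have h1 : ∀ a : Idx, diagEntry a h - diagEntry (.inl 0) h = hform (diff a (.inl 0)) h := by
    intro a
    rcases a with a | a <;> fin_cases a <;>
    simp [diagEntry, epsCoord, cartanD5, alphaHat, hform, Fin.sum_univ_succ, form, diff, ofEps, wt,
      Pi.single_apply] <;> ring
  have h2 := hform_add (diff a b) (diff b (.inl 0)) h
  rw [diff_add] at h2
  linear_combination h1 a - h1 b + h2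

lemma nuInv_ofH (h : Fin 6 → ℂ) : (nuInv (ofH h) : Matrix Idx Idx ℂ) =
    Matrix.diagonal fun a => diagEntry a h := by
  ext a b
  rw [nuInv_apply, coef_ofH, hPart_ofH, Matrix.diagonal_apply]
  simp

lemma diagEntry_swap (a : Idx) (h : Fin 6 → ℂ) : diagEntry a.swap h = -diagEntry a h := by
  rcases a with a | a <;> simp [diagEntry]

lemma diagEntry_toH_diff (a b c : Idx) : diagEntry c (toH (diff a b)) = gram c a - gram c b := by
  have h1 := diagEntry_sub c c.swap (toH (diff a b))
  rw [hform_toH, form_diff_diff, diagEntry_swap] at h1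
  have h2 : ∀ x y : Idx, gram x y = gram y x := by decide +kernel
  have h3 : ∀ x y : Idx, gram x.swap y = -gram x y := by decide +kernel
  rw [h2 a c, h2 a, h2 b, h2 b, h3, h3] at h1
  push_cast at h1
  linear_combination h1 / 2

lemma nuInv_ofH_diff (a b : Idx) : nuInv (ofH (toH (diff a b))) = so a a - so b b := by
  apply Subtype.ext
  rw [nuInv_ofH]
  ext c d
  rw [sub_o10_apply, so_apply, so_apply, Matrix.diagonal_apply, diagEntry_toH_diff]
  have hs : ∀ x : Idx, x.swap.swap = x := Sum.swap_swap
  have hn : ∀ x : Idx, x ≠ x.swap := by decide +kernel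
  by_cases hcd : c = d
  · subst hcd
    have k : ∀ x : Idx, (((if x = c ∧ x = c then 1 else 0) - (if x.swap = c ∧ x.swap = c then 1 else 0) : ℂ))
        = (gram c x : ℂ) := by
      intro x
      unfold gram
      have := hn x
      split_ifs <;> first | (norm_num; done) | grind
    rw [if_pos rfl, k, k]
  · rw [if_neg hcd, if_neg (by grind), if_neg (by grind), if_neg (by grind), if_neg (by grind)]
    simp

lemma so_lie_so {p q s : Idx} (h1 : p ≠ q ∧ p ≠ q.swap) (h2 : q ≠ s ∧ q ≠ s.swap) :
    ⁅so p q, so q s⁆ = so p s - if s = p then so q q else 0 := by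
  have hs : ∀ x : Idx, x.swap.swap = x := Sum.swap_swap
  apply Subtype.ext
  rw [lie_o10_coe]
  have e1 : q ≠ s.swap := h2.2
  have e2 : p.swap ≠ q := by grind
  have e3 : s ≠ q.swap := by grind
  have e4 : q.swap ≠ p := by grind
  have hsw : ∀ x y : Idx, x.swap = y.swap ↔ x = y := fun x y => by grind
  simp only [so, mul_sub, sub_mul, Matrix.single_mul_single_same, mul_one]
  rw [Matrix.single_mul_single_of_ne _ _ _ _ e1, Matrix.single_mul_single_of_ne _ _ _ _ e2,
    Matrix.single_mul_single_of_ne _ _ _ _ e3, Matrix.single_mul_single_of_ne _ _ _ _ e4]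
  by_cases hsp : s = p
  · subst hsp
    rw [if_pos rfl, Matrix.single_mul_single_same, Matrix.single_mul_single_same]
    rw [sub_o10_coe]
    simp only [mul_one]
    abel
  · rw [if_neg hsp, Matrix.single_mul_single_of_ne _ _ _ _ hsp,
      Matrix.single_mul_single_of_ne _ _ _ _ (by grind)]
    simp only [sub_zero]
    abel

lemma so_swap (a b : Idx) : so b.swap a.swap = -so a b := by
  apply Subtype.ext
  have hs : ∀ x : Idx, x.swap.swap = x := Sum.swap_swap
  simp [so, hs]

lemma Root.bounds (α : Root) : α.1 3 ∈ Finset.Icc (-3 : ℤ) 3 ∧ α.1 2 ∈ Finset.Icc (-3 : ℤ) 3 ∧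
    α.1 4 ∈ Finset.Icc (-3 : ℤ) 3 ∧
    (3 * α.1 2 - 2 * α.1 3) ^ 2 + (3 * α.1 4 - 2 * α.1 3) ^ 2 + α.1 3 ^ 2 ≤ 12 ∧
    α.1 1 ∈ Finset.Icc (-2 : ℤ) 2 ∧ α.1 0 ∈ Finset.Icc (-2 : ℤ) 2 ∧
    α.1 5 ∈ Finset.Icc (-2 : ℤ) 2 := by
  have h6 := six_form α.1
  rw [α.2] at h6
  have b4 : ∀ x : ℤ, x ^ 2 ≤ 4 → -2 ≤ x ∧ x ≤ 2 := fun x hx => by constructor <;> nlinarith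
  have b12 : ∀ x : ℤ, x ^ 2 ≤ 12 → -3 ≤ x ∧ x ≤ 3 := fun x hx => by constructor <;> nlinarith
  have p1 := sq_nonneg (2 * α.1 0 - α.1 2)
  have p2 := sq_nonneg (2 * α.1 5 - α.1 4)
  have p3 := sq_nonneg (2 * α.1 1 - α.1 3)
  have p4 := sq_nonneg (3 * α.1 2 - 2 * α.1 3)
  have p5 := sq_nonneg (3 * α.1 4 - 2 * α.1 3)
  have p6 := sq_nonneg (α.1 3)
  have q1 := b4 (2 * α.1 0 - α.1 2) (by linarith)
  have q2 := b4 (2 * α.1 5 - α.1 4) (by linarith)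
  have q3 := b4 (2 * α.1 1 - α.1 3) (by linarith)
  have q4 := b12 (3 * α.1 2 - 2 * α.1 3) (by linarith)
  have q5 := b12 (3 * α.1 4 - 2 * α.1 3) (by linarith)
  have q6 := b12 (α.1 3) (by linarith)
  simp only [Finset.mem_Icc]
  refine ⟨q6, ?_, ?_, by linarith, ?_, ?_, ?_⟩ <;> omega

/-- Roots of `D₅` are weights of the elements `E_{a,b} - E_{b',a'}`. -/
lemma exists_diff (α : Root) (h5 : α.1 5 = 0) :
    ∃ a b : Idx, (a ≠ b ∧ a ≠ b.swap) ∧ α.1 = diff a b := by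
  have key : ∀ d ∈ Finset.Icc (-3 : ℤ) 3, ∀ c ∈ Finset.Icc (-3 : ℤ) 3, ∀ e ∈ Finset.Icc (-3 : ℤ) 3,
      (3 * c - 2 * d) ^ 2 + (3 * e - 2 * d) ^ 2 + d ^ 2 ≤ 12 →
      ∀ b ∈ Finset.Icc (-2 : ℤ) 2, ∀ a ∈ Finset.Icc (-2 : ℤ) 2,
      form ![a, b, c, d, e, 0] ![a, b, c, d, e, 0] = 2 →
      ∃ x y : Idx, (x ≠ y ∧ x ≠ y.swap) ∧ ![a, b, c, d, e, 0] = diff x y := by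
    decide +kernel
  obtain ⟨hd, hc, he, hq, hb, ha, -⟩ := α.bounds
  have h := key _ hd _ hc _ he hq _ hb _ ha
  rw [← h5] at h
  have hv : ![α.1 0, α.1 1, α.1 2, α.1 3, α.1 4, α.1 5] = α.1 := by
    funext i; fin_cases i <;> rfl
  rw [hv] at h
  exact h α.2

lemma nuInv_bracket_aux {p q s : Idx} (h1 : p ≠ q ∧ p ≠ q.swap) (h2 : q ≠ s ∧ q ≠ s.swap)
    {α β : Root} (hα : α.1 = diff p q) (hβ : β.1 = diff q s) :
    nuInv ⁅E α, E β⁆ = ⁅nuInv (E α), nuInv (E β)⁆ := by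
  have hn : ∀ x : Idx, x ≠ x.swap := by decide +kernel
  have hs : ∀ x : Idx, x.swap.swap = x := Sum.swap_swap
  rw [nuInv_E h1 hα, nuInv_E h2 hβ, lie_smul, smul_lie, so_lie_so h1 h2, smul_smul, br_EE]
  by_cases hsp : s = p
  · subst hsp
    have h0 : α.1 + β.1 = 0 := by
      rw [hα, hβ, diff_add]
      have : ∀ x : Idx, diff x x = 0 := by decide +kernel
      exact this s
    rw [if_pos rfl, rootBracket, if_pos h0, map_neg, hα, nuInv_ofH_diff, nuSign_neg s q]
    have : (nuSign s q : ℂ) * nuSign s q = 1 := by exact_mod_cast nuSign_sq s q h1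
    push_cast
    rw [neg_mul, this, neg_one_smul]
  · rw [if_neg hsp, sub_zero]
    by_cases hsp' : s = p.swap
    · subst hsp'
      have h3 : form α.1 β.1 = 0 := by
        rw [hα, hβ, form_diff_diff]
        unfold gram
        have := hn q
        have := hn p
        grind
      have h4 : so p p.swap = 0 := by
        apply Subtype.ext
        simp [so, hs]
      rw [rootBracket_of_ne (by omega) (by omega), h4, map_zero, smul_zero]
    · have h3 : p ≠ s ∧ p ≠ s.swap := by grind
      obtain ⟨γ, hγ⟩ : ∃ γ : Root, γ.1 = diff p s := ⟨⟨_, (form_diff p s).2 h3⟩, rfl⟩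
      rw [rootBracket_of_eq (γ := γ) (by rw [hγ, hα, hβ, diff_add]), map_smul, nuInv_E h3 hγ, smul_smul,
        hα, hβ]
      congr 1
      have := nuSign_mul p q s h1 h2 h3
      rw [mul_comm (nuSign q s : ℂ)]
      exact_mod_cast this.symm

lemma nuInv_bracket_EE (α β : Root) (hα5 : α.1 5 = 0) (hβ5 : β.1 5 = 0) :
    nuInv ⁅E α, E β⁆ = ⁅nuInv (E α), nuInv (E β)⁆ := by
  obtain ⟨p, q, hpq, hα⟩ := exists_diff α hα5
  obtain ⟨r, s, hrs, hβ⟩ := exists_diff β hβ5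
  have hs : ∀ x : Idx, x.swap.swap = x := Sum.swap_swap
  have hrs' : s.swap ≠ r.swap ∧ s.swap ≠ r.swap.swap := by grind
  have hβ' : β.1 = diff s.swap r.swap := by rw [diff_swap, hβ]
  have hflip : nuInv ⁅E β, E α⁆ = ⁅nuInv (E β), nuInv (E α)⁆ →
      nuInv ⁅E α, E β⁆ = ⁅nuInv (E α), nuInv (E β)⁆ := by
    intro h
    rw [← lie_skew, map_neg, h, lie_skew]
  by_cases c1 : q = r
  · subst c1
    exact nuInv_bracket_aux hpq hrs hα hβ
  by_cases c2 : s = p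
  · subst c2
    exact hflip (nuInv_bracket_aux hrs hpq hβ hα)
  by_cases c3 : q = s.swap
  · subst c3
    exact nuInv_bracket_aux hpq hrs' hα hβ'
  by_cases c4 : r.swap = p
  · subst c4
    exact hflip (nuInv_bracket_aux hrs' hpq hβ' hα)
  have hf : ¬ form α.1 β.1 < 0 := by
    intro h
    rw [hα, hβ] at h
    rcases form_diff_neg _ _ _ _ h with h' | h' | h' | h'
    exacts [c1 h', c2 h', c3 h', c4 h']
  rw [br_EE, rootBracket_of_ne (by omega) (by omega), map_zero, nuInv_E hpq hα, nuInv_E hrs hβ, lie_smul,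
    smul_lie]
  have h0 : ⁅so p q, so r s⁆ = 0 := by
    apply Subtype.ext
    rw [lie_o10_coe]
    have e1 : p.swap ≠ r := by grind
    have e2 : p.swap ≠ s.swap := by grind
    have e3 : s ≠ q.swap := by grind
    have e4 : r.swap ≠ q.swap := by grind
    simp only [so, mul_sub, sub_mul]
    rw [Matrix.single_mul_single_of_ne _ _ _ _ c1, Matrix.single_mul_single_of_ne _ _ _ _ c2,
      Matrix.single_mul_single_of_ne _ _ _ _ c3, Matrix.single_mul_single_of_ne _ _ _ _ c4,
      Matrix.single_mul_single_of_ne _ _ _ _ e1, Matrix.single_mul_single_of_ne _ _ _ _ e2,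
      Matrix.single_mul_single_of_ne _ _ _ _ e3, Matrix.single_mul_single_of_ne _ _ _ _ e4]
    simp
  rw [h0, smul_zero, smul_zero]

lemma nuInv_bracket_HE (h : Fin 6 → ℂ) (β : Root) :
    nuInv ⁅ofH h, E β⁆ = ⁅nuInv (ofH h), nuInv (E β)⁆ := by
  apply Subtype.ext
  rw [lie_o10_coe, nuInv_ofH]
  ext a b
  rw [br_HE, map_smul, smul_o10_apply, Matrix.sub_apply, Matrix.diagonal_mul, Matrix.mul_diagonal,
    nuInv_apply, coef_E, hPart_E, map_zero]
  by_cases hab : a = b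
  · simp [hab]
  · rw [if_neg hab]
    by_cases hd : diff a b = β.1
    · rw [if_pos hd, ← hd, ← diagEntry_sub]
      ring
    · rw [if_neg hd]
      ring

/-- The roots `γ` with `E_γ = ξ_{i+1}`, that is, the positive roots of `E₆` outside `D₅`. -/
def rt : Fin 16 → Lat :=
  ![![0, 0, 0, 0, 0, 1], ![0, 0, 0, 0, 1, 1], ![0, 0, 0, 1, 1, 1], ![0, 0, 1, 1, 1, 1],
    ![0, 1, 0, 1, 1, 1], ![0, 1, 1, 1, 1, 1], ![1, 0, 1, 1, 1, 1], ![1, 1, 1, 1, 1, 1],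
    ![0, 1, 1, 2, 1, 1], ![1, 1, 1, 2, 1, 1], ![0, 1, 1, 2, 2, 1], ![1, 1, 2, 2, 1, 1],
    ![1, 1, 1, 2, 2, 1], ![1, 1, 2, 2, 2, 1], ![1, 1, 2, 3, 2, 1], ![1, 2, 2, 3, 2, 1]]

lemma form_rt (i : Fin 16) : form (rt i) (rt i) = 2 := by
  revert i; decide +kernel

lemma rt_five (i : Fin 16) : rt i 5 = 1 := by
  revert i; decide +kernel

lemma rt_injective : Function.Injective rt := by
  have : ∀ i j, rt i = rt j → i = j := by decide +kernel
  exact fun i j h => this i j h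

lemma exists_rt (α : Root) (h5 : α.1 5 = 1) : ∃ i, α.1 = rt i := by
  have key : ∀ d ∈ Finset.Icc (-3 : ℤ) 3, ∀ c ∈ Finset.Icc (-3 : ℤ) 3, ∀ e ∈ Finset.Icc (-3 : ℤ) 3,
      (3 * c - 2 * d) ^ 2 + (3 * e - 2 * d) ^ 2 + d ^ 2 ≤ 12 →
      ∀ b ∈ Finset.Icc (-2 : ℤ) 2, ∀ a ∈ Finset.Icc (-2 : ℤ) 2,
      form ![a, b, c, d, e, 1] ![a, b, c, d, e, 1] = 2 → ∃ i, ![a, b, c, d, e, 1] = rt i := by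
    decide +kernel
  obtain ⟨hd, hc, he, hq, hb, ha, -⟩ := α.bounds
  have h := key _ hd _ hc _ he hq _ hb _ ha
  rw [← h5] at h
  have hv : ![α.1 0, α.1 1, α.1 2, α.1 3, α.1 4, α.1 5] = α.1 := by
    funext i; fin_cases i <;> rfl
  rw [hv] at h
  exact h α.2

lemma Root.five (α : Root) : α.1 5 = -1 ∨ α.1 5 = 0 ∨ α.1 5 = 1 := by
  have h2 := α.2
  have e1 : 60 * form α.1 α.1 = 30 * (2 * α.1 0 - α.1 2) ^ 2 + 10 * (3 * α.1 2 - 2 * α.1 3) ^ 2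
      + 30 * (2 * α.1 1 - α.1 3) ^ 2 + 2 * (5 * α.1 3 - 6 * α.1 4) ^ 2
      + 3 * (4 * α.1 4 - 5 * α.1 5) ^ 2 + 45 * α.1 5 ^ 2 := by
    simp only [form]; ring
  have h5 : α.1 5 ^ 2 ≤ 2 := by
    nlinarith [sq_nonneg (2 * α.1 0 - α.1 2), sq_nonneg (3 * α.1 2 - 2 * α.1 3),
      sq_nonneg (2 * α.1 1 - α.1 3), sq_nonneg (5 * α.1 3 - 6 * α.1 4),
      sq_nonneg (4 * α.1 4 - 5 * α.1 5)]
  have h6 : -1 ≤ α.1 5 := by nlinarith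
  have h7 : α.1 5 ≤ 1 := by nlinarith
  omega

end E6Ext
end

noncomputable section

namespace E6Ext

open scoped TensorProduct

/-! ### The grading of `𝒢^{E₆}` by the coefficient of `α_6` -/

/-- The element of `H` that acts on `E_γ` by the coefficient of `α_6` in `γ`. -/
def gr : E6 := ofH ((1 / 3 : ℂ) • alphaHat)

/-- The homogeneous component of degree `n` for the coefficient of `α_6`. -/
def IsDeg (n : ℤ) (u : E6) : Prop := ⁅gr, u⁆ = (n : ℂ) • u

lemma hform_gr (v : Lat) : hform v ((1 / 3 : ℂ) • alphaHat) = v 5 := by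
  simp [hform, alphaHat, form, Fin.sum_univ_succ, Pi.single_apply]
  ring

lemma E6_ext {u v : E6} (h1 : hPart u = hPart v) (h2 : ∀ α : Root, coef α.1 u = coef α.1 v) :
    u = v := by
  refine Prod.ext h1 ?_
  refine Finsupp.ext fun α => ?_
  have := h2 α
  simp only [coef, α.2, dif_pos] at this
  exact this

lemma coef_gr (α : Root) (u : E6) : coef α.1 ⁅gr, u⁆ = α.1 5 * coef α.1 u := by
  induction u using E6_induction with
  | hH h => rw [gr, br_HH, coef_ofH, map_zero, mul_zero]
  | hE β =>
    rw [gr, br_HE, map_smul, coef_E, hform_gr]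
    by_cases h : α.1 = β.1 <;> simp [h]
  | hadd x y hx hy => rw [br_add, map_add, hx, hy, map_add]; ring
  | hsmul a x hx => rw [br_smul, map_smul, hx, map_smul, smul_eq_mul, smul_eq_mul]; ring

lemma hPart_gr (u : E6) : hPart ⁅gr, u⁆ = 0 := by
  induction u using E6_induction with
  | hH h => rw [gr, br_HH, map_zero]
  | hE β => rw [gr, br_HE, map_smul, hPart_E, smul_zero]
  | hadd x y hx hy => rw [br_add, map_add, hx, hy, add_zero]
  | hsmul a x hx => rw [br_smul, map_smul, hx, smul_zero]

lemma IsDeg.coef_eq {n : ℤ} {u : E6} (h : IsDeg n u) (α : Root) (hα : α.1 5 ≠ n) :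
    coef α.1 u = 0 := by
  have h1 := coef_gr α u
  rw [h, map_smul, smul_eq_mul] at h1
  have h2 : ((α.1 5 : ℂ) - n) * coef α.1 u = 0 := by linear_combination -h1
  refine (mul_eq_zero.1 h2).resolve_left ?_
  intro h3
  exact hα (by exact_mod_cast sub_eq_zero.1 h3)

lemma IsDeg.hPart_eq {n : ℤ} {u : E6} (h : IsDeg n u) (hn : n ≠ 0) : hPart u = 0 := by
  have h1 := hPart_gr u
  rw [h, map_smul] at h1
  exact (smul_eq_zero.1 h1).resolve_left (by exact_mod_cast hn)

lemma IsDeg.lie {m n : ℤ} {u v : E6} (hu : IsDeg m u) (hv : IsDeg n v) : IsDeg (m + n) ⁅u, v⁆ := by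
  unfold IsDeg at *
  rw [leibniz_lie, hu, hv, smul_lie, lie_smul]
  push_cast
  rw [add_smul]

lemma IsDeg.eq_zero {n : ℤ} {u : E6} (h : IsDeg n u) (hn : n < -1 ∨ 1 < n) : u = 0 := by
  refine E6_ext (by rw [h.hPart_eq (by omega), map_zero]) fun α => ?_
  rw [h.coef_eq α (by rcases α.five with h | h | h <;> omega), map_zero]

lemma isDeg_ofH (h : Fin 6 → ℂ) : IsDeg 0 (ofH h) := by
  rw [IsDeg, gr, br_HH]; simp

lemma isDeg_E (α : Root) : IsDeg (α.1 5) (E α) := by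
  rw [IsDeg, gr, br_HE, hform_gr]

/-- `ξ_{i+1}`, a root vector of `𝒢_+`. -/
def xi (i : Fin 16) : E6 := E ⟨rt i, form_rt i⟩

/-- `η_{i+1}`, a root vector of `𝒢_-`. -/
def eta (i : Fin 16) : E6 := E (Root.neg ⟨rt i, form_rt i⟩)

lemma isDeg_xi (i : Fin 16) : IsDeg 1 (xi i) := by
  have := isDeg_E ⟨rt i, form_rt i⟩
  simp only [rt_five] at this
  exact this

lemma isDeg_eta (i : Fin 16) : IsDeg (-1) (eta i) := by
  have := isDeg_E (Root.neg ⟨rt i, form_rt i⟩)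
  simp only [Root.neg, Pi.neg_apply, rt_five] at this
  exact this

lemma coef_xi (v : Lat) (i : Fin 16) : coef v (xi i) = if v = rt i then 1 else 0 := coef_E _ _

lemma coef_eta (v : Lat) (i : Fin 16) : coef v (eta i) = if v = -rt i then 1 else 0 := coef_E _ _

lemma IsDeg.eq_sum_xi {u : E6} (h : IsDeg 1 u) : u = ∑ i, coef (rt i) u • xi i := by
  refine E6_ext ?_ fun α => ?_
  · rw [h.hPart_eq one_ne_zero, map_sum]
    exact (Finset.sum_eq_zero fun i _ => by rw [map_smul, xi, hPart_E, smul_zero]).symm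
  · rw [map_sum]
    simp only [map_smul, coef_xi, smul_eq_mul]
    by_cases hα : α.1 5 = 1
    · obtain ⟨i, hi⟩ := exists_rt α hα
      rw [Finset.sum_eq_single i]
      · rw [if_pos hi, hi, mul_one]
      · intro j _ hj
        rw [if_neg (fun h => hj (rt_injective (by rw [← h, hi]))), mul_zero]
      · simp
    · rw [h.coef_eq α hα, Finset.sum_eq_zero]
      intro i _
      rw [if_neg (fun h => hα (by rw [h, rt_five])), mul_zero]

lemma exists_rt_neg (α : Root) (h5 : α.1 5 = -1) : ∃ i, α.1 = -rt i := by
  obtain ⟨i, hi⟩ := exists_rt α.neg (by simp [Root.neg, h5])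
  exact ⟨i, by rw [← hi]; simp [Root.neg]⟩

lemma IsDeg.eq_sum_eta {u : E6} (h : IsDeg (-1) u) : u = ∑ i, coef (-rt i) u • eta i := by
  refine E6_ext ?_ fun α => ?_
  · rw [h.hPart_eq (by norm_num), map_sum]
    exact (Finset.sum_eq_zero fun i _ => by rw [map_smul, eta, hPart_E, smul_zero]).symm
  · rw [map_sum]
    simp only [map_smul, coef_eta, smul_eq_mul]
    by_cases hα : α.1 5 = -1
    · obtain ⟨i, hi⟩ := exists_rt_neg α hα
      rw [Finset.sum_eq_single i]
      · rw [if_pos hi, hi, mul_one]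
      · intro j _ hj
        rw [if_neg (fun h => hj (rt_injective (neg_injective (by rw [← h, hi])))), mul_zero]
      · simp
    · rw [h.coef_eq α hα, Finset.sum_eq_zero]
      intro i _
      rw [if_neg (fun h => hα (by rw [h, Pi.neg_apply, rt_five])), mul_zero]

lemma xi_lie_xi (i j : Fin 16) : ⁅xi i, xi j⁆ = 0 :=
  ((isDeg_xi i).lie (isDeg_xi j)).eq_zero (by omega)

lemma eta_lie_eta (i j : Fin 16) : ⁅eta i, eta j⁆ = 0 :=
  ((isDeg_eta i).lie (isDeg_eta j)).eq_zero (by omega)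

lemma isDeg_xi_eta (i j : Fin 16) : IsDeg 0 ⁅xi i, eta j⁆ := (isDeg_xi i).lie (isDeg_eta j)

lemma deg_zero_induction {p : E6 → Prop} (hH : ∀ h, p (ofH h)) (hE : ∀ α : Root, α.1 5 = 0 → p (E α))
    (hadd : ∀ x y, p x → p y → p (x + y)) (hsmul : ∀ (a : ℂ) x, p x → p (a • x)) (u : E6)
    (hu : IsDeg 0 u) : p u := by
  have hx : u = ofH (hPart u) + ofR (rPart u) := by
    rcases u with ⟨h, r⟩
    exact Prod.ext (add_zero h).symm (zero_add r).symm
  rw [hx]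
  refine hadd _ _ (hH _) ?_
  rw [← Finsupp.sum_single (rPart u), Finsupp.sum, map_sum]
  refine Finset.sum_induction _ p hadd (by simpa using hsmul 0 _ (hH 0)) fun α _ => ?_
  have h1 : ofR (Finsupp.single α (rPart u α)) = rPart u α • E α := by
    rw [E, ← map_smul, Finsupp.smul_single, smul_eq_mul, mul_one]
  rw [h1]
  by_cases hα : α.1 5 = 0
  · exact hsmul _ _ (hE α hα)
  · have := hu.coef_eq α hα
    simp only [coef, α.2, dif_pos] at this
    have h2 : rPart u α = 0 := this
    rw [h2]
    simpa using hsmul 0 _ (hH 0)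

lemma nuInv_lie (u v : E6) (hu : IsDeg 0 u) (hv : IsDeg 0 v) :
    nuInv ⁅u, v⁆ = ⁅nuInv u, nuInv v⁆ := by
  refine deg_zero_induction (p := fun u => nuInv ⁅u, v⁆ = ⁅nuInv u, nuInv v⁆) (fun h => ?_)
    (fun α hα => ?_) (fun x y hx hy => ?_) (fun a x hx => ?_) u hu
  · refine deg_zero_induction (p := fun v => nuInv ⁅ofH h, v⁆ = ⁅nuInv (ofH h), nuInv v⁆)
      (fun k => ?_) (fun β _ => nuInv_bracket_HE h β) (fun x y hx hy => ?_) (fun a x hx => ?_) v hv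
    · rw [br_HH, map_zero]
      apply Subtype.ext
      rw [lie_o10_coe, nuInv_ofH, nuInv_ofH, Matrix.diagonal_mul_diagonal,
        Matrix.diagonal_mul_diagonal]
      simp [mul_comm]
    · rw [lie_add, map_add, hx, hy, map_add, lie_add]
    · rw [lie_smul, map_smul, hx, map_smul, lie_smul]
  · refine deg_zero_induction (p := fun v => nuInv ⁅E α, v⁆ = ⁅nuInv (E α), nuInv v⁆)
      (fun k => ?_) (fun β hβ => nuInv_bracket_EE α β hα hβ) (fun x y hx hy => ?_)
      (fun a x hx => ?_) v hv
    · rw [← lie_skew, map_neg, nuInv_bracket_HE, lie_skew]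
    · rw [lie_add, map_add, hx, hy, map_add, lie_add]
    · rw [lie_smul, map_smul, hx, map_smul, lie_smul]
  · rw [add_lie, map_add, hx, hy, map_add, add_lie]
  · rw [smul_lie, map_smul, hx, map_smul, smul_lie]

lemma rt_ne_diff (i : Fin 16) (a b : Idx) : diff a b ≠ rt i := by
  intro h
  have h1 : (diff a b) 5 = 0 := rfl
  rw [h, rt_five] at h1
  omega

lemma rt_neg_ne_diff (i : Fin 16) (a b : Idx) : diff a b ≠ -rt i := by
  intro h
  have h1 : (diff a b) 5 = 0 := rfl
  rw [h, Pi.neg_apply, rt_five] at h1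
  omega

lemma nuInv_xi (i : Fin 16) : nuInv (xi i) = 0 := by
  apply Subtype.ext
  ext a b
  rw [nuInv_apply, coef_xi, if_neg (rt_ne_diff i a b), xi, hPart_E]
  simp

lemma nuInv_eta (i : Fin 16) : nuInv (eta i) = 0 := by
  apply Subtype.ext
  ext a b
  rw [nuInv_apply, coef_eta, if_neg (rt_neg_ne_diff i a b), eta, hPart_E]
  simp

lemma hPart_five_lie (u v : E6) (hu : IsDeg 0 u) (hv : IsDeg 0 v) : hPart ⁅u, v⁆ 5 = 0 := by
  refine deg_zero_induction (p := fun u => hPart ⁅u, v⁆ 5 = 0) (fun h => ?_)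
    (fun α hα => ?_) (fun x y hx hy => ?_) (fun a x hx => ?_) u hu
  · refine deg_zero_induction (p := fun v => hPart ⁅ofH h, v⁆ 5 = 0)
      (fun k => ?_) (fun β _ => ?_) (fun x y hx hy => ?_) (fun a x hx => ?_) v hv
    · rw [br_HH, map_zero, Pi.zero_apply]
    · rw [br_HE, map_smul, hPart_E, smul_zero, Pi.zero_apply]
    · rw [lie_add, map_add, Pi.add_apply, hx, hy, add_zero]
    · rw [lie_smul, map_smul, Pi.smul_apply, hx, smul_zero]
  · refine deg_zero_induction (p := fun v => hPart ⁅E α, v⁆ 5 = 0)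
      (fun k => ?_) (fun β _ => ?_) (fun x y hx hy => ?_) (fun a x hx => ?_) v hv
    · rw [br_EH, map_neg, map_smul, hPart_E, smul_zero, neg_zero, Pi.zero_apply]
    · rw [br_EE, rootBracket]
      split_ifs
      · rw [map_neg, hPart_ofH, Pi.neg_apply, toH, hα]
        simp
      · rw [map_smul, Ev]
        split_ifs <;> simp
    · rw [lie_add, map_add, Pi.add_apply, hx, hy, add_zero]
    · rw [lie_smul, map_smul, Pi.smul_apply, hx, smul_zero]
  · rw [add_lie, map_add, Pi.add_apply, hx, hy, add_zero]
  · rw [smul_lie, map_smul, Pi.smul_apply, hx, smul_zero]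

lemma coef_rootBracket (α β γ : Root) :
    coef γ.1 (rootBracket α β) = if γ.1 = α.1 + β.1 then (F α.1 β.1 : ℂ) else 0 := by
  by_cases h : γ.1 = α.1 + β.1
  · rw [rootBracket_of_eq h, map_smul, coef_E, if_pos rfl, if_pos h, smul_eq_mul, mul_one]
  · rw [if_neg h, rootBracket]
    split_ifs with h0
    · rw [map_neg, coef_ofH, neg_zero]
    · by_cases h1 : form (α.1 + β.1) (α.1 + β.1) = 2
      · rw [Ev, dif_pos h1, map_smul, coef_E, if_neg h, smul_zero]
      · rw [Ev_of_ne h1, smul_zero, map_zero]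

/-- `φ_{i,j}(u)`, defined by `[u, η_i] = ∑_j φ_{i,j}(u) η_j` for `u ∈ 𝒢_0`, and zero on `𝒢_±`. -/
def phi (i j : Fin 16) : E6 →ₗ[ℂ] ℂ where
  toFun u := coef (-rt j) ⁅u, eta i⁆
  map_add' u v := by rw [add_lie, map_add]
  map_smul' a u := by rw [smul_lie, map_smul]; rfl

lemma phi_apply (i j : Fin 16) (u : E6) : phi i j u = coef (-rt j) ⁅u, eta i⁆ := rfl

lemma phi_eq_neg (i j : Fin 16) (u : E6) : phi i j u = -coef (rt i) ⁅u, xi j⁆ := by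
  induction u using E6_induction with
  | hadd x y hx hy => rw [map_add, hx, hy, add_lie, map_add]; ring
  | hsmul a x hx => rw [map_smul, hx, smul_lie, map_smul]; simp
  | hH h =>
    rw [phi_apply, eta, xi, br_HE, br_HE, map_smul, map_smul]
    change hform (-rt i) h • coef (-rt j) (eta i) = -(hform (rt j) h • coef (rt i) (xi j))
    rw [coef_eta, coef_xi]
    by_cases hij : i = j
    · subst hij
      have h1 := hform_add (rt i) (-rt i) h
      have h2 : hform 0 h = 0 := by simpa using hform_add 0 0 h
      rw [add_neg_cancel, h2] at h1
      simp only [if_true, smul_eq_mul, mul_one]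
      linear_combination -h1
    · rw [if_neg (fun h => hij (rt_injective (neg_injective h)).symm),
        if_neg (fun h => hij (rt_injective h))]
      simp
  | hE γ =>
    have h1 : coef (-rt j) ⁅E γ, eta i⁆ = if -rt j = γ.1 + -rt i then (F γ.1 (-rt i) : ℂ) else 0 := by
      rw [eta, br_EE]
      exact coef_rootBracket γ (Root.neg ⟨rt i, form_rt i⟩) (Root.neg ⟨rt j, form_rt j⟩)
    have h2 : coef (rt i) ⁅E γ, xi j⁆ = if rt i = γ.1 + rt j then (F γ.1 (rt j) : ℂ) else 0 := by
      rw [xi, br_EE]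
      exact coef_rootBracket γ ⟨rt j, form_rt j⟩ ⟨rt i, form_rt i⟩
    rw [phi_apply, h1, h2]
    by_cases h : rt i = γ.1 + rt j
    · have h' : -rt j = γ.1 + -rt i := by rw [h]; abel
      rw [if_pos h, if_pos h', F_neg_right, h, F_add_right, F_self γ]
      push_cast; ring
    · have h' : ¬ -rt j = γ.1 + -rt i := by
        intro h'
        apply h
        calc rt i = -rt j + rt i + rt j := by abel
          _ = (γ.1 + -rt i) + rt i + rt j := by rw [← h']
          _ = _ := by abel
      rw [if_neg h, if_neg h', neg_zero]

lemma lie_eta (u : E6) (hu : IsDeg 0 u) (i : Fin 16) : ⁅u, eta i⁆ = ∑ j, phi i j u • eta j := by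
  have h := hu.lie (isDeg_eta i)
  rw [zero_add] at h
  exact h.eq_sum_eta

lemma lie_xi (u : E6) (hu : IsDeg 0 u) (r : Fin 16) : ⁅u, xi r⁆ = -∑ i, phi i r u • xi i := by
  have h := hu.lie (isDeg_xi r)
  rw [zero_add] at h
  rw [h.eq_sum_xi, ← Finset.sum_neg_distrib]
  simp only [phi_eq_neg, neg_smul, neg_neg]

lemma phi_xi (r i j : Fin 16) : phi i j (xi r) = 0 := by
  rw [phi_eq_neg, xi_lie_xi, map_zero, neg_zero]

lemma phi_eta (r i j : Fin 16) : phi i j (eta r) = 0 := by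
  rw [phi_apply, eta_lie_eta, map_zero]

lemma phi_swap_xi (i k r s : Fin 16) : phi k r ⁅xi s, eta i⁆ = phi k s ⁅xi r, eta i⁆ := by
  have h : ⁅⁅xi s, eta i⁆, xi r⁆ = ⁅⁅xi r, eta i⁆, xi s⁆ := by
    rw [lie_lie, xi_lie_xi, lie_zero, sub_zero, ← lie_skew (eta i) (xi r), lie_neg, lie_skew]
  rw [phi_eq_neg, phi_eq_neg, h]

lemma phi_swap_eta (i j r k : Fin 16) : phi j k ⁅xi r, eta i⁆ = phi i k ⁅xi r, eta j⁆ := by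
  rw [phi_apply, phi_apply, lie_lie, eta_lie_eta, lie_zero, zero_sub, lie_skew]

lemma phi_lie (u v : E6) (hu : IsDeg 0 u) (hv : IsDeg 0 v) (k r : Fin 16) :
    phi k r ⁅u, v⁆ = ∑ i, (phi k i v * phi i r u - phi k i u * phi i r v) := by
  rw [phi_apply, lie_lie, lie_eta v hv, lie_eta u hu, map_sub, lie_sum, lie_sum, map_sum, map_sum,
    Finset.sum_sub_distrib]
  simp only [lie_smul, map_smul, smul_eq_mul, phi_apply]

end E6Ext
end

noncomputable section

namespace E6Ext

open scoped TensorProduct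

/-- The polynomial algebra `𝒜 = ℂ[x_1, …, x_16]`. -/
abbrev Poly := MvPolynomial (Fin 16) ℂ

/-- Multiplication by `x_{j+1}`. -/
def mulX (j : Fin 16) : Module.End ℂ Poly := LinearMap.mulLeft ℂ (MvPolynomial.X j)

/-- The partial derivative `∂_{x_{i+1}}`. -/
def dX (i : Fin 16) : Module.End ℂ Poly := (MvPolynomial.pderiv i).toLinearMap

/-- `u|_𝒜 = ∑_{i,j} φ_{i,j}(u) x_j ∂_{x_i}`, the action of `𝒢_0` on `𝒜`. -/
def polyAct : E6 →ₗ[ℂ] Module.End ℂ Poly :=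
  ∑ i, ∑ j, (phi i j).smulRight (mulX j * dX i)

lemma polyAct_apply (u : E6) : polyAct u = ∑ i, ∑ j, phi i j u • (mulX j * dX i) := by
  simp [polyAct]

/-- The vector fields `P_i`, homogeneous of degree two, with `[∂_{x_r}, P_i] = [ξ_r, η_i]|_𝒜`. -/
def quadField (i : Fin 16) : Module.End ℂ Poly :=
  (1 / 2 : ℂ) • ∑ r, mulX r * polyAct ⁅xi r, eta i⁆

section Com

variable {M : Type*} [AddCommGroup M] [Module ℂ M]

/-- The commutator of two operators. -/
def com (x y : Module.End ℂ M) : Module.End ℂ M := x * y - y * x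

lemma com_apply (x y : Module.End ℂ M) (w : M) : com x y w = x (y w) - y (x w) := rfl

lemma com_mul (x y z : Module.End ℂ M) : com x (y * z) = com x y * z + y * com x z := by
  simp only [com]; noncomm_ring

lemma com_smul (a : ℂ) (x y : Module.End ℂ M) : com x (a • y) = a • com x y := by
  simp only [com, mul_smul_comm, smul_mul_assoc, smul_sub]

lemma smul_com (a : ℂ) (x y : Module.End ℂ M) : com (a • x) y = a • com x y := by
  simp only [com, mul_smul_comm, smul_mul_assoc, smul_sub]

lemma com_sum {ι : Type*} (s : Finset ι) (x : Module.End ℂ M) (f : ι → Module.End ℂ M) :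
    com x (∑ i ∈ s, f i) = ∑ i ∈ s, com x (f i) := by
  simp only [com, Finset.mul_sum, Finset.sum_mul, Finset.sum_sub_distrib]

lemma sum_com {ι : Type*} (s : Finset ι) (x : Module.End ℂ M) (f : ι → Module.End ℂ M) :
    com (∑ i ∈ s, f i) x = ∑ i ∈ s, com (f i) x := by
  simp only [com, Finset.mul_sum, Finset.sum_mul, Finset.sum_sub_distrib]

lemma com_add (x y z : Module.End ℂ M) : com x (y + z) = com x y + com x z := by
  simp only [com]; noncomm_ring

lemma add_com (x y z : Module.End ℂ M) : com (x + y) z = com x z + com y z := by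
  simp only [com]; noncomm_ring

lemma com_sub (x y z : Module.End ℂ M) : com x (y - z) = com x y - com x z := by
  simp only [com]; noncomm_ring

lemma com_com (x y z : Module.End ℂ M) :
    com x (com y z) = com (com x y) z + com y (com x z) := by
  simp only [com]; noncomm_ring

lemma com_skew (x y : Module.End ℂ M) : com y x = -com x y := by
  simp only [com]; noncomm_ring

end Com

lemma dX_lie_dX (r s : Fin 16) : (com (dX r) (dX s)) = 0 := by
  rw [com, sub_eq_zero]
  refine LinearMap.ext fun p => ?_
  refine MvPolynomial.ext _ _ fun m => ?_
  change MvPolynomial.coeff m (MvPolynomial.pderiv r (MvPolynomial.pderiv s p)) =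
    MvPolynomial.coeff m (MvPolynomial.pderiv s (MvPolynomial.pderiv r p))
  simp only [MvPolynomial.coeff_pderiv]
  by_cases h : r = s
  · rw [h]
  · rw [add_right_comm]
    simp [h, Ne.symm h]
    ring

lemma dX_lie_mulX (r s : Fin 16) : (com (dX r) (mulX s)) = if r = s then 1 else 0 := by
  rw [com]
  refine LinearMap.ext fun p => ?_
  change MvPolynomial.pderiv r (MvPolynomial.X s * p) - MvPolynomial.X s * MvPolynomial.pderiv r p = _
  rw [MvPolynomial.pderiv_mul, MvPolynomial.pderiv_X, add_sub_cancel_right]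
  by_cases h : r = s
  · subst h; simp
  · simp [h, Ne.symm h]

lemma dX_lie_polyAct (r : Fin 16) (u : E6) : (com (dX r) (polyAct u)) = ∑ i, phi i r u • dX i := by
  rw [polyAct_apply]
  simp only [com_sum, com_smul, com_mul, dX_lie_mulX, dX_lie_dX, mul_zero, add_zero, ite_mul, one_mul,
    zero_mul, smul_ite, smul_zero, Finset.sum_ite_eq, Finset.mem_univ, if_true]

lemma dX_lie_quadField (r i : Fin 16) : (com (dX r) (quadField i)) = polyAct ⁅xi r, eta i⁆ := by
  have h : ∑ s, mulX s * (com (dX r) (polyAct ⁅xi s, eta i⁆)) = polyAct ⁅xi r, eta i⁆ := by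
    rw [polyAct_apply, Finset.sum_comm]
    refine Finset.sum_congr rfl fun s _ => ?_
    rw [dX_lie_polyAct, Finset.mul_sum]
    refine Finset.sum_congr rfl fun k _ => ?_
    rw [phi_swap_xi, mul_smul_comm]
  rw [quadField, com_smul, com_sum]
  simp only [com_mul, Finset.sum_add_distrib]
  rw [h]
  simp only [dX_lie_mulX, ite_mul, one_mul, zero_mul, Finset.sum_ite_eq, Finset.mem_univ, if_true]
  rw [← two_smul ℂ, smul_smul]
  norm_num

lemma polyAct_xi (i : Fin 16) : polyAct (xi i) = 0 := by simp [polyAct_apply, phi_xi]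
lemma polyAct_eta (i : Fin 16) : polyAct (eta i) = 0 := by simp [polyAct_apply, phi_eta]

section Tensor

variable (V : Type*) [AddCommGroup V] [Module ℂ V]

/-- The vector space `𝒜 ⊗ V`. -/
def Tens := Poly ⊗[ℂ] V

instance : AddCommGroup (Tens V) := inferInstanceAs (AddCommGroup (Poly ⊗[ℂ] V))
instance : Module ℂ (Tens V) := inferInstanceAs (Module ℂ (Poly ⊗[ℂ] V))

/-- An operator on `𝒜`, acting on the first factor of `𝒜 ⊗ V`. -/
def opL : Module.End ℂ Poly →ₐ[ℂ] Module.End ℂ (Tens V) := Module.End.rTensorAlgHom ℂ Poly V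

/-- An operator on `V`, acting on the second factor of `𝒜 ⊗ V`. -/
def opR : Module.End ℂ V →ₐ[ℂ] Module.End ℂ (Tens V) := Module.End.lTensorAlgHom ℂ V Poly

variable {V}

/-- The pure tensor `p ⊗ v`. -/
def tm (p : Poly) (v : V) : Tens V := p ⊗ₜ[ℂ] v

lemma Tens_induction {P : Tens V → Prop} (zero : P 0) (tmul : ∀ p v, P (tm p v))
    (add : ∀ x y, P x → P y → P (x + y)) (w : Tens V) : P w :=
  TensorProduct.induction_on (motive := P) w zero tmul add

@[simp] lemma opL_tmul (f : Module.End ℂ Poly) (p : Poly) (v : V) : opL V f (tm p v) = tm (f p) v := rfl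

@[simp] lemma opR_tmul (f : Module.End ℂ V) (p : Poly) (v : V) : opR V f (tm p v) = tm p (f v) := rfl

lemma opL_lie (f g : Module.End ℂ Poly) : com (opL V f) (opL V g) = opL V (com f g) := by
  simp only [com, map_sub, map_mul]

lemma opL_lie_opR (f : Module.End ℂ Poly) (g : Module.End ℂ V) : com (opL V f) (opR V g) = 0 := by
  refine LinearMap.ext fun w => ?_
  rw [com_apply, LinearMap.zero_apply, sub_eq_zero]
  induction w using Tens_induction with
  | zero => simp
  | add x y hx hy => simp only [map_add, hx, hy]
  | tmul p v => simp

/-- The coefficient of a monomial. -/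
def cf (m : Fin 16 →₀ ℕ) : Tens V →ₗ[ℂ] V :=
  show Poly ⊗[ℂ] V →ₗ[ℂ] V from (TensorProduct.lid ℂ V).toLinearMap.comp (LinearMap.rTensor V (MvPolynomial.lcoeff ℂ m))

lemma cf_tmul (m : Fin 16 →₀ ℕ) (p : Poly) (v : V) : cf m (tm p v) = MvPolynomial.coeff m p • v := by
  change (TensorProduct.lid ℂ V) (LinearMap.rTensor V (MvPolynomial.lcoeff ℂ m) (p ⊗ₜ[ℂ] v)) = _
  simp

lemma eq_zero_of_cf (w : Tens V) (h : ∀ m, cf m w = 0) : w = 0 := by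
  have key : ∀ (w : Poly ⊗[ℂ] V) (m : Fin 16 →₀ ℕ), TensorProduct.equivFinsuppOfBasisLeft
      (MvPolynomial.basisMonomials (Fin 16) ℂ) w m = cf m (w : Tens V) := by
    intro w m
    induction w with
    | zero => exact (map_zero (cf (V := V) m)).symm
    | add x y hx hy =>
      rw [map_add, Finsupp.add_apply, hx, hy]
      exact (map_add (cf (V := V) m) x y).symm
    | tmul p v =>
      rw [TensorProduct.equivFinsuppOfBasisLeft_apply_tmul_apply]
      exact (cf_tmul m p v).symm
  have h1 : TensorProduct.equivFinsuppOfBasisLeft (MvPolynomial.basisMonomials (Fin 16) ℂ)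
      (w : Poly ⊗[ℂ] V) = 0 := Finsupp.ext fun m => (key w m).trans (h m)
  exact (LinearEquiv.map_eq_zero_iff _).1 h1

lemma cf_dX (m : Fin 16 →₀ ℕ) (r : Fin 16) (w : Tens V) :
    cf m (opL V (dX r) w) = ((m r : ℂ) + 1) • cf (m + Finsupp.single r 1) w := by
  induction w using Tens_induction with
  | zero => simp
  | add x y hx hy => rw [map_add, map_add, hx, hy, map_add, smul_add]
  | tmul p v =>
    rw [opL_tmul, cf_tmul, cf_tmul, smul_smul]
    congr 1
    change MvPolynomial.coeff m (MvPolynomial.pderiv r p) = _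
    rw [MvPolynomial.coeff_pderiv]
    ring

/-- An operator that commutes with all `∂_{x_r}` and has no constant term is zero. -/
lemma eq_zero_of_comm (Z : Module.End ℂ (Tens V)) (hd : ∀ r, (com (opL V (dX r)) Z) = 0)
    (h0 : ∀ w, cf 0 (Z w) = 0) : Z = 0 := by
  refine LinearMap.ext fun w => eq_zero_of_cf _ fun m => ?_
  have key : ∀ (n : ℕ) (m : Fin 16 →₀ ℕ), m.degree = n → ∀ w, cf m (Z w) = 0 := by
    intro n
    induction n with
    | zero =>
      intro m hm w
      rw [Finsupp.degree_eq_zero_iff] at hm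
      rw [hm, h0]
    | succ n ih =>
      intro m hm w
      obtain ⟨r, hr⟩ : ∃ r, m r ≠ 0 := by
        by_contra hc
        push Not at hc
        have : m = 0 := Finsupp.ext hc
        rw [this, map_zero] at hm
        omega
      obtain ⟨k, rfl⟩ : ∃ k, m = k + Finsupp.single r 1 :=
        ⟨m - Finsupp.single r 1, (tsub_add_cancel_of_le (by simpa [Nat.one_le_iff_ne_zero])).symm⟩
      have h1 := cf_dX k r (Z w)
      have h2 : opL V (dX r) (Z w) = Z (opL V (dX r) w) := by
        have := LinearMap.congr_fun (hd r) w
        rw [com_apply] at this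
        exact sub_eq_zero.1 this
      rw [h2, ih k (by rw [map_add, Finsupp.degree_single] at hm; omega)] at h1
      exact (smul_eq_zero.1 h1.symm).resolve_left (by exact_mod_cast Nat.succ_ne_zero (k r))
  exact key _ m rfl w

lemma cf_mulX (r : Fin 16) (w : Tens V) : cf 0 (opL V (mulX r) w) = 0 := by
  induction w using Tens_induction with
  | zero => simp
  | add x y hx hy => rw [map_add, map_add, hx, hy, add_zero]
  | tmul p v =>
    rw [opL_tmul, cf_tmul]
    change MvPolynomial.coeff 0 (MvPolynomial.X r * p) • v = 0
    rw [← MvPolynomial.constantCoeff_eq]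
    simp

lemma cf_opR (f : Module.End ℂ V) (w : Tens V) : cf 0 (opR V f w) = f (cf 0 w) := by
  induction w using Tens_induction with
  | zero => simp
  | add x y hx hy => rw [map_add, map_add, hx, hy, map_add, map_add]
  | tmul p v => rw [opR_tmul, cf_tmul, cf_tmul, map_smul]

lemma cf_polyAct (u : E6) (w : Tens V) : cf 0 (opL V (polyAct u) w) = 0 := by
  rw [polyAct_apply]
  simp only [map_sum, map_smul, map_mul, LinearMap.sum_apply, LinearMap.smul_apply, Module.End.mul_apply,
    cf_mulX, smul_zero, Finset.sum_const_zero]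

end Tensor

end E6Ext
end

noncomputable section

namespace E6Ext

open scoped TensorProduct

section Ext

variable (c : ℂ) (V : Type*) [AddCommGroup V] [Module ℂ V] [LieRingModule o10 V] [LieModule ℂ o10 V]

/-- The representation of `𝒢_0 = 𝒢^{D₅} ⊕ ℂ α̂` on `V`: `𝒢^{D₅}` acts through `ν⁻¹`, and `α̂` acts as
`2c`. It is extended by zero to `𝒢_±`. (The `ℂ α̂`-component of `h ∈ H` is `(h_6 / 4) α̂`.) -/
def rho : E6 →ₗ[ℂ] Module.End ℂ V :=
  (LieModule.toEnd ℂ o10 V : o10 →ₗ[ℂ] Module.End ℂ V).comp nuInv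
    + ((2 * c / 4) • (LinearMap.proj 5).comp hPart).smulRight 1

/-- The operator on `𝒜 ⊗ V` by which `u ∈ 𝒢_0` acts: `u|_𝒜 ⊗ 1 + 1 ⊗ u|_V`. -/
def zeroOp : E6 →ₗ[ℂ] Module.End ℂ (Tens V) :=
  (opL V).toLinearMap.comp polyAct + (opR V).toLinearMap.comp (rho c V)

/-- The operator on `𝒜 ⊗ V` by which `η_i` acts: `P_i ⊗ 1 + ∑_r x_r ⊗ [ξ_r, η_i]|_V`. -/
def etaOp (i : Fin 16) : Module.End ℂ (Tens V) :=
  opL V (quadField i) + ∑ r, opL V (mulX r) * opR V (rho c V ⁅xi r, eta i⁆)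

/-- The action `ι` of `𝒢^{E₆} = 𝒢_- ⊕ 𝒢_0 ⊕ 𝒢_+` on `𝒜 ⊗ V`, where `ξ_i` acts as `∂_{x_i} ⊗ 1`. -/
def iota : E6 →ₗ[ℂ] Module.End ℂ (Tens V) :=
  ∑ i, (coef (rt i)).smulRight (opL V (dX i)) + zeroOp c V
    + ∑ i, (coef (-rt i)).smulRight (etaOp c V i)

variable {c V}

lemma rho_apply (u : E6) :
    rho c V u = LieModule.toEnd ℂ o10 V (nuInv u) + (2 * c / 4 * hPart u 5) • 1 := by
  simp [rho]

lemma zeroOp_apply (u : E6) : zeroOp c V u = opL V (polyAct u) + opR V (rho c V u) := by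
  simp [zeroOp]

lemma iota_apply (u : E6) : iota c V u = ∑ i, coef (rt i) u • opL V (dX i) + zeroOp c V u
    + ∑ i, coef (-rt i) u • etaOp c V i := by
  simp [iota]

lemma rho_lie (u v : E6) (hu : IsDeg 0 u) (hv : IsDeg 0 v) :
    rho c V ⁅u, v⁆ = (com (rho c V u) (rho c V v)) := by
  refine LinearMap.ext fun w => ?_
  rw [com_apply]
  simp only [rho_apply, hPart_five_lie u v hu hv, nuInv_lie u v hu hv, LinearMap.add_apply,
    LinearMap.smul_apply, LieModule.toEnd_apply_apply, Module.End.one_apply, lie_add, lie_smul, lie_lie,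
    mul_zero, zero_smul, add_zero, smul_add]
  rw [smul_comm]
  abel

lemma d_lie_zeroOp (r : Fin 16) (u : E6) :
    (com (opL V (dX r)) (zeroOp c V u)) = ∑ i, phi i r u • opL V (dX i) := by
  rw [zeroOp_apply, com_add, opL_lie, opL_lie_opR, dX_lie_polyAct, add_zero, map_sum]
  simp only [map_smul]

lemma d_lie_etaOp (r i : Fin 16) :
    (com (opL V (dX r)) (etaOp c V i)) = zeroOp c V ⁅xi r, eta i⁆ := by
  rw [etaOp, com_add, opL_lie, dX_lie_quadField, com_sum, zeroOp_apply]
  simp only [com_mul, opL_lie_opR, mul_zero, add_zero, opL_lie, dX_lie_mulX]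
  rw [Finset.sum_eq_single r]
  · simp
  · intro s _ hs
    simp [Ne.symm hs]
  · simp

lemma cf_zeroOp (u : E6) (w : Tens V) : cf 0 (zeroOp c V u w) = rho c V u (cf 0 w) := by
  rw [zeroOp_apply, LinearMap.add_apply, map_add, cf_polyAct, cf_opR, zero_add]

lemma cf_etaOp (i : Fin 16) (w : Tens V) : cf 0 (etaOp c V i w) = 0 := by
  rw [etaOp, quadField]
  simp only [map_sum, map_smul, map_mul, LinearMap.add_apply, LinearMap.sum_apply,
    LinearMap.smul_apply, Module.End.mul_apply, map_add, cf_mulX, smul_zero, Finset.sum_const_zero,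
    add_zero]

lemma zeroOp_lie (u v : E6) (hu : IsDeg 0 u) (hv : IsDeg 0 v) :
    (com (zeroOp c V u) (zeroOp c V v)) = zeroOp c V ⁅u, v⁆ := by
  rw [← sub_eq_zero]
  refine eq_zero_of_comm _ (fun r => ?_) (fun w => ?_)
  · rw [com_sub, com_com, d_lie_zeroOp, d_lie_zeroOp, d_lie_zeroOp, sum_com, com_sum]
    simp only [smul_com, com_smul]
    have h : ∀ i, (com (zeroOp c V u) (opL V (dX i))) = -∑ k, phi k i u • opL V (dX k) := fun i => by
      rw [com_skew, d_lie_zeroOp]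
    simp only [h, d_lie_zeroOp, phi_lie u v hu hv, Finset.sum_smul, sub_smul, Finset.smul_sum, smul_neg,
      smul_smul, Finset.sum_sub_distrib, Finset.sum_neg_distrib]
    rw [Finset.sum_comm (f := fun k i => (phi k i v * phi i r u) • opL V (dX k)),
      Finset.sum_comm (f := fun k i => (phi k i u * phi i r v) • opL V (dX k))]
    simp only [mul_comm (phi _ r u), mul_comm (phi _ r v)]
    abel
  · rw [com, LinearMap.sub_apply, LinearMap.sub_apply, map_sub, map_sub, Module.End.mul_apply,
      Module.End.mul_apply]
    simp only [cf_zeroOp]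
    rw [rho_lie u v hu hv, com]
    simp

lemma zeroOp_lie_etaOp (u : E6) (hu : IsDeg 0 u) (i : Fin 16) :
    (com (zeroOp c V u) (etaOp c V i)) = ∑ j, phi i j u • etaOp c V j := by
  rw [← sub_eq_zero]
  refine eq_zero_of_comm _ (fun r => ?_) (fun w => ?_)
  · rw [com_sub, com_com, d_lie_zeroOp, d_lie_etaOp, sum_com, com_sum, zeroOp_lie _ _ hu (isDeg_xi_eta r i),
      leibniz_lie, lie_xi u hu, lie_eta u hu, neg_lie, sum_lie, lie_sum]
    simp only [smul_com, com_smul, d_lie_etaOp, smul_lie, lie_smul, map_add, map_neg, map_sum, map_smul]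
    abel
  · rw [com, LinearMap.sub_apply, LinearMap.sub_apply, map_sub, map_sub, Module.End.mul_apply,
      Module.End.mul_apply]
    simp only [cf_zeroOp, cf_etaOp, map_zero, LinearMap.sum_apply, map_sum, LinearMap.smul_apply, map_smul,
      smul_zero, Finset.sum_const_zero, sub_zero]

lemma etaOp_lie_etaOp (i j : Fin 16) : (com (etaOp c V i) (etaOp c V j)) = 0 := by
  refine eq_zero_of_comm _ (fun r => ?_) (fun w => ?_)
  · rw [com_com, d_lie_etaOp, d_lie_etaOp, com_skew (zeroOp c V ⁅xi r, eta j⁆),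
      zeroOp_lie_etaOp _ (isDeg_xi_eta r i), zeroOp_lie_etaOp _ (isDeg_xi_eta r j)]
    simp only [phi_swap_eta i j r]
    abel
  · rw [com, LinearMap.sub_apply, map_sub, Module.End.mul_apply, Module.End.mul_apply, cf_etaOp,
      cf_etaOp, sub_zero]

lemma iota_deg_zero (u : E6) (hu : IsDeg 0 u) : iota c V u = zeroOp c V u := by
  have h1 : ∀ i, coef (rt i) u = 0 := fun i => hu.coef_eq ⟨rt i, form_rt i⟩ (by simp [rt_five])
  have h2 : ∀ i, coef (-rt i) u = 0 := fun i =>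
    hu.coef_eq (Root.neg ⟨rt i, form_rt i⟩) (by simp [Root.neg, rt_five])
  simp [iota_apply, h1, h2]

lemma iota_xi (i : Fin 16) : iota c V (xi i) = opL V (dX i) := by
  have h1 : ∀ j, coef (rt j) (xi i) = if j = i then 1 else 0 := fun j => by
    rw [coef_xi]
    simp only [rt_injective.eq_iff]
  have h2 : ∀ j, coef (-rt j) (xi i) = 0 := fun j =>
    (isDeg_xi i).coef_eq (Root.neg ⟨rt j, form_rt j⟩) (by simp [Root.neg, rt_five])
  have h3 : rho c V (xi i) = 0 := by
    rw [rho_apply, nuInv_xi, xi, hPart_E]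
    simp
  simp [iota_apply, h1, h2, zeroOp_apply, polyAct_xi, h3]

lemma iota_eta (i : Fin 16) : iota c V (eta i) = etaOp c V i := by
  have h1 : ∀ j, coef (-rt j) (eta i) = if j = i then 1 else 0 := fun j => by
    rw [coef_eta]
    simp only [rt_injective.eq_iff, neg_inj]
  have h2 : ∀ j, coef (rt j) (eta i) = 0 := fun j =>
    (isDeg_eta i).coef_eq ⟨rt j, form_rt j⟩ (by simp [rt_five])
  have h3 : rho c V (eta i) = 0 := by
    rw [rho_apply, nuInv_eta, eta, hPart_E]
    simp
  simp [iota_apply, h1, h2, zeroOp_apply, polyAct_eta, h3]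

lemma graded_induction {p : E6 → Prop} (h0 : ∀ u, IsDeg 0 u → p u) (hx : ∀ i, p (xi i))
    (he : ∀ i, p (eta i)) (hadd : ∀ x y, p x → p y → p (x + y))
    (hsmul : ∀ (a : ℂ) x, p x → p (a • x)) (u : E6) : p u := by
  refine E6_induction (fun h => h0 _ (isDeg_ofH h)) (fun α => ?_) hadd hsmul u
  rcases α.five with h | h | h
  · obtain ⟨i, hi⟩ := exists_rt_neg α h
    have : α = Root.neg ⟨rt i, form_rt i⟩ := Subtype.ext hi
    rw [this]
    exact he i
  · exact h0 _ (by simpa [h] using isDeg_E α)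
  · obtain ⟨i, hi⟩ := exists_rt α h
    have : α = ⟨rt i, form_rt i⟩ := Subtype.ext hi
    rw [this]
    exact hx i

lemma iota_lie_skew {u v : E6} (h : iota c V ⁅u, v⁆ = (com (iota c V u) (iota c V v))) :
    iota c V ⁅v, u⁆ = (com (iota c V v) (iota c V u)) := by
  rw [← lie_skew, map_neg, h, com_skew]
  simp

lemma iota_lie_of {u : E6}
    (h0 : ∀ v, IsDeg 0 v → iota c V ⁅u, v⁆ = (com (iota c V u) (iota c V v)))
    (hx : ∀ i, iota c V ⁅u, xi i⁆ = (com (iota c V u) (iota c V (xi i))))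
    (he : ∀ i, iota c V ⁅u, eta i⁆ = (com (iota c V u) (iota c V (eta i)))) (v : E6) :
    iota c V ⁅u, v⁆ = (com (iota c V u) (iota c V v)) :=
  graded_induction (p := fun v => iota c V ⁅u, v⁆ = (com (iota c V u) (iota c V v))) h0 hx he
    (fun x y hx hy => by rw [lie_add, map_add, hx, hy, map_add, com_add])
    (fun a x hx => by rw [lie_smul, map_smul, hx, map_smul, com_smul]) v

lemma iota_zero_xi (u : E6) (hu : IsDeg 0 u) (i : Fin 16) :
    iota c V ⁅u, xi i⁆ = (com (iota c V u) (iota c V (xi i))) := by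
  rw [iota_deg_zero u hu, lie_xi u hu, map_neg, map_sum]
  simp only [map_smul, iota_xi]
  rw [com_skew, d_lie_zeroOp]

lemma iota_zero_eta (u : E6) (hu : IsDeg 0 u) (i : Fin 16) :
    iota c V ⁅u, eta i⁆ = (com (iota c V u) (iota c V (eta i))) := by
  rw [iota_deg_zero u hu, lie_eta u hu, map_sum]
  simp only [map_smul, iota_eta]
  rw [zeroOp_lie_etaOp u hu]

lemma iota_xi_eta (r i : Fin 16) :
    iota c V ⁅xi r, eta i⁆ = (com (iota c V (xi r)) (iota c V (eta i))) := by
  rw [iota_deg_zero _ (isDeg_xi_eta r i), iota_xi, iota_eta, d_lie_etaOp]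

lemma iota_lie (u v : E6) : iota c V ⁅u, v⁆ = (com (iota c V u) (iota c V v)) := by
  refine graded_induction (p := fun u => iota c V ⁅u, v⁆ = (com (iota c V u) (iota c V v))) (fun u hu => ?_)
    (fun i => ?_) (fun i => ?_)
    (fun x y hx hy => by rw [add_lie, map_add, hx, hy, map_add, add_com])
    (fun a x hx => by rw [smul_lie, map_smul, hx, map_smul, smul_com]) u
  · refine iota_lie_of (fun v hv => ?_) (iota_zero_xi u hu) (iota_zero_eta u hu) v
    have h := hu.lie hv
    rw [zero_add] at h
    rw [iota_deg_zero _ h, iota_deg_zero u hu, iota_deg_zero v hv, zeroOp_lie u v hu hv]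
  · refine iota_lie_of (fun v hv => iota_lie_skew (iota_zero_xi v hv i)) (fun j => ?_)
      (fun j => iota_xi_eta i j) v
    rw [xi_lie_xi, map_zero, iota_xi, iota_xi, opL_lie, dX_lie_dX, map_zero]
  · refine iota_lie_of (fun v hv => iota_lie_skew (iota_zero_eta v hv i))
      (fun j => iota_lie_skew (iota_xi_eta j i)) (fun j => ?_) v
    rw [eta_lie_eta, map_zero, iota_eta, iota_eta, etaOp_lie_etaOp]

lemma iota_iota (u v : E6) (w : Tens V) :
    iota c V u (iota c V v w) = iota c V ⁅u, v⁆ w + iota c V v (iota c V u w) := by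
  rw [iota_lie, com_apply]
  abel

/-- The `𝒢^{E₆}`-module `V̂ = 𝒜 ⊗ V` with parameter `c`. -/
def Ext (_c : ℂ) (V : Type*) [AddCommGroup V] [Module ℂ V] := Tens V

instance : AddCommGroup (Ext c V) := inferInstanceAs (AddCommGroup (Tens V))
instance : Module ℂ (Ext c V) := inferInstanceAs (Module ℂ (Tens V))

/-- A representation makes its space a module. -/
abbrev lieRingModuleOf {M : Type*} [AddCommGroup M] [Module ℂ M] (f : E6 →ₗ[ℂ] Module.End ℂ M)
    (hf : ∀ u v w, f u (f v w) = f ⁅u, v⁆ w + f v (f u w)) : LieRingModule E6 M where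
  bracket u w := f u w
  add_lie u v w := by simp
  lie_add u w w' := by simp
  leibniz_lie u v w := hf u v w

/-- `𝒢^{E₆}` acts on `V̂` by `ι`. -/
instance : LieRingModule E6 (Ext c V) := lieRingModuleOf (M := Tens V) (iota c V) iota_iota

lemma lie_ext_def (u : E6) (w : Ext c V) : ⁅u, w⁆ = (iota c V u : Tens V → Tens V) w := rfl

instance : LieModule ℂ E6 (Ext c V) where
  smul_lie a u w := LinearMap.congr_fun (map_smul (iota c V) a u) w
  lie_smul a u w := map_smul (iota c V u) a w

end Ext

end E6Ext
end

noncomputable section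

namespace E6Ext

/-- `ν(E_{i,i} - E_{5+i,5+i}) ∈ H`. -/
def nuH : Fin 5 → Fin 6 → ℂ :=
  ![![1, 1 / 2, 1, 1, 1 / 2, 0], ![0, 1 / 2, 1, 1, 1 / 2, 0], ![0, 1 / 2, 0, 1, 1 / 2, 0],
    ![0, 1 / 2, 0, 0, 1 / 2, 0], ![0, 1 / 2, 0, 0, -1 / 2, 0]]

/-- The embedding `ν : o(10, ℂ) → 𝒢^{D₅} ⊆ 𝒢^{E₆}`. The factor `1 / 2` is there because the entries
at `(a, b)` and at `(b', a')` give the same term. -/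
def nu : o10 →ₗ[ℂ] E6 where
  toFun M := ofH (∑ i, (M : Matrix Idx Idx ℂ) (.inl i) (.inl i) • nuH i)
    + (1 / 2 : ℂ) • ∑ a, ∑ b, ((M : Matrix Idx Idx ℂ) a b * nuSign a b) • Ev (diff a b)
  map_add' M N := by
    have h : ∀ a b, ((M + N : o10) : Matrix Idx Idx ℂ) a b
      = (M : Matrix Idx Idx ℂ) a b + (N : Matrix Idx Idx ℂ) a b := fun _ _ => rfl
    simp only [h, add_smul, add_mul, Finset.sum_add_distrib, map_add, smul_add]
    abel
  map_smul' x M := by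
    simp only [smul_o10_apply, mul_assoc, mul_smul, ← Finset.smul_sum, map_smul, RingHom.id_apply,
      smul_add]
    rw [smul_comm]

lemma nuInv_nu (M : o10) : nuInv (nu M) = M := by
  have hs : ∀ x : Idx, x.swap.swap = x := Sum.swap_swap
  have hM := (mem_o10_iff (M : Matrix Idx Idx ℂ)).1 M.2
  have hEv : ∀ v : Lat, hPart (Ev v) = 0 := fun v => by
    unfold Ev
    split_ifs
    · exact hPart_E _
    · exact map_zero _
  have hp : hPart (nu M) = ∑ i, (M : Matrix Idx Idx ℂ) (.inl i) (.inl i) • nuH i := by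
    change hPart (_ + _) = _
    simp only [map_add, map_smul, map_sum, hPart_ofH, hEv, smul_zero, Finset.sum_const_zero, add_zero]
  apply Subtype.ext
  ext a b
  rw [nuInv_apply]
  by_cases hab : a = b
  · subst hab
    rw [if_pos rfl, hp]
    have key : ∀ i, diagEntry (.inl i) (∑ i, (M : Matrix Idx Idx ℂ) (.inl i) (.inl i) • nuH i)
        = (M : Matrix Idx Idx ℂ) (.inl i) (.inl i) := by
      intro i
      fin_cases i <;>
      simp [diagEntry, epsCoord, cartanD5, alphaHat, nuH, Fin.sum_univ_succ] <;> ring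
    rcases a with i | i
    · exact key i
    · have h1 := diagEntry_swap (.inl i) (∑ i, (M : Matrix Idx Idx ℂ) (.inl i) (.inl i) • nuH i)
      have h2 := hM (.inl i) (.inl i)
      rw [key] at h1
      exact h1.trans h2.symm
  · rw [if_neg hab]
    by_cases hab' : a = b.swap
    · subst hab'
      have h1 := hM b.swap b
      rw [hs] at h1
      have h2 : ∀ b : Idx, nuSign b.swap b = 0 := by decide +kernel
      rw [h2]
      have h3 : (M : Matrix Idx Idx ℂ) b.swap b = 0 := by linear_combination h1 / 2
      rw [h3]
      simp
    · have hEv' : ∀ c d : Idx, coef (diff a b) (Ev (diff c d)) =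
          if (c = a ∧ d = b) ∨ (c = b.swap ∧ d = a.swap) then 1 else 0 := by
        intro c d
        by_cases hcd : diff c d = diff a b
        · rw [if_pos (diff_inj a b c d ⟨hab, hab'⟩ hcd), hcd, Ev,
            dif_pos ((form_diff a b).2 ⟨hab, hab'⟩), coef_E, if_pos rfl]
        · rw [if_neg, Ev]
          · split_ifs
            · rw [coef_E, if_neg (Ne.symm hcd)]
            · exact map_zero _
          · rintro (⟨rfl, rfl⟩ | ⟨rfl, rfl⟩)
            · exact hcd rfl
            · exact hcd (diff_swap a b)
      have hc : coef (diff a b) (nu M) = (M : Matrix Idx Idx ℂ) a b * nuSign a b := by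
        change coef (diff a b) (_ + _) = _
        simp only [map_add, map_smul, map_sum, coef_ofH, hEv', smul_eq_mul]
        have e : ∀ c d : Idx, (M : Matrix Idx Idx ℂ) c d * (nuSign c d : ℂ)
            * (if (c = a ∧ d = b) ∨ (c = b.swap ∧ d = a.swap) then 1 else 0)
            = (if c = a then if d = b then (M : Matrix Idx Idx ℂ) a b * (nuSign a b : ℂ) else 0 else 0)
            + (if c = b.swap then if d = a.swap then
                (M : Matrix Idx Idx ℂ) a b * (nuSign a b : ℂ) else 0 else 0) := by
          intro c d
          by_cases h1 : c = a ∧ d = b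
          · obtain ⟨rfl, rfl⟩ := h1
            rw [if_pos (Or.inl ⟨rfl, rfl⟩), if_pos rfl, if_pos rfl, if_neg hab']
            ring
          · by_cases h2 : c = b.swap ∧ d = a.swap
            · obtain ⟨rfl, rfl⟩ := h2
              rw [if_pos (Or.inr ⟨rfl, rfl⟩), if_neg (Ne.symm hab'), if_pos rfl, if_pos rfl, nuSign_swap,
                hM]
              push_cast
              ring
            · rw [if_neg (by tauto), ← ite_and, ← ite_and, if_neg h1, if_neg h2]
              ring
        simp only [e, Finset.sum_add_distrib]
        simp
        ring
      rw [hc]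
      have h3 : (nuSign a b : ℂ) * nuSign a b = 1 := by exact_mod_cast nuSign_sq a b ⟨hab, hab'⟩
      linear_combination (M : Matrix Idx Idx ℂ) a b * h3

end E6Ext
end

noncomputable section

namespace E6Ext

/-! ### Weights of `o(10, ℂ)`, in coordinates with respect to `ε_1, …, ε_5` -/

/-- The inner product with `(ε_i, ε_j) = δ_{i,j}`. -/
def ip (x y : Fin 5 → ℚ) : ℚ := ∑ i, x i * y i

/-- Dominant integral weights. -/
def IsDominant (μ : Fin 5 → ℚ) : Prop :=
  (∀ i : Fin 4, ∃ n : ℕ, μ i.castSucc - μ i.succ = n) ∧ ∃ n : ℕ, μ 3 + μ 4 = n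

/-- Half the sum of the positive roots. -/
def halfSum : Fin 5 → ℚ := ![4, 3, 2, 1, 0]

/-- The highest weight of the span of `x_1, …, x_16`. -/
def spinHighest : Fin 5 → ℚ := ![1 / 2, 1 / 2, 1 / 2, 1 / 2, -1 / 2]

/-- The weights of the span of `x_1, …, x_16`. -/
def spinWeights : Set (Fin 5 → ℚ) :=
  {μ | ∃ k : Fin 5 → ZMod 2, ∑ i, k i = 1 ∧ ∀ i, μ i = 1 / 2 * (-1) ^ (k i).val}

/-- The weights `±ε_i` of the span of `ζ_1, …, ζ_10`. -/
def vectorWeights : Set (Fin 5 → ℚ) := {μ | ∃ i, μ = Pi.single i 1 ∨ μ = -Pi.single i 1}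

/-- `Υ(λ)`. -/
def upsilon (lam : Fin 5 → ℚ) : Set (Fin 5 → ℚ) :=
  {lam' | ∃ μ ∈ spinWeights, lam' = lam + μ ∧ IsDominant lam'}

/-- `Υ'(λ)`. -/
def upsilonPrime (lam : Fin 5 → ℚ) : Set (Fin 5 → ℚ) :=
  {lam' | ∃ μ ∈ vectorWeights, lam' = lam + μ ∧ IsDominant lam'}

/-- The Casimir eigenvalue `(μ + 2ρ, μ)`. -/
def casimir (μ : Fin 5 → ℚ) : ℚ := ip (μ + 2 • halfSum) μ

/-- The set whose minimum is `ℓ_ω(λ)`. -/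
def ellSet (lam : Fin 5 → ℚ) : Set ℚ :=
  {q | ∃ lam' ∈ upsilon lam, q = (casimir lam' - casimir lam - casimir spinHighest) / 2}

/-! ### Singular vectors and the set whose minimum is `♭(λ)` -/

/-- `w` is a singular vector of weight `μ`: a nonzero weight vector that is killed by all root vectors
for the positive roots `ε_i - ε_j` and `ε_i + ε_j`, `i < j`. -/
def IsSingular {N : Type*} [AddCommGroup N] [Module ℂ N] (act : o10 → Module.End ℂ N)
    (μ : Fin 5 → ℚ) (w : N) : Prop :=
  w ≠ 0 ∧ (∀ i, act (so (.inl i) (.inl i)) w = (μ i : ℂ) • w) ∧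
    ∀ i j, i < j → act (so (.inl i) (.inl j)) w = 0 ∧ act (so (.inl i) (.inr j)) w = 0

/-- The variable `x_{i+1}`. -/
def xv (i : Fin 16) : Poly := MvPolynomial.X i

/-- The quadratic polynomials `ζ_1, …, ζ_10`. -/
def zeta : Idx → Poly
  | .inl 0 => xv 0 * xv 10 + xv 1 * xv 8 - xv 2 * xv 5 + xv 3 * xv 4
  | .inl 1 => xv 0 * xv 12 + xv 1 * xv 9 - xv 2 * xv 7 + xv 4 * xv 6
  | .inl 2 => xv 0 * xv 13 + xv 1 * xv 11 - xv 3 * xv 7 + xv 5 * xv 6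
  | .inl 3 => xv 0 * xv 14 - xv 2 * xv 11 + xv 3 * xv 9 - xv 6 * xv 8
  | .inl 4 => -xv 1 * xv 14 - xv 2 * xv 13 + xv 3 * xv 12 - xv 6 * xv 10
  | .inr 0 => xv 6 * xv 15 + xv 7 * xv 14 + xv 9 * xv 13 - xv 11 * xv 12
  | .inr 1 => -xv 3 * xv 15 - xv 5 * xv 14 - xv 8 * xv 13 + xv 10 * xv 11
  | .inr 2 => xv 2 * xv 15 + xv 4 * xv 14 + xv 8 * xv 12 - xv 9 * xv 10
  | .inr 3 => xv 1 * xv 15 - xv 4 * xv 13 + xv 5 * xv 12 - xv 7 * xv 10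
  | .inr 4 => xv 0 * xv 15 + xv 4 * xv 11 - xv 5 * xv 9 + xv 7 * xv 8

section Flat

variable (V : Type*) [AddCommGroup V] [Module ℂ V] [LieRingModule o10 V] [LieModule ℂ o10 V]

/-- The tensor action `B(f ⊗ v) = B(f) ⊗ v + f ⊗ B(v)` of `o(10, ℂ)` on `𝒜 ⊗ V`. -/
def tensAct (B : o10) : Module.End ℂ (Tens V) :=
  opL V (polyAct (nu B)) + opR V (LieModule.toEnd ℂ o10 V B)

variable {V}

/-- `T'_a(v) = ∑_b ζ_b ⊗ (E_{a,b} - E_{b',a'}) v`. -/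
def Tprime (a : Idx) (v : V) : Tens V := ∑ b, tm (zeta b) ⁅so a b, v⁆

variable (V)

/-- The numbers `♭_{λ'}` for `λ' ∈ Υ'(λ)`: the scalars with `∑ T'_a(u_a) = ♭_{λ'} u` for a singular
vector `u = ∑ ζ_a ⊗ u_a` of weight `λ'`. -/
def flatSet (lam : Fin 5 → ℚ) : Set ℂ :=
  {b | ∃ lam' ∈ upsilonPrime lam, ∃ u : Idx → V,
    IsSingular (tensAct V) lam' (∑ a, tm (zeta a) (u a)) ∧
      ∑ a, Tprime a (u a) = b • ∑ a, tm (zeta a) (u a)}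

end Flat

end E6Ext
end

open scoped ComplexOrder

noncomputable section

namespace E6Ext

/-! ### Representations of `o(10, ℂ)` -/

/-! Let N be a nonzero submodule of 𝒜 ⊗ V. The ξ_i act as partial derivatives, so differentiating an
element of N until all its derivatives vanish gives some 1 ⊗ v ≠ 0 in N, and irreducibility of V
gives 1 ⊗ V ⊆ N. It remains to show that 𝒜_k ⊗ V ⊆ N implies 𝒜_{k+1} ⊗ V ⊆ N, where 𝒜_k is the space
of forms of degree k; this is `containsDegree_of_surjective`.

The structure constants of [ξ_r, η_i] are two Kronecker terms minus ∑_a Z^a_{ij} Z^a_{rl}, where Z^a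
is the Hessian of ζ_a (`phi_xi_eta`). Hence P_i g = k x_i g - ∑_{a,j} Z^a_{ij} ζ_a ∂_j g for g of
degree k (`quadField_of_isHomogeneous`). Modulo multiples of the quadrics, ∑_i η_i(g ⊗ u_i) is
therefore ∑_r x_r g ⊗ u'_r with u' = (Ω + k - c/2)u. Here Ω is the mixed part of the Casimir
operator of o(10) on the span of the x_i tensored with V (`spinBasis_mixed`). If Ω + k - c/2 is
surjective, every x_i g ⊗ v lies in N up to terms ζ_a ∂_j g ⊗ w.

Those terms are obtained by contracting with the Hessian: for g of degree n, ∑_{i,j} Z^a_{ij}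
η_i(x_j g ⊗ v) = ∑_b ζ_b g ⊗ B_{a,b} v + (n - 6 - c) ζ_a g ⊗ v (`sum_Z_smul_iota_eta`). This rests
on the facts that the ζ_a span the natural module (`polyAct_nu_zeta`) and that ∑_b ζ_b B_{a,b} acts
on 𝒜 as ½ ζ_a times the Euler field (`sum_zeta_polyAct`). The right side is Ω' + n - 6 - c, with Ω'
the mixed Casimir operator of the natural module tensored with V; Ω' is the operator T' that defines
the numbers ♭.

Surjectivity is a question about eigenvalues, V being finite-dimensional. The Casimir operator of V
is a scalar, so an eigenspace of Ω or Ω' is an eigenspace of the Casimir operator of the tensor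
product; it is invariant and contains a singular vector, whose weight is λ plus a weight of the
small factor and is dominant integral (`WeightBasis.exists_isSing_of_eigenvalue`). The eigenvalue is
then a difference of Casimir values. The weights of each small factor have equal length and are
congruent modulo the root lattice, so these values differ by integers
(`WeightBasis.exists_nat_of_mixedVal_le`). All eigenvalues thus lie in ℓ_ω(λ) + ℕ or ♭(λ) + ℕ, and
the two excluded progressions for c are what the induction needs. -/

lemma o10_ext {M N : o10} (h : ∀ a b, (M : Matrix Idx Idx ℂ) a b = (N : Matrix Idx Idx ℂ) a b) :
    M = N :=
  Subtype.ext (Matrix.ext h)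

lemma o10_skew (M : o10) (a b : Idx) :
    (M : Matrix Idx Idx ℂ) b.swap a.swap = -(M : Matrix Idx Idx ℂ) a b :=
  (mem_o10_iff _).1 M.2 a b

lemma sum_o10_apply {ι : Type*} (s : Finset ι) (f : ι → o10) (a b : Idx) :
    ((∑ i ∈ s, f i : o10) : Matrix Idx Idx ℂ) a b = ∑ i ∈ s, (f i : Matrix Idx Idx ℂ) a b := by
  classical
  induction s using Finset.induction_on with
  | empty => rfl
  | insert i s hi ih =>
    rw [Finset.sum_insert hi, Finset.sum_insert hi, ← ih]
    rfl

/-- The nested conditionals let `Finset.sum_ite_eq` evaluate sums one index at a time. -/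
lemma so_entry (a b c d : Idx) : (so a b : Matrix Idx Idx ℂ) c d =
    (if c = a then if d = b then 1 else 0 else 0)
      - (if c = b.swap then if d = a.swap then 1 else 0 else 0) := by
  rw [so_apply, ← ite_and, ← ite_and]
  simp only [eq_comm]

lemma so_self_swap (a : Idx) : so a a.swap = 0 := by
  refine o10_ext fun c d => ?_
  rw [so_entry, Sum.swap_swap, sub_self]
  rfl

/-- By skewness the entries at (a, b) and (b', a') contribute the same term, whence the factor 1/2.
-/
lemma o10_eq_sum (M : o10) : M = (1 / 2 : ℂ) • ∑ a, ∑ b, (M : Matrix Idx Idx ℂ) a b • so a b := by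
  refine o10_ext fun c d => ?_
  rw [smul_o10_apply, sum_o10_apply]
  simp only [sum_o10_apply, smul_o10_apply, so_entry, mul_sub, mul_ite, mul_one, mul_zero,
    Finset.sum_sub_distrib, Finset.sum_ite_eq, Finset.mem_univ, if_true, Finset.sum_ite_irrel,
    Finset.sum_const_zero]
  have h : ∀ x : Idx, (∑ y : Idx, if c = y.swap then if d = x.swap then
      (M : Matrix Idx Idx ℂ) x y else 0 else 0) = if d = x.swap then (M : Matrix Idx Idx ℂ) x c.swap else 0 := by
    intro x
    rw [Finset.sum_eq_single c.swap]
    · simp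
    · intro y _ hy
      rw [if_neg]
      exact fun h => hy (by rw [h, Sum.swap_swap])
    · simp
  simp only [h]
  rw [Finset.sum_eq_single d.swap]
  · simp only [Sum.swap_swap, if_true]
    rw [o10_skew]
    ring
  · intro y _ hy
    rw [if_neg]
    exact fun h => hy (by rw [h, Sum.swap_swap])
  · simp

/-- This is the commutator of M with E_{a,b}, antisymmetrised; the half coming from E_{b',a'} fits
because M is skew. Thus M acts on the first index as on a basis vector and on the second as on a
dual one. -/
lemma lie_so (M : o10) (a b : Idx) : ⁅M, so a b⁆ =
    ∑ c, (M : Matrix Idx Idx ℂ) c a • so c b - ∑ d, (M : Matrix Idx Idx ℂ) b d • so a d := by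
  refine o10_ext fun x y => ?_
  rw [lie_o10_coe, sub_o10_apply, sum_o10_apply, sum_o10_apply, Matrix.sub_apply, Matrix.mul_apply,
    Matrix.mul_apply]
  have h : ∀ (f : Idx → ℂ) (z : Idx), (∑ w : Idx, if z = w.swap then f w else 0) = f z.swap := by
    intro f z
    rw [Finset.sum_eq_single z.swap]
    · simp
    · intro w _ hw
      rw [if_neg]
      exact fun h => hw (by rw [h, Sum.swap_swap])
    · simp
  simp only [smul_o10_apply, so_entry, mul_sub, sub_mul, ite_mul, one_mul, zero_mul, mul_ite, mul_one,
    mul_zero, Finset.sum_sub_distrib, Finset.sum_ite_eq, Finset.sum_ite_eq', Finset.mem_univ, if_true, Finset.sum_ite_irrel,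
    Finset.sum_const_zero, h]
  have h1 := o10_skew M b x.swap
  have h2 := o10_skew M y.swap a
  rw [Sum.swap_swap] at h1 h2
  rw [h1, h2]
  split_ifs <;> ring

/-! ### Representations, the Casimir operator and singular vectors. -/

variable {N : Type*} [AddCommGroup N] [Module ℂ N]

/-- A linear map to endomorphisms that is a representation of `o(10, ℂ)`. -/
def IsRep (R : o10 →ₗ[ℂ] Module.End ℂ N) : Prop := ∀ A B, R ⁅A, B⁆ = com (R A) (R B)

/-- The Casimir operator of a representation. -/
def cas (R : o10 →ₗ[ℂ] Module.End ℂ N) : Module.End ℂ N :=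
  (1 / 2 : ℂ) • ∑ a, ∑ b, R (so a b) * R (so b a)

/-- In B_{a,b} B_{b,a} each index occurs once as a vector and once as a covector, so by `lie_so` the
contributions of M cancel in pairs after renaming summation indices. -/
lemma com_cas {R : o10 →ₗ[ℂ] Module.End ℂ N} (hR : IsRep R) (M : o10) : com (R M) (cas R) = 0 := by
  rw [cas, com_smul, com_sum]
  simp only [com_sum, com_mul, ← hR M, lie_so, map_sub, map_sum, map_smul, sub_mul, mul_sub, Finset.sum_mul,
    Finset.mul_sum, smul_mul_assoc, mul_smul_comm, Finset.sum_add_distrib, Finset.sum_sub_distrib]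
  have e1 : ∑ a, ∑ b, ∑ c, (M : Matrix Idx Idx ℂ) c a • (R (so c b) * R (so b a))
      = ∑ a, ∑ b, ∑ c, (M : Matrix Idx Idx ℂ) a c • (R (so a b) * R (so b c)) := by
    rw [Finset.sum_comm]
    rw [Finset.sum_comm (f := fun a b => ∑ c, (M : Matrix Idx Idx ℂ) a c • (R (so a b) * R (so b c)))]
    exact Finset.sum_congr rfl fun b _ => Finset.sum_comm
  have e2 : ∑ a, ∑ b, ∑ d, (M : Matrix Idx Idx ℂ) b d • (R (so a d) * R (so b a))
      = ∑ a, ∑ b, ∑ c, (M : Matrix Idx Idx ℂ) c b • (R (so a b) * R (so c a)) :=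
    Finset.sum_congr rfl fun a _ => Finset.sum_comm
  rw [e1, e2]
  simp

lemma cas_apply_comm {R : o10 →ₗ[ℂ] Module.End ℂ N} (hR : IsRep R) (M : o10) (w : N) :
    cas R (R M w) = R M (cas R w) := by
  have := LinearMap.congr_fun (com_cas hR M) w
  rw [com_apply] at this
  exact (sub_eq_zero.1 this).symm

/-- The value at the weight `μ` of the weight of the `a`-th standard basis vector. -/
def pair (μ : Fin 5 → ℂ) (a : Idx) : ℂ := ∑ i, (wt a i : ℂ) * μ i

lemma pair_inl (μ : Fin 5 → ℂ) (i : Fin 5) : pair μ (.inl i) = μ i := by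
  simp [pair, wt, Pi.single_apply]

lemma pair_inr (μ : Fin 5 → ℂ) (i : Fin 5) : pair μ (.inr i) = -μ i := by
  simp [pair, wt, Pi.single_apply]

/-- The height of the weight of the `a`-th standard basis vector. -/
def hgt : Idx → ℤ
  | .inl i => 4 - (i : ℕ)
  | .inr i => (i : ℕ) - 4

/-- `w` is a singular vector of the complex weight `μ`. -/
def IsSing (R : o10 →ₗ[ℂ] Module.End ℂ N) (μ : Fin 5 → ℂ) (w : N) : Prop :=
  w ≠ 0 ∧ (∀ i, R (so (.inl i) (.inl i)) w = μ i • w) ∧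
    ∀ i j, i < j → R (so (.inl i) (.inl j)) w = 0 ∧ R (so (.inl i) (.inr j)) w = 0

/-- The height difference is the height of the root of B_{a,b}. Up to the sign rule `so_swap`, a
root vector that raises heights is one of those in the definition of a singular vector, or zero. -/
lemma IsSing.pos {R : o10 →ₗ[ℂ] Module.End ℂ N} {μ : Fin 5 → ℂ} {w : N} (h : IsSing R μ w)
    (a b : Idx) (hab : hgt b < hgt a) : R (so a b) w = 0 := by
  rcases a with i | i <;> rcases b with j | j <;> simp only [hgt] at hab
  · exact (h.2.2 i j (Fin.lt_def.2 (by omega))).1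
  · rcases lt_trichotomy i j with hij | hij | hij
    · exact (h.2.2 i j hij).2
    · subst hij
      have : so (.inl i) (.inr i) = 0 := so_self_swap (.inl i)
      rw [this, map_zero, LinearMap.zero_apply]
    · have := so_swap (.inl j) (.inr i)
      simp only [Sum.swap_inl, Sum.swap_inr] at this
      rw [this, map_neg, LinearMap.neg_apply, (h.2.2 j i hij).2, neg_zero]
  · omega
  · have := so_swap (.inl j) (.inl i)
    simp only [Sum.swap_inl] at this
    rw [this, map_neg, LinearMap.neg_apply, (h.2.2 j i (Fin.lt_def.2 (by omega))).1, neg_zero]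

lemma IsSing.diag {R : o10 →ₗ[ℂ] Module.End ℂ N} {μ : Fin 5 → ℂ} {w : N} (h : IsSing R μ w)
    (a : Idx) : R (so a a) w = pair μ a • w := by
  rcases a with i | i
  · rw [h.2.1, pair_inl]
  · have := so_swap (.inl i) (.inl i)
    simp only [Sum.swap_inl] at this
    rw [this, map_neg, LinearMap.neg_apply, h.2.1, pair_inr, neg_smul]

/-- The Casimir eigenvalue for a complex weight. -/
def casC (μ : Fin 5 → ℂ) : ℂ := ∑ i, μ i * (μ i + 2 * (halfSum i : ℂ))

lemma casC_cast (μ : Fin 5 → ℚ) : casC (fun i => (μ i : ℂ)) = (casimir μ : ℂ) := by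
  simp only [casC, casimir, ip, two_nsmul, Pi.add_apply]
  push_cast
  exact Finset.sum_congr rfl fun i _ => by ring

/-- Only ±ε_5 share a height, and there B_{a,a'} = 0. So every nonzero B_{a,b} is diagonal, raising
or lowering. -/
lemma hgt_eq {a b : Idx} (h : hgt a = hgt b) : a = b ∨ a = b.swap := by
  revert a b; decide

/-- If B_{a,b} raises heights, B_{a,b} B_{b,a} w is the commutator applied to w and gives μ_a - μ_b;
if it lowers them, B_{b,a} w = 0 already. The diagonal terms give (μ, μ) and the positive roots give
(2ρ, μ). -/
lemma IsSing.cas_apply {R : o10 →ₗ[ℂ] Module.End ℂ N} (hR : IsRep R) {μ : Fin 5 → ℂ} {w : N}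
    (h : IsSing R μ w) : cas R w = casC μ • w := by
  have key : ∀ a b, R (so a b) (R (so b a) w) = (if a = b then pair μ a ^ 2 else if a = b.swap then 0
      else if hgt b < hgt a then pair μ a - pair μ b else 0) • w := by
    intro a b
    split_ifs with h1 h2 h3
    · subst h1
      rw [h.diag, map_smul, h.diag, smul_smul, sq]
    · have : so a b = 0 := by rw [h2, ← so_self_swap b.swap, Sum.swap_swap]
      rw [this]
      simp
    · have h4 := LinearMap.congr_fun (hR (so a b) (so b a)) w
      rw [com_apply, so_lie_so ⟨h1, h2⟩ ⟨Ne.symm h1, fun h' => h2 (by rw [h', Sum.swap_swap])⟩, if_pos rfl,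
        h.pos a b h3, map_zero, sub_zero, map_sub, LinearMap.sub_apply, h.diag, h.diag, ← sub_smul] at h4
      exact h4.symm
    · have h4 : hgt a < hgt b := by
        rcases lt_trichotomy (hgt a) (hgt b) with h' | h' | h'
        · exact h'
        · rcases hgt_eq h' with h'' | h''
          · exact absurd h'' h1
          · exact absurd h'' h2
        · exact absurd h' h3
      rw [h.pos b a h4, map_zero, zero_smul]
  rw [cas]
  simp only [LinearMap.smul_apply, LinearMap.sum_apply, Module.End.mul_apply, key, ← Finset.sum_smul,
    smul_smul]
  congr 1
  simp only [Fintype.sum_sum_type, pair_inl, pair_inr, Sum.swap_inl, Sum.swap_inr, hgt, casC, halfSum,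
    Fin.sum_univ_five]
  simp
  ring

/-- The element of the Cartan subalgebra that measures heights. -/
def hElt : o10 := ∑ i : Fin 5, (halfSum i : ℂ) • so (.inl i) (.inl i)

lemma so_diag_apply (i : Fin 5) (a b : Idx) : (so (.inl i) (.inl i) : Matrix Idx Idx ℂ) a b =
    if a = b then (wt a i : ℂ) else 0 := by
  rw [so_entry]
  rcases a with a | a <;> rcases b with b | b <;> simp [wt, Pi.single_apply] <;> grind

lemma cartan_lie_so (i : Fin 5) (a b : Idx) :
    ⁅so (.inl i) (.inl i), so a b⁆ = ((wt a i : ℂ) - wt b i) • so a b := by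
  rw [lie_so]
  simp [so_diag_apply, sub_smul]

lemma sum_halfSum_wt (a : Idx) : ∑ i, (halfSum i : ℂ) * (wt a i : ℂ) = hgt a := by
  rcases a with i | i <;> fin_cases i <;> simp [wt, hgt, halfSum, Fin.sum_univ_five]

lemma hElt_lie_so (a b : Idx) : ⁅hElt, so a b⁆ = ((hgt a - hgt b : ℤ) : ℂ) • so a b := by
  rw [hElt, sum_lie]
  simp only [smul_lie, cartan_lie_so, smul_smul, ← Finset.sum_smul, mul_sub, Finset.sum_sub_distrib,
    sum_halfSum_wt]
  push_cast
  rfl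

lemma cartan_lie_cartan (i j : Fin 5) : ⁅so (.inl i) (.inl i), so (.inl j) (.inl j)⁆ = 0 := by
  rw [cartan_lie_so, sub_self, zero_smul]

lemma IsRep.apply_apply {R : o10 →ₗ[ℂ] Module.End ℂ N} (hR : IsRep R) (A B : o10) (w : N) :
    R A (R B w) = R ⁅A, B⁆ w + R B (R A w) := by
  rw [hR, com_apply, sub_add_cancel]

/-! ### Existence of singular vectors and dominance of their weights. -/

lemma exists_eigenvector_mem [FiniteDimensional ℂ N] (T : Module.End ℂ N) (W : Submodule ℂ N)
    (hW : W ≠ ⊥) (hT : ∀ w ∈ W, T w ∈ W) : ∃ e : ℂ, ∃ w ∈ W, w ≠ 0 ∧ T w = e • w := by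
  have : Nontrivial W := Submodule.nontrivial_iff_ne_bot.2 hW
  obtain ⟨e, he⟩ := Module.End.exists_eigenvalue (T.restrict hT)
  obtain ⟨w, hw⟩ := he.exists_hasEigenvector
  refine ⟨e, w, w.2, fun h => hw.2 (Subtype.ext h), ?_⟩
  have := congrArg Subtype.val hw.apply_eq_smul
  exact this

/-- The subspace is cut down by an eigenspace of one operator at a time; commutativity keeps it
stable under the remaining operators. -/
lemma exists_common_eigenvector [FiniteDimensional ℂ N] {ι : Type*} [Fintype ι]
    (T : ι → Module.End ℂ N) (hT : ∀ i j w, T i (T j w) = T j (T i w)) (W : Submodule ℂ N)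
    (hW : W ≠ ⊥) (hWT : ∀ i, ∀ w ∈ W, T i w ∈ W) :
    ∃ μ : ι → ℂ, ∃ w ∈ W, w ≠ 0 ∧ ∀ i, T i w = μ i • w := by
  classical
  have key : ∀ s : Finset ι, ∃ K : Submodule ℂ N, K ≤ W ∧ K ≠ ⊥ ∧ (∀ i, ∀ w ∈ K, T i w ∈ K) ∧
      ∀ i ∈ s, ∃ e : ℂ, ∀ w ∈ K, T i w = e • w := by
    intro s
    induction s using Finset.induction_on with
    | empty => exact ⟨W, le_rfl, hW, hWT, by simp⟩
    | insert i s hi ih =>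
      obtain ⟨K, h1, h2, h3, h4⟩ := ih
      obtain ⟨e, w, hw, hw0, he⟩ := exists_eigenvector_mem (T i) K h2 (h3 i)
      refine ⟨K ⊓ (T i).eigenspace e, inf_le_left.trans h1, ?_, ?_, ?_⟩
      · refine (Submodule.ne_bot_iff _).2 ⟨w, ⟨hw, ?_⟩, hw0⟩
        exact Module.End.mem_eigenspace_iff.2 he
      · rintro j x ⟨hx1, hx2⟩
        refine ⟨h3 j x hx1, Module.End.mem_eigenspace_iff.2 ?_⟩
        rw [hT, Module.End.mem_eigenspace_iff.1 hx2, map_smul]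
      · intro j hj
        rcases Finset.mem_insert.1 hj with rfl | hj
        · exact ⟨e, fun x hx => Module.End.mem_eigenspace_iff.1 hx.2⟩
        · obtain ⟨e', he'⟩ := h4 j hj
          exact ⟨e', fun x hx => he' x hx.1⟩
  obtain ⟨K, h1, h2, -, h4⟩ := key Finset.univ
  obtain ⟨w, hw, hw0⟩ := (Submodule.ne_bot_iff _).1 h2
  choose μ hμ using fun i => h4 i (Finset.mem_univ i)
  exact ⟨μ, w, h1 hw, hw0, fun i => hμ i w hw⟩

/-- A nonzero finite-dimensional invariant subspace contains a singular vector. -/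
lemma exists_isSing [FiniteDimensional ℂ N] {R : o10 →ₗ[ℂ] Module.End ℂ N} (hR : IsRep R)
    (W : Submodule ℂ N) (hW : W ≠ ⊥) (hWR : ∀ M, ∀ w ∈ W, R M w ∈ W) :
    ∃ μ, ∃ w ∈ W, IsSing R μ w := by
  let S : Set ℂ := {e | ∃ w ∈ W, w ≠ 0 ∧ R hElt w = e • w}
  have hS : S.Finite := by
    refine (Module.End.finite_hasEigenvalue (f := R hElt)).subset ?_
    rintro e ⟨w, -, hw0, hw⟩
    exact Module.End.hasEigenvalue_of_hasEigenvector (x := w)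
      ⟨Module.End.mem_eigenspace_iff.2 hw, hw0⟩
  have hS' : S.Nonempty := exists_eigenvector_mem (R hElt) W hW (hWR _)
  -- A vector with `hElt`-eigenvalue of maximal real part is killed by every raising operator, since
  -- those add a positive integer to the eigenvalue. Real parts are compared because the eigenvalues
  -- are not yet known to be real.
  obtain ⟨e, ⟨w, hwW, hw0, hw⟩, hmax⟩ := Set.exists_max_image S Complex.re hS hS'
  have hcomm : ∀ i, ⁅so (.inl i) (.inl i), hElt⁆ = 0 := by
    intro i
    rw [hElt, lie_sum]
    simp [cartan_lie_cartan]
  obtain ⟨μ, x, ⟨hxW, hxe⟩, hx0, hx⟩ := exists_common_eigenvector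
    (fun i : Fin 5 => R (so (.inl i) (.inl i)))
    (fun i j x => by rw [hR.apply_apply, cartan_lie_cartan, map_zero, LinearMap.zero_apply, zero_add])
    (W ⊓ (R hElt).eigenspace e)
    ((Submodule.ne_bot_iff _).2 ⟨w, ⟨hwW, Module.End.mem_eigenspace_iff.2 hw⟩, hw0⟩)
    (by
      rintro i x ⟨hx1, hx2⟩
      refine ⟨hWR _ _ hx1, Module.End.mem_eigenspace_iff.2 ?_⟩
      have := hR.apply_apply (so (.inl i) (.inl i)) hElt x
      rw [hcomm, map_zero, LinearMap.zero_apply, zero_add] at this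
      rw [← this, Module.End.mem_eigenspace_iff.1 hx2, map_smul])
  have kill : ∀ a b, hgt b < hgt a → R (so a b) x = 0 := by
    intro a b hab
    by_contra hne
    have hmem : e + ((hgt a - hgt b : ℤ) : ℂ) ∈ S := by
      refine ⟨_, hWR (so a b) x hxW, hne, ?_⟩
      rw [hR.apply_apply, hElt_lie_so, map_smul, LinearMap.smul_apply,
        Module.End.mem_eigenspace_iff.1 hxe, map_smul, ← add_smul, add_comm]
    have := hmax _ hmem
    rw [Complex.add_re, Complex.intCast_re] at this
    have h1 : (0 : ℝ) < ((hgt a - hgt b : ℤ) : ℝ) := by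
      rw [Int.cast_pos]
      omega
    linarith
  refine ⟨μ, x, hxW, hx0, hx, fun i j hij => ⟨kill _ _ ?_, kill _ _ ?_⟩⟩ <;>
    simp only [hgt] <;> have := Fin.lt_def.1 hij <;> omega

/-- B_{a,b}, B_{b,a} and their bracket form an 𝔰𝔩₂-triple for which w is a primitive vector, so its
weight is a natural number in finite dimension. -/
lemma IsSing.exists_nat [FiniteDimensional ℂ N] {R : o10 →ₗ[ℂ] Module.End ℂ N} (hR : IsRep R)
    {μ : Fin 5 → ℂ} {w : N} (h : IsSing R μ w) (a b : Idx) (h1 : a ≠ b) (h2 : a ≠ b.swap)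
    (hab : hgt b < hgt a) : ∃ n : ℕ, pair μ a - pair μ b = n := by
  have h1' : b ≠ a := Ne.symm h1
  have h2' : b ≠ a.swap := fun h' => h2 (by rw [h', Sum.swap_swap])
  have hs : ∀ x : Idx, x.swap.swap = x := Sum.swap_swap
  have hn : ∀ x : Idx, x ≠ x.swap := by decide
  have hw : R (so a a - so b b) w = (pair μ a - pair μ b) • w := by
    rw [map_sub, LinearMap.sub_apply, h.diag, h.diag, sub_smul]
  -- An `IsSl2Triple` requires a nonzero semisimple element. If it acts as zero, the weight
  -- difference is 0 because w ≠ 0.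
  by_cases h0 : R (so a a - so b b) = 0
  · rw [h0, LinearMap.zero_apply] at hw
    exact ⟨0, by simpa using (smul_eq_zero.1 hw.symm).resolve_right h.1⟩
  have e1 : ⁅so a b, so b a⁆ = so a a - so b b := by
    rw [so_lie_so ⟨h1, h2⟩ ⟨h1', h2'⟩, if_pos rfl]
  have e2 : ∀ c d : Idx, c ≠ d → c ≠ d.swap → ⁅so c c - so d d, so c d⁆ = (2 : ℂ) • so c d := by
    intro c d g1 g2
    have g3 : d ≠ c.swap := fun h' => g2 (by rw [h', hs])
    rw [lie_so]
    have hc := hn c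
    have hd := hn d
    have k1 : ∀ x, ((so c c - so d d : o10) : Matrix Idx Idx ℂ) x c = if x = c then 1 else 0 := by
      intro x
      rw [sub_o10_apply, so_entry, so_entry]
      simp [hc, g1, g2]
    have k2 : ∀ x, ((so c c - so d d : o10) : Matrix Idx Idx ℂ) d x = if x = d then -1 else 0 := by
      intro x
      rw [sub_o10_apply, so_entry, so_entry]
      by_cases hx : x = d <;> simp [hx, hd, g1.symm, g3]
    simp only [k1, k2, ite_smul, one_smul, zero_smul, Finset.sum_ite_eq', Finset.mem_univ, if_true,
      neg_smul, sub_neg_eq_add, two_smul]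
  have e3 : ⁅so a a - so b b, so b a⁆ = -((2 : ℂ) • so b a) := by
    rw [← e2 b a h1' h2', ← neg_lie, neg_sub]
  -- The bracket of this instance is definitionally `com`.
  let _ : LieRing (Module.End ℂ N) := LieRing.ofAssociativeRing
  have t : IsSl2Triple (R (so a a - so b b)) (R (so a b)) (R (so b a)) := by
    refine ⟨h0, ?_, ?_, ?_⟩
    · exact (hR (so a b) (so b a)).symm.trans (by rw [e1])
    · exact (hR (so a a - so b b) (so a b)).symm.trans (by rw [e2 a b h1 h2, map_smul, two_smul, two_smul])
    · exact (hR (so a a - so b b) (so b a)).symm.trans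
        (by rw [e3, map_neg, map_smul, two_smul, two_smul])
  have P : t.HasPrimitiveVectorWith w (pair μ a - pair μ b) := ⟨h.1, hw, h.pos a b hab⟩
  exact P.exists_nat

/-- The weight of a singular vector of a finite-dimensional module is dominant integral. -/
lemma IsSing.dominant [FiniteDimensional ℂ N] {R : o10 →ₗ[ℂ] Module.End ℂ N} (hR : IsRep R)
    {μ : Fin 5 → ℂ} {w : N} (h : IsSing R μ w) :
    ∃ q : Fin 5 → ℚ, (∀ i, μ i = q i) ∧ IsDominant q := by
  have h1 : ∀ i : Fin 4, ∃ n : ℕ, μ i.castSucc - μ i.succ = n := by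
    intro i
    have := h.exists_nat hR (.inl i.castSucc) (.inl i.succ) (by simp [Fin.ext_iff]) (by simp)
      (by simp [hgt])
    simpa only [pair_inl] using this
  have h2 : ∃ n : ℕ, μ 3 + μ 4 = n := by
    have := h.exists_nat hR (.inl 3) (.inr 4) (by simp) (by simp) (by decide)
    simpa only [pair_inl, pair_inr, sub_neg_eq_add] using this
  choose n hn using h1
  obtain ⟨m, hm⟩ := h2
  have n0 := hn 0
  have n1 := hn 1
  have n2 := hn 2
  have n3 := hn 3
  simp only [Fin.reduceCastSucc, Fin.reduceSucc] at n0 n1 n2 n3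
  -- The last coordinate comes from μ_4 + μ_5 = m and μ_4 - μ_5 = n 3; the others are obtained by
  -- adding successive differences.
  refine ⟨![(m - n 3) / 2 + n 3 + n 2 + n 1 + n 0, (m - n 3) / 2 + n 3 + n 2 + n 1,
    (m - n 3) / 2 + n 3 + n 2, (m - n 3) / 2 + n 3, (m - n 3) / 2], ?_, ?_, ?_⟩
  · intro i
    fin_cases i <;> simp
    · linear_combination n0 + n1 + n2 + n3 / 2 + hm / 2
    · linear_combination n1 + n2 + n3 / 2 + hm / 2
    · linear_combination n2 + n3 / 2 + hm / 2
    · linear_combination n3 / 2 + hm / 2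
    · linear_combination hm / 2 - n3 / 2
  · intro i
    refine ⟨n i, ?_⟩
    fin_cases i <;> simp
  · exact ⟨m, by simp; ring⟩

/-! ### Descendants of a singular vector and consequences of irreducibility. -/

/-- The vectors obtained from `w` by negative root vectors, with their depth. -/
inductive Desc (R : o10 →ₗ[ℂ] Module.End ℂ N) (w : N) : ℕ → N → Prop
  | base : Desc R w 0 w
  | step {n k : ℕ} {m : N} {a b : Idx} (h : Desc R w n m) (hk : hgt b = hgt a + (k + 1)) :
    Desc R w (n + (k + 1)) (R (so a b) m)

/-- Each step lowers the height by `k + 1`, hence by at least one, so depth zero is attained only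
without steps. -/
lemma Desc.zero {R : o10 →ₗ[ℂ] Module.End ℂ N} {w m : N} {n : ℕ} (h : Desc R w n m) (hn : n = 0) :
    m = w := by
  cases h with
  | base => rfl
  | step h hk => omega

lemma IsSing.hElt_apply {R : o10 →ₗ[ℂ] Module.End ℂ N} {μ : Fin 5 → ℂ} {w : N} (h : IsSing R μ w) :
    R hElt w = (∑ i, (halfSum i : ℂ) * μ i) • w := by
  rw [hElt, map_sum, LinearMap.sum_apply, Finset.sum_smul]
  refine Finset.sum_congr rfl fun i _ => ?_
  rw [map_smul, LinearMap.smul_apply, h.2.1, smul_smul]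

/-- Depth is the drop of the `hElt`-eigenvalue, so descendants of different depths are separated by
eigenspaces. -/
lemma Desc.hElt_apply {R : o10 →ₗ[ℂ] Module.End ℂ N} (hR : IsRep R) {w m : N} {n : ℕ} {e : ℂ}
    (hw : R hElt w = e • w) (h : Desc R w n m) : R hElt m = (e - n) • m := by
  induction h with
  | base => simpa using hw
  | @step n k m a b h hk ih =>
    rw [hR.apply_apply, hElt_lie_so, map_smul, LinearMap.smul_apply, ih, map_smul, ← add_smul, hk]
    congr 1
    push_cast
    ring

/-- The span of the descendants of a singular vector is invariant. -/
lemma IsSing.span_invariant {R : o10 →ₗ[ℂ] Module.End ℂ N} (hR : IsRep R) {μ : Fin 5 → ℂ} {w : N}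
    (h : IsSing R μ w) (M : o10) (x : N) (hx : x ∈ Submodule.span ℂ {m | ∃ n, Desc R w n m}) :
    R M x ∈ Submodule.span ℂ {m | ∃ n, Desc R w n m} := by
  have key : ∀ n m, Desc R w n m → ∀ M, R M m ∈ Submodule.span ℂ {m | ∃ n, Desc R w n m} := by
    intro n m hm
    induction hm with
    | base =>
      intro M
      rw [o10_eq_sum M, map_smul, map_sum, LinearMap.smul_apply, LinearMap.sum_apply]
      refine Submodule.smul_mem _ _ (Submodule.sum_mem _ fun a _ => ?_)
      rw [map_sum, LinearMap.sum_apply]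
      refine Submodule.sum_mem _ fun b _ => ?_
      rw [map_smul, LinearMap.smul_apply]
      refine Submodule.smul_mem _ _ ?_
      rcases lt_trichotomy (hgt a) (hgt b) with h' | h' | h'
      · refine Submodule.subset_span ⟨_, Desc.step (k := (hgt b - hgt a - 1).toNat) Desc.base ?_⟩
        omega
      · rcases hgt_eq h' with h'' | h''
        · subst h''
          rw [h.diag]
          exact Submodule.smul_mem _ _ (Submodule.subset_span ⟨0, Desc.base⟩)
        · have : so a b = 0 := by rw [h'', ← so_self_swap b.swap, Sum.swap_swap]
          rw [this, map_zero]
          exact Submodule.zero_mem _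
      · rw [h.pos a b h']
        exact Submodule.zero_mem _
    | @step n k m a b hm hk ih =>
      intro M
      -- Moving M past the lowering operator leaves a bracket, covered by the induction hypothesis,
      -- and a lowering operator applied to the span, which stays in the span.
      rw [hR.apply_apply]
      refine Submodule.add_mem _ (ih _) ?_
      refine Submodule.span_induction (p := fun y _ => R (so a b) y ∈
        Submodule.span ℂ {m | ∃ n, Desc R w n m}) ?_ ?_ ?_ ?_ (ih M)
      · rintro y ⟨n', hy⟩
        exact Submodule.subset_span ⟨_, Desc.step hy hk⟩
      · rw [map_zero]
        exact Submodule.zero_mem _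
      · intro y z _ _ hy hz
        rw [map_add]
        exact Submodule.add_mem _ hy hz
      · intro t y _ hy
        rw [map_smul]
        exact Submodule.smul_mem _ _ hy
  refine Submodule.span_induction (p := fun y _ => R M y ∈
    Submodule.span ℂ {m | ∃ n, Desc R w n m}) ?_ ?_ ?_ ?_ hx
  · rintro y ⟨n, hy⟩
    exact key n y hy M
  · rw [map_zero]
    exact Submodule.zero_mem _
  · intro y z _ _ hy hz
    rw [map_add]
    exact Submodule.add_mem _ hy hz
  · intro t y _ hy
    rw [map_smul]
    exact Submodule.smul_mem _ _ hy

/-- A representation without proper nonzero invariant subspaces. -/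
def IsIrred (R : o10 →ₗ[ℂ] Module.End ℂ N) : Prop :=
  ∀ W : Submodule ℂ N, (∀ M, ∀ w ∈ W, R M w ∈ W) → W ≠ ⊥ → W = ⊤

lemma IsSing.span_eq_top {R : o10 →ₗ[ℂ] Module.End ℂ N} (hR : IsRep R) (hI : IsIrred R)
    {μ : Fin 5 → ℂ} {w : N} (h : IsSing R μ w) :
    Submodule.span ℂ {m | ∃ n, Desc R w n m} = ⊤ :=
  hI _ (h.span_invariant hR)
    ((Submodule.ne_bot_iff _).2 ⟨w, Submodule.subset_span ⟨0, Desc.base⟩, h.1⟩)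

/-- The descendants span, and all are `hElt`-eigenvectors with eigenvalues e - n. If e' were not
among these, x would lie in the sum of the other eigenspaces, contradicting their independence. -/
lemma IsSing.exists_depth {R : o10 →ₗ[ℂ] Module.End ℂ N} (hR : IsRep R) (hI : IsIrred R)
    {μ : Fin 5 → ℂ} {w : N} (h : IsSing R μ w) {e e' : ℂ} {x : N} (hw : R hElt w = e • w)
    (hx0 : x ≠ 0) (hx : R hElt x = e' • x) : ∃ n : ℕ, e' = e - n := by
  by_contra hc
  push Not at hc
  have h1 : x ∈ ⨆ j, ⨆ (_ : j ≠ e'), (R hElt).eigenspace j := by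
    have h2 : x ∈ Submodule.span ℂ {m | ∃ n, Desc R w n m} := by
      rw [h.span_eq_top hR hI]; trivial
    refine Submodule.span_le.2 ?_ h2
    rintro m ⟨n, hm⟩
    exact Submodule.mem_iSup_of_mem (e - n) (Submodule.mem_iSup_of_mem (hc n).symm
      (Module.End.mem_eigenspace_iff.2 (hm.hElt_apply hR hw)))
  exact hx0 (Submodule.disjoint_def.1 (Module.End.eigenspaces_iSupIndep (R hElt) e') x
    (Module.End.mem_eigenspace_iff.2 hx) h1)

/-- The singular vectors of an irreducible representation have the same weight. -/
lemma IsSing.weight_unique {R : o10 →ₗ[ℂ] Module.End ℂ N} (hR : IsRep R) (hI : IsIrred R)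
    {μ μ' : Fin 5 → ℂ} {w x : N} (h : IsSing R μ w) (h' : IsSing R μ' x) : μ' = μ := by
  have hw := h.hElt_apply
  have hx := h'.hElt_apply
  obtain ⟨n, hn⟩ := h.exists_depth hR hI hw h'.1 hx
  obtain ⟨n', hn'⟩ := h'.exists_depth hR hI hx h.1 hw
  -- Each vector lies at some depth below the other, so both depths vanish.
  have h0 : ((n + n' : ℕ) : ℂ) = 0 := by
    push_cast
    linear_combination hn + hn'
  have hn0 : n = 0 := by
    rw [Nat.cast_eq_zero] at h0
    omega
  subst hn0
  rw [Nat.cast_zero, sub_zero] at hn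
  rw [hn] at hx
  set e := ∑ i, (halfSum i : ℂ) * μ i
  -- All descendants but w have an `hElt`-eigenvalue different from that of x, so the component of x
  -- outside ℂ w must vanish.
  have h1 : x ∈ Submodule.span ℂ {w} ⊔ ⨆ j, ⨆ (_ : j ≠ e), (R hElt).eigenspace j := by
    have h2 : x ∈ Submodule.span ℂ {m | ∃ n, Desc R w n m} := by
      rw [h.span_eq_top hR hI]; trivial
    refine Submodule.span_le.2 ?_ h2
    rintro m ⟨n, hm⟩
    rcases Nat.eq_zero_or_pos n with h3 | h3
    · rw [hm.zero h3]
      exact Submodule.mem_sup_left (Submodule.mem_span_singleton_self w)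
    · refine Submodule.mem_sup_right (Submodule.mem_iSup_of_mem (e - n) (Submodule.mem_iSup_of_mem ?_
        (Module.End.mem_eigenspace_iff.2 (hm.hElt_apply hR hw))))
      intro h4
      have : (n : ℂ) = 0 := by linear_combination -h4
      rw [Nat.cast_eq_zero] at this
      omega
  obtain ⟨y, hy, z, hz, hyz⟩ := Submodule.mem_sup.1 h1
  obtain ⟨t, rfl⟩ := Submodule.mem_span_singleton.1 hy
  have hz0 : z = 0 := by
    refine Submodule.disjoint_def.1 (Module.End.eigenspaces_iSupIndep (R hElt) e) z ?_ hz
    have : z = x - t • w := by rw [← hyz]; abel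
    rw [Module.End.mem_eigenspace_iff, this, map_sub, map_smul, hx, hw, smul_sub, smul_comm]
  rw [hz0, add_zero] at hyz
  funext i
  have h3 := h'.2.1 i
  rw [← hyz, map_smul, h.2.1, smul_comm] at h3
  have h4 := sub_eq_zero.2 h3
  rw [← sub_smul, hyz] at h4
  exact (sub_eq_zero.1 ((smul_eq_zero.1 h4).resolve_right h'.1)).symm

/-- The Casimir operator acts on an irreducible module as a scalar. -/
lemma IsSing.cas_eq {R : o10 →ₗ[ℂ] Module.End ℂ N} (hR : IsRep R) (hI : IsIrred R)
    {μ : Fin 5 → ℂ} {w : N} (h : IsSing R μ w) (x : N) : cas R x = casC μ • x := by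
  -- The eigenspace is invariant and contains w, so irreducibility makes it everything.
  have h1 : (cas R).eigenspace (casC μ) = ⊤ := by
    refine hI _ (fun M y hy => ?_) ((Submodule.ne_bot_iff _).2 ⟨w, ?_, h.1⟩)
    · rw [Module.End.mem_eigenspace_iff] at hy ⊢
      rw [cas_apply_comm hR, hy, map_smul]
    · exact Module.End.mem_eigenspace_iff.2 (h.cas_apply hR)
  exact Module.End.mem_eigenspace_iff.1 (h1 ▸ Submodule.mem_top)

end E6Ext
end

noncomputable section

namespace E6Ext

/-! ### The quadrics `ζ_a` as symmetric matrices -/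

/-- The monomials of `ζ_a` with their signs. -/
def zetaTerms : Idx → List (ℤ × Fin 16 × Fin 16)
  | .inl 0 => [(1, 0, 10), (1, 1, 8), (-1, 2, 5), (1, 3, 4)]
  | .inl 1 => [(1, 0, 12), (1, 1, 9), (-1, 2, 7), (1, 4, 6)]
  | .inl 2 => [(1, 0, 13), (1, 1, 11), (-1, 3, 7), (1, 5, 6)]
  | .inl 3 => [(1, 0, 14), (-1, 2, 11), (1, 3, 9), (-1, 6, 8)]
  | .inl 4 => [(-1, 1, 14), (-1, 2, 13), (1, 3, 12), (-1, 6, 10)]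
  | .inr 0 => [(1, 6, 15), (1, 7, 14), (1, 9, 13), (-1, 11, 12)]
  | .inr 1 => [(-1, 3, 15), (-1, 5, 14), (-1, 8, 13), (1, 10, 11)]
  | .inr 2 => [(1, 2, 15), (1, 4, 14), (1, 8, 12), (-1, 9, 10)]
  | .inr 3 => [(1, 1, 15), (-1, 4, 13), (1, 5, 12), (-1, 7, 10)]
  | .inr 4 => [(1, 0, 15), (1, 4, 11), (-1, 5, 9), (1, 7, 8)]

/-- The Hessian matrix of `ζ_a`. -/
def Z (a : Idx) (i j : Fin 16) : ℤ :=
  ((zetaTerms a).map fun t => (if t.2.1 = i then if t.2.2 = j then t.1 else 0 else 0)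
    + (if t.2.1 = j then if t.2.2 = i then t.1 else 0 else 0)).sum

lemma Z_symm (a : Idx) (i j : Fin 16) : Z a j i = Z a i j := by
  unfold Z
  congr 2
  funext t
  ring

/-- A positional encoding of the roots `γ_i` that is compatible with sums. -/
def code (v : Lat) : ℤ := v 0 + 10 * v 1 + 100 * v 2 + 1000 * v 3 + 10000 * v 4

/-- The code of `γ_i`. -/
def rtCode (i : Fin 16) : ℕ :=
  [0, 10000, 11000, 11100, 11010, 11110, 11101, 11111, 12110, 12111, 22110, 12211, 22111, 22211, 23211,
    23221].getD i 0

lemma code_rt (i : Fin 16) : code (rt i) = rtCode i := by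
  revert i; decide +kernel

lemma rtCode_add {i j r l : Fin 16} (h : rt i + rt j = rt r + rt l) :
    rtCode i + rtCode j = rtCode r + rtCode l := by
  have h1 : code (rt i + rt j) = code (rt r + rt l) := by rw [h]
  have h2 : ∀ u v, code (u + v) = code u + code v := fun u v => by
    simp only [code, Pi.add_apply]; ring
  rw [h2, h2, code_rt, code_rt, code_rt, code_rt] at h1
  exact_mod_cast h1

/-- The structure constants `φ_{j,l}([ξ_r, η_i])`. -/
def quadCoef (i j r l : Fin 16) : ℤ :=
  if r = i then if l = j then form (rt i) (rt j) else 0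
  else if form (rt r + -rt i) (rt r + -rt i) = 2 then
    if rt i + rt j = rt r + rt l then F (rt r) (-rt i) * F (rt r + -rt i) (-rt j) else 0 else 0

/-- All monomials of ζ_a have the same weight; the first one serves as its representative. -/
lemma Z_weight (a : Idx) (i j : Fin 16) (h : Z a i j ≠ 0) :
    rt i + rt j = rt ((zetaTerms a).headI.2.1) + rt ((zetaTerms a).headI.2.2) := by
  revert a i j; decide +kernel

/-- A finite computation. Comparing numerical codes is a cheap test for equal weights, and index
pairs of unequal weight, where both sides vanish, are left to `phi_xi_eta`. -/
lemma quadCoef_eq_of_code (i j : Fin 16) (hij : i ≤ j) (r l : Fin 16) (hrl : r ≤ l)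
    (h : rtCode i + rtCode j = rtCode r + rtCode l) :
    quadCoef i j r l = (if r = i then if l = j then 1 else 0 else 0)
      + (if l = i then if r = j then 1 else 0 else 0)
      - ((Z (.inl 0) i j * Z (.inl 0) r l + Z (.inl 1) i j * Z (.inl 1) r l
        + Z (.inl 2) i j * Z (.inl 2) r l + Z (.inl 3) i j * Z (.inl 3) r l
        + Z (.inl 4) i j * Z (.inl 4) r l) + (Z (.inr 0) i j * Z (.inr 0) r l
        + Z (.inr 1) i j * Z (.inr 1) r l + Z (.inr 2) i j * Z (.inr 2) r l
        + Z (.inr 3) i j * Z (.inr 3) r l + Z (.inr 4) i j * Z (.inr 4) r l)) := by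
  revert i j r l; decide +kernel

/-- A variable has at most one partner in ζ_a, because the weight of ζ_a determines the weight of
the partner. -/
lemma Z_mul_Z (a : Idx) {i r l : Fin 16} (h : l ≠ i) : Z a i r * Z a r l = 0 := by
  by_contra hne
  have h1 := Z_weight a i r (left_ne_zero_of_mul hne)
  have h2 := Z_weight a r l (right_ne_zero_of_mul hne)
  rw [← h1, add_comm] at h2
  exact h (rt_injective (add_right_cancel h2))

/-- The 5 counts the quadrics in which a given variable occurs. -/
lemma sum_Z_Z (i l : Fin 16) : ∑ a, ∑ r, Z a i r * Z a r l = if l = i then 5 else 0 := by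
  by_cases h : l = i
  · subst h
    rw [if_pos rfl]
    revert l
    decide +kernel
  · rw [if_neg h]
    exact Finset.sum_eq_zero fun a _ => Finset.sum_eq_zero fun r _ => Z_mul_Z a h

/-- The Hessian of ζ_a has eight entries ±1, two for each of the four monomials; quadrics of
different weights share no monomial. -/
lemma sum_Z_mul_Z (a b : Idx) : ∑ i, ∑ j, Z a i j * Z b i j = if a = b then 8 else 0 := by
  by_cases h : a = b
  · subst h
    rw [if_pos rfl]
    revert a
    decide +kernel
  · rw [if_neg h]
    refine Finset.sum_eq_zero fun i _ => Finset.sum_eq_zero fun j _ => ?_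
    by_contra hne
    have h1 := Z_weight a i j (left_ne_zero_of_mul hne)
    have h2 := Z_weight b i j (right_ne_zero_of_mul hne)
    have h3 : ∀ a b : Idx, rt ((zetaTerms a).headI.2.1) + rt ((zetaTerms a).headI.2.2) =
      rt ((zetaTerms b).headI.2.1) + rt ((zetaTerms b).headI.2.2) → a = b := by decide +kernel
    exact h (h3 a b (h1.symm.trans h2))

/-! ### Simple root vectors acting on the quadrics. -/

/-- The `k`-th positive simple root vector of `o(10, ℂ)`. -/
def simpleFst : Fin 5 → Idx := ![.inl 0, .inl 1, .inl 2, .inl 3, .inl 3]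

/-- The second index of the `k`-th positive simple root vector of `o(10, ℂ)`. -/
def simpleSnd : Fin 5 → Idx := ![.inl 1, .inl 2, .inl 3, .inl 4, .inr 4]

/-- The terms `s x_j ∂_{x_i}` of the `k`-th simple root vector as a vector field. -/
def simpleTerms : Fin 5 → List (ℤ × Fin 16 × Fin 16) :=
  ![[(1, 6, 3), (1, 7, 5), (1, 9, 8), (1, 12, 10)], [(1, 3, 2), (1, 5, 4), (1, 11, 9), (1, 13, 12)],
    [(-1, 2, 1), (-1, 8, 5), (-1, 9, 7), (1, 14, 13)], [(-1, 1, 0), (1, 10, 8), (1, 12, 9), (1, 13, 11)],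
    [(-1, 4, 2), (-1, 5, 3), (-1, 7, 6), (1, 15, 14)]]

/-- The structure constants `φ_{i,j}(ν(E_{a,b} - E_{b',a'}))`. -/
def rootCoef (a b : Idx) (i j : Fin 16) : ℤ :=
  nuSign a b * if rt i = rt j + diff a b then F (diff a b) (rt i) else 0

/-- A simple root vector moves only four variables. Listing these terms replaces the sums over all
variables in the later computations by sums of length four. -/
lemma rootCoef_simple (k : Fin 5) (i j : Fin 16) : rootCoef (simpleFst k) (simpleSnd k) i j =
    ((simpleTerms k).map fun t => if t.2.1 = i then if t.2.2 = j then t.1 else 0 else 0).sum := by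
  revert k i j; decide +kernel

lemma rootCoef_symm_simple (k : Fin 5) (i j : Fin 16) :
    rootCoef (simpleSnd k) (simpleFst k) i j = rootCoef (simpleFst k) (simpleSnd k) j i := by
  revert k i j; decide +kernel

/-- The identity compares Hessian entries in B(ζ_c) = ∑_a B_{a,c} ζ_a for B a simple root vector.
Symmetry permits j ≤ l. -/
lemma Z_simple (k : Fin 5) (c : Idx) (j l : Fin 16) (hjl : j ≤ l) :
    ((simpleTerms k).map fun t => (if t.2.2 = j then Z c t.2.1 l * t.1 else 0)
      + (if t.2.2 = l then Z c t.2.1 j * t.1 else 0)).sum =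
    (if simpleSnd k = c then Z (simpleFst k) j l else 0)
      - (if (simpleFst k).swap = c then Z (simpleSnd k).swap j l else 0) := by
  revert k c j l; decide +kernel

/-- The same comparison for the negative simple root vectors, whose matrices on the variables are
the transposes (`rootCoef_symm_simple`). -/
lemma Z_simple_neg (k : Fin 5) (c : Idx) (j l : Fin 16) (hjl : j ≤ l) :
    ((simpleTerms k).map fun t => (if t.2.1 = j then Z c t.2.2 l * t.1 else 0)
      + (if t.2.1 = l then Z c t.2.2 j * t.1 else 0)).sum =
    (if simpleFst k = c then Z (simpleSnd k) j l else 0)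
      - (if (simpleSnd k).swap = c then Z (simpleFst k).swap j l else 0) := by
  revert k c j l; decide +kernel

end E6Ext
end

noncomputable section

namespace E6Ext

/-! ### The embedding `ν` -/

lemma IsDeg.add {n : ℤ} {u v : E6} (hu : IsDeg n u) (hv : IsDeg n v) : IsDeg n (u + v) := by
  unfold IsDeg at *
  rw [lie_add, hu, hv, smul_add]

lemma IsDeg.smul {n : ℤ} {u : E6} (a : ℂ) (hu : IsDeg n u) : IsDeg n (a • u) := by
  unfold IsDeg at *
  rw [lie_smul, hu, smul_comm]

lemma isDeg_zero (n : ℤ) : IsDeg n 0 := by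
  unfold IsDeg
  rw [lie_zero, smul_zero]

lemma IsDeg.sub {n : ℤ} {u v : E6} (hu : IsDeg n u) (hv : IsDeg n v) : IsDeg n (u - v) := by
  unfold IsDeg at *
  rw [lie_sub, hu, hv, smul_sub]

lemma isDeg_sum {ι : Type*} (s : Finset ι) {n : ℤ} {f : ι → E6} (h : ∀ i, IsDeg n (f i)) :
    IsDeg n (∑ i ∈ s, f i) :=
  Finset.sum_induction f (IsDeg n) (fun _ _ => IsDeg.add) (isDeg_zero n) fun i _ => h i

lemma isDeg_Ev (v : Lat) : IsDeg (v 5) (Ev v) := by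
  unfold Ev
  split_ifs with h
  · exact isDeg_E ⟨v, h⟩
  · exact isDeg_zero _

lemma hPart_Ev (v : Lat) : hPart (Ev v) = 0 := by
  unfold Ev
  split_ifs
  · exact hPart_E _
  · exact map_zero _

lemma nu_apply (M : o10) : nu M = ofH (∑ i, (M : Matrix Idx Idx ℂ) (.inl i) (.inl i) • nuH i)
    + (1 / 2 : ℂ) • ∑ a, ∑ b, ((M : Matrix Idx Idx ℂ) a b * nuSign a b) • Ev (diff a b) := rfl

lemma isDeg_nu (M : o10) : IsDeg 0 (nu M) :=
  (isDeg_ofH _).add (IsDeg.smul _ (isDeg_sum _ fun _ => isDeg_sum _ fun _ =>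
    IsDeg.smul _ (isDeg_Ev _)))

lemma hPart_nu_five (M : o10) : hPart (nu M) 5 = 0 := by
  rw [nu_apply]
  simp only [map_add, map_smul, map_sum, hPart_ofH, hPart_Ev, smul_zero, Finset.sum_const_zero, add_zero,
    Finset.sum_apply, Pi.smul_apply]
  exact Finset.sum_eq_zero fun i _ => by fin_cases i <;> simp [nuH]

/-- On 𝒢_0 the kernel of `nuInv` is ℂ α̂, and the coefficient of α_6 detects α̂. Identities for ν
are proved by applying this to the difference of the two sides. -/
lemma eq_zero_of_nuInv {u : E6} (hu : IsDeg 0 u) (h5 : hPart u 5 = 0) (h : nuInv u = 0) : u = 0 := by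
  have hab : ∀ a b, (nuInv u : Matrix Idx Idx ℂ) a b = 0 := fun a b => by rw [h]; rfl
  refine E6_ext ?_ fun α => ?_
  · have hd : ∀ i, diagEntry (.inl i) (hPart u) = 0 := fun i => by
      have := hab (.inl i) (.inl i)
      rwa [nuInv_apply, if_pos rfl] at this
    have h0 := hd 0
    have h1 := hd 1
    have h2 := hd 2
    have h3 := hd 3
    have h4 := hd 4
    simp [diagEntry, epsCoord, cartanD5, h5] at h0 h1 h2 h3 h4
    rw [map_zero]
    funext i
    fin_cases i <;> simp
    · exact h0
    · linear_combination (h0 + h1 + h2 + h3 + h4) / 2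
    · linear_combination h0 + h1
    · linear_combination h0 + h1 + h2
    · linear_combination (h0 + h1 + h2 + h3 - h4) / 2
    · exact h5
  · rw [map_zero]
    by_cases h0 : α.1 5 = 0
    · obtain ⟨a, b, hne, hα⟩ := exists_diff α h0
      have h1 := hab a b
      rw [nuInv_apply, if_neg hne.1, ← hα] at h1
      have h2 : (nuSign a b : ℂ) * nuSign a b = 1 := by exact_mod_cast nuSign_sq a b hne
      exact (mul_eq_zero.1 h1).resolve_left fun h3 => by rw [h3] at h2; simp at h2
    · exact hu.coef_eq α h0

lemma nuInv_alphaHat : nuInv (ofH alphaHat) = 0 := by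
  apply Subtype.ext
  rw [nuInv_ofH]
  ext a b
  rw [Matrix.diagonal_apply]
  split_ifs
  · rcases a with i | i <;> fin_cases i <;> simp [diagEntry, epsCoord, cartanD5, alphaHat]
  · rfl

/-- The α_6-coefficient of α̂ is 4, so the central component of u is a quarter of the
α_6-coefficient of u times α̂. -/
lemma nu_nuInv {u : E6} (hu : IsDeg 0 u) :
    nu (nuInv u) = u - (hPart u 5 / 4) • ofH alphaHat := by
  rw [← sub_eq_zero]
  refine eq_zero_of_nuInv ((isDeg_nu _).sub (hu.sub (IsDeg.smul _ (isDeg_ofH _)))) ?_ ?_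
  · simp only [map_sub, map_smul, hPart_ofH, Pi.sub_apply, Pi.smul_apply, hPart_nu_five]
    simp [alphaHat]
  · rw [map_sub, map_sub, map_smul, nuInv_alphaHat, nuInv_nu, smul_zero, sub_zero, sub_self]

/-- Transported from `nuInv_lie`: a bracket in 𝒢_0 has no α_6-component, so `nuInv` determines it.
-/
lemma nu_lie (A B : o10) : nu ⁅A, B⁆ = ⁅nu A, nu B⁆ := by
  have h := (isDeg_nu A).lie (isDeg_nu B)
  rw [zero_add] at h
  rw [← sub_eq_zero]
  refine eq_zero_of_nuInv ((isDeg_nu _).sub h) ?_ ?_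
  · rw [map_sub, Pi.sub_apply, hPart_nu_five, hPart_five_lie _ _ (isDeg_nu A) (isDeg_nu B), sub_zero]
  · rw [map_sub, nuInv_nu, nuInv_lie _ _ (isDeg_nu A) (isDeg_nu B), nuInv_nu, nuInv_nu, sub_self]

lemma nu_so {a b : Idx} (h : a ≠ b ∧ a ≠ b.swap) :
    nu (so a b) = (nuSign a b : ℂ) • E ⟨diff a b, (form_diff a b).2 h⟩ := by
  have h1 := nu_nuInv (isDeg_Ev (diff a b))
  have h2 : (nuSign a b : ℂ) * nuSign a b = 1 := by exact_mod_cast nuSign_sq a b h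
  rw [hPart_Ev, Ev, dif_pos ((form_diff a b).2 h), nuInv_E h rfl, map_smul, Pi.zero_apply, zero_div,
    zero_smul, sub_zero] at h1
  rw [← h1, smul_smul, h2, one_smul]

lemma nu_so_diag (i : Fin 5) : nu (so (.inl i) (.inl i)) = ofH (nuH i) := by
  have h1 : ∀ a b, (so (.inl i) (.inl i) : Matrix Idx Idx ℂ) a b * (nuSign a b : ℂ) = 0 := by
    intro a b
    rw [so_diag_apply]
    split_ifs with h
    · subst h
      have : nuSign a a = 0 := by revert a; decide +kernel
      rw [this]
      simp
    · rw [zero_mul]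
  rw [nu_apply]
  simp only [h1, zero_smul, Finset.sum_const_zero, smul_zero, add_zero]
  congr 1
  simp [so_diag_apply, wt, Pi.single_apply]

/-! ### The structure constants -/

lemma phi_E (i j : Fin 16) (γ : Root) :
    phi i j (E γ) = if -rt j = γ.1 + -rt i then (F γ.1 (-rt i) : ℂ) else 0 := by
  rw [phi_apply, eta, br_EE]
  exact coef_rootBracket γ (Root.neg ⟨rt i, form_rt i⟩) (Root.neg ⟨rt j, form_rt j⟩)

lemma hform_neg (v : Lat) (h : Fin 6 → ℂ) : hform (-v) h = -hform v h := by
  have h1 := hform_add v (-v) h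
  have h2 := hform_add 0 0 h
  rw [add_neg_cancel] at h1
  rw [add_zero] at h2
  linear_combination -h1 - h2

lemma phi_ofH (i j : Fin 16) (h : Fin 6 → ℂ) :
    phi i j (ofH h) = if j = i then -hform (rt i) h else 0 := by
  rw [phi_apply, eta, br_HE, map_smul]
  change hform (-rt i) h • coef (-rt j) (eta i) = _
  rw [coef_eta, hform_neg]
  simp only [neg_inj, rt_injective.eq_iff]
  split_ifs <;> simp

/-- α̂ is three times the grading element, and η_i has degree -1. -/
lemma phi_alphaHat (i j : Fin 16) : phi i j (ofH alphaHat) = if j = i then -3 else 0 := by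
  have h := hform_gr (rt i)
  rw [map_smul, rt_five, smul_eq_mul] at h
  rw [phi_ofH]
  split_ifs
  · push_cast at h
    linear_combination -3 * h
  · rfl

lemma phi_nu_so {a b : Idx} (h : a ≠ b ∧ a ≠ b.swap) (i j : Fin 16) :
    phi i j (nu (so a b)) = rootCoef a b i j := by
  have h1 : (-rt j = diff a b + -rt i) ↔ rt i = rt j + diff a b := by
    constructor <;> intro h'
    · calc rt i = rt i + -rt j + rt j := by abel
        _ = rt i + (diff a b + -rt i) + rt j := by rw [h']
        _ = _ := by abel
    · rw [h']
      abel
  rw [nu_so h, map_smul, phi_E, F_neg_right, rootCoef]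
  simp only [h1]
  split_ifs <;> simp

lemma xi_lie_eta_self (i : Fin 16) : ⁅xi i, eta i⁆ = -ofH (toH (rt i)) := by
  rw [xi, eta, br_EE, rootBracket_neg]

lemma xi_lie_eta_ne {r i : Fin 16} (h : r ≠ i) :
    ⁅xi r, eta i⁆ = (F (rt r) (-rt i) : ℂ) • Ev (rt r + -rt i) := by
  have h1 : ¬rt r + -rt i = 0 := by
    rw [← sub_eq_add_neg, sub_eq_zero]
    exact fun h' => h (rt_injective h')
  rw [xi, eta, br_EE, rootBracket]
  exact if_neg h1

lemma phi_xi_eta_quadCoef (i j r l : Fin 16) : phi j l ⁅xi r, eta i⁆ = quadCoef i j r l := by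
  unfold quadCoef
  by_cases h : r = i
  · subst h
    rw [if_pos rfl, xi_lie_eta_self, map_neg, phi_ofH, hform_toH]
    split_ifs <;> simp
  · rw [if_neg h, xi_lie_eta_ne h, map_smul, Ev]
    by_cases h2 : form (rt r + -rt i) (rt r + -rt i) = 2
    · have h1 : (-rt l = rt r + -rt i + -rt j) ↔ rt i + rt j = rt r + rt l := by
        constructor <;> intro h'
        · calc rt i + rt j = rt i + rt j + -rt l + rt l := by abel
            _ = rt i + rt j + (rt r + -rt i + -rt j) + rt l := by rw [h']
            _ = _ := by abel
        · calc -rt l = rt r + -(rt r + rt l) := by abel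
            _ = _ := by rw [← h']; abel
      rw [dif_pos h2, if_pos h2, phi_E]
      simp only [h1]
      split_ifs <;> simp
    · rw [dif_neg h2, if_neg h2]
      simp

/-- The structure constants of the quadratic vector fields in terms of the quadrics `ζ_a`. -/
lemma phi_xi_eta (i j r l : Fin 16) : phi j l ⁅xi r, eta i⁆ =
    (if r = i then if l = j then 1 else 0 else 0) + (if l = i then if r = j then 1 else 0 else 0)
      - ∑ a, (Z a i j : ℂ) * Z a r l := by
  wlog hij : i ≤ j generalizing i j
  · rw [phi_swap_eta, this j i (le_of_not_ge hij)]
    simp only [Z_symm _ i j]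
    rw [← ite_and, ← ite_and, ← ite_and, ← ite_and]
    simp only [and_comm]
    ring
  wlog hrl : r ≤ l generalizing r l
  · rw [phi_swap_xi, this l r (le_of_not_ge hrl)]
    simp only [Z_symm _ r l]
    ring
  -- For unequal weights every term on both sides vanishes: a nonzero product of Hessian entries of
  -- ζ_a would force both weights to be that of ζ_a.
  by_cases hw : rt i + rt j = rt r + rt l
  · have h := quadCoef_eq_of_code i j hij r l hrl (rtCode_add hw)
    rw [phi_xi_eta_quadCoef, h]
    simp only [Fintype.sum_sum_type, Fin.sum_univ_five]
    push_cast
    rfl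
  · have h1 : quadCoef i j r l = 0 := by
      unfold quadCoef
      rw [if_neg hw]
      split_ifs with h1 h2
      · exact absurd (by rw [h1, h2]) hw
      · rfl
      · rfl
      · rfl
    have h2 : ∑ a, (Z a i j : ℂ) * Z a r l = 0 := by
      refine Finset.sum_eq_zero fun a _ => ?_
      by_contra hne
      have g1 := Z_weight a i j (by exact_mod_cast left_ne_zero_of_mul hne)
      have g2 := Z_weight a r l (by exact_mod_cast right_ne_zero_of_mul hne)
      exact hw (g1.trans g2.symm)
    rw [phi_xi_eta_quadCoef, h1, h2, ← ite_and, ← ite_and, if_neg, if_neg]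
    · simp
    · rintro ⟨rfl, rfl⟩
      exact hw (add_comm _ _)
    · rintro ⟨rfl, rfl⟩
      exact hw rfl

lemma diagEntry_toH (c : Fin 5) (v : Lat) : diagEntry (.inl c) (toH v) = hform v (nuH c) := by
  fin_cases c <;>
  simp [diagEntry, epsCoord, cartanD5, alphaHat, hform, Fin.sum_univ_succ, form, toH, nuH,
    Pi.single_apply] <;> ring

/-- This is invariance of the bilinear form of E₆: pairing [ξ_r, η_i] with B amounts to pairing ξ_r
with [η_i, B]. It turns sums over [ξ_r, η_i] into sums over pairs B_{a,b}, B_{b,a}, that is, into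
Casimir-type expressions. -/
lemma nuInv_xi_eta (r i : Fin 16) (c d : Idx) :
    (nuInv ⁅xi r, eta i⁆ : Matrix Idx Idx ℂ) c d = phi i r (nu (so d c)) := by
  by_cases hcd : c = d
  · subst hcd
    have key : ∀ k : Fin 5, (nuInv ⁅xi r, eta i⁆ : Matrix Idx Idx ℂ) (.inl k) (.inl k) =
        phi i r (nu (so (.inl k) (.inl k))) := by
      intro k
      rw [nuInv_apply, if_pos rfl, nu_so_diag, phi_ofH]
      by_cases h : r = i
      · subst h
        rw [if_pos rfl, xi_lie_eta_self, map_neg, map_neg, hPart_ofH, diagEntry_toH]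
      · rw [if_neg h, xi_lie_eta_ne h, map_smul, hPart_Ev, smul_zero, map_zero]
    rcases c with k | k
    · exact key k
    · have h1 := o10_skew (nuInv ⁅xi r, eta i⁆) (.inl k) (.inl k)
      have h2 := so_swap (.inl k) (.inl k)
      simp only [Sum.swap_inl] at h1 h2
      rw [h1, h2, key, map_neg, map_neg]
  · rw [nuInv_apply, if_neg hcd]
    by_cases hcd' : c = d.swap
    · subst hcd'
      have h4 : ∀ x : Idx, nuSign x.swap x = 0 := by decide +kernel
      rw [h4, so_self_swap, map_zero, map_zero]
      simp
    · have hs : ∀ x : Idx, x.swap.swap = x := Sum.swap_swap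
      have hdc : d ≠ c ∧ d ≠ c.swap := ⟨Ne.symm hcd, fun h => hcd' (by rw [h, hs])⟩
      rw [phi_nu_so hdc, rootCoef, nuSign_neg c d]
      by_cases h : r = i
      · subst h
        have h0 : diff d c ≠ 0 := by
          intro h0
          have := (form_diff d c).2 hdc
          rw [h0, form_zero_left] at this
          omega
        rw [xi_lie_eta_self, map_neg, coef_ofH, if_neg (by simpa using h0)]
        simp
      · have h2 : diff c d = -diff d c := by
          have h3 := diff_add c d c
          have h4 : ∀ x : Idx, diff x x = 0 := by decide +kernel
          rw [h4] at h3
          exact eq_neg_of_add_eq_zero_left h3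
        have hc : coef (diff c d) ⁅xi r, eta i⁆ =
            if diff c d = rt r + -rt i then (F (rt r) (-rt i) : ℂ) else 0 := by
          rw [xi, eta, br_EE]
          exact coef_rootBracket ⟨rt r, form_rt r⟩ (Root.neg ⟨rt i, form_rt i⟩)
            ⟨diff c d, (form_diff c d).2 ⟨hcd, hcd'⟩⟩
        rw [hc]
        by_cases h1 : rt i = rt r + diff d c
        · have h3 : diff c d = rt r + -rt i := by rw [h2, h1]; abel
          have h4 : rt r = rt i + diff c d := by rw [h3]; abel
          have h5 : F (rt r) (-rt i) = -F (diff d c) (rt i) := by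
            rw [F_neg_right, h4, F_add_left, F_self ⟨rt i, form_rt i⟩, h2, F_neg_left, neg_one_mul]
          rw [if_pos h1, if_pos h3, h5]
          push_cast
          ring
        · have h3 : ¬diff c d = rt r + -rt i := by
            intro h3
            apply h1
            rw [h2] at h3
            calc rt i = rt r + -(rt r + -rt i) := by abel
              _ = _ := by rw [← h3, neg_neg]
          rw [if_neg h1, if_neg h3]
          simp

lemma nuInv_xi_eta_eq_sum (r i : Fin 16) : nuInv ⁅xi r, eta i⁆ =
    (1 / 2 : ℂ) • ∑ a, ∑ b, phi i r (nu (so b a)) • so a b := by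
  conv_lhs => rw [o10_eq_sum (nuInv ⁅xi r, eta i⁆)]
  simp only [nuInv_xi_eta]

lemma hPart_xi_eta_five (r i : Fin 16) : hPart ⁅xi r, eta i⁆ 5 = if r = i then -1 else 0 := by
  split_ifs with h
  · subst h
    rw [xi_lie_eta_self, map_neg, hPart_ofH, Pi.neg_apply, toH, rt_five]
    simp
  · rw [xi_lie_eta_ne h, map_smul, hPart_Ev, smul_zero, Pi.zero_apply]

end E6Ext
end

noncomputable section

namespace E6Ext

open MvPolynomial

/-! ### The action on polynomials -/

lemma polyAct_eval (u : E6) (p : Poly) :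
    polyAct u p = ∑ i, ∑ j, phi i j u • (X j * pderiv i p) := by
  rw [polyAct_apply]
  simp only [LinearMap.sum_apply, LinearMap.smul_apply]
  rfl

lemma polyAct_X (u : E6) (i : Fin 16) : polyAct u (X i) = ∑ j, phi i j u • X j := by
  rw [polyAct_eval, Finset.sum_eq_single i]
  · simp
  · intro k _ hk
    simp [pderiv_X_of_ne hk.symm]
  · simp

lemma polyAct_eq_sum (u : E6) (p : Poly) : polyAct u p = ∑ i, pderiv i p * polyAct u (X i) := by
  rw [polyAct_eval]
  refine Finset.sum_congr rfl fun i _ => ?_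
  rw [polyAct_X, Finset.mul_sum]
  refine Finset.sum_congr rfl fun j _ => ?_
  rw [mul_smul_comm, mul_comm]

lemma polyAct_mul (u : E6) (p q : Poly) :
    polyAct u (p * q) = polyAct u p * q + p * polyAct u q := by
  rw [polyAct_eq_sum, polyAct_eq_sum u p, polyAct_eq_sum u q, Finset.sum_mul, Finset.mul_sum,
    ← Finset.sum_add_distrib]
  refine Finset.sum_congr rfl fun i _ => ?_
  rw [pderiv_mul]
  ring

/-- The action of an element of `𝒢_0` on polynomials as a derivation. -/
def actDer (u : E6) : Derivation ℂ Poly Poly :=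
  Derivation.mk' (polyAct u) fun p q => by
    rw [polyAct_mul, smul_eq_mul, smul_eq_mul]
    ring

/-- Both sides are derivations in p, so agreement on the variables suffices, where the claim is
`phi_lie`. -/
lemma polyAct_lie {u v : E6} (hu : IsDeg 0 u) (hv : IsDeg 0 v) (p : Poly) :
    polyAct ⁅u, v⁆ p = polyAct u (polyAct v p) - polyAct v (polyAct u p) := by
  have h : actDer ⁅u, v⁆ = ⁅actDer u, actDer v⁆ := by
    refine MvPolynomial.derivation_ext fun i => ?_
    rw [Derivation.commutator_apply]
    change polyAct ⁅u, v⁆ (X i) = polyAct u (polyAct v (X i)) - polyAct v (polyAct u (X i))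
    simp only [polyAct_X, map_sum, map_smul, Finset.smul_sum, smul_smul]
    rw [Finset.sum_comm, Finset.sum_comm (f := fun x k => (phi i x u * phi x k v) • X k),
      ← Finset.sum_sub_distrib]
    refine Finset.sum_congr rfl fun r _ => ?_
    rw [phi_lie u v hu hv, Finset.sum_smul, ← Finset.sum_sub_distrib]
    simp only [sub_smul]
  exact congrArg (fun D : Derivation ℂ Poly Poly => D p) h

lemma polyAct_nu_lie (A B : o10) (p : Poly) : polyAct (nu ⁅A, B⁆) p =
    polyAct (nu A) (polyAct (nu B) p) - polyAct (nu B) (polyAct (nu A) p) := by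
  rw [nu_lie, polyAct_lie (isDeg_nu A) (isDeg_nu B)]

lemma polyAct_alphaHat (p : Poly) :
    polyAct (ofH alphaHat) p = (-3 : ℂ) • ∑ i, X i * pderiv i p := by
  rw [polyAct_eval, Finset.smul_sum]
  refine Finset.sum_congr rfl fun i _ => ?_
  simp only [phi_alphaHat, ite_smul, zero_smul, Finset.sum_ite_eq', Finset.mem_univ, if_true]

/-! ### The quadrics -/

lemma zeta_eq_terms (a : Idx) :
    zeta a = ((zetaTerms a).map fun t => (t.1 : ℂ) • (X t.2.1 * X t.2.2 : Poly)).sum := by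
  rcases a with a | a <;> fin_cases a <;> simp [zeta, zetaTerms, xv] <;> ring

/-- Each listed monomial contributes at (i, j) and at (j, i), whence the factor 2. -/
lemma sum_smul_terms (L : List (ℤ × Fin 16 × Fin 16)) :
    ∑ i, ∑ j, (((L.map fun t => (if t.2.1 = i then if t.2.2 = j then t.1 else 0 else 0)
      + (if t.2.1 = j then if t.2.2 = i then t.1 else 0 else 0)).sum : ℤ) : ℂ) • (X i * X j : Poly)
      = (2 : ℂ) • (L.map fun t => (t.1 : ℂ) • (X t.2.1 * X t.2.2 : Poly)).sum := by
  induction L with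
  | nil => simp
  | cons t L ih =>
    simp only [List.map_cons, List.sum_cons, Int.cast_add, add_smul, Finset.sum_add_distrib, ih, smul_add]
    rw [add_left_inj]
    simp only [Int.cast_ite, Int.cast_zero, ite_smul, zero_smul, Finset.sum_ite_eq, Finset.mem_univ,
      if_true, Finset.sum_ite_irrel, Finset.sum_const_zero, two_smul]
    rw [mul_comm (X t.2.2)]

lemma zeta_eq_sum (a : Idx) :
    zeta a = (1 / 2 : ℂ) • ∑ i, ∑ j, (Z a i j : ℂ) • (X i * X j : Poly) := by
  have h := sum_smul_terms (zetaTerms a)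
  rw [← zeta_eq_terms] at h
  unfold Z
  rw [h, smul_smul]
  norm_num

lemma pderiv_zeta (a : Idx) (i : Fin 16) : pderiv i (zeta a) = ∑ j, (Z a i j : ℂ) • (X j : Poly) := by
  have h1 : ∀ j k, pderiv i (X j * X k : Poly) =
      (if i = j then X k else 0) + (if i = k then X j else 0) := by
    intro j k
    rw [pderiv_mul, pderiv_X, pderiv_X]
    simp only [Pi.single_apply, ite_mul, mul_ite, one_mul, zero_mul, mul_one, mul_zero, eq_comm]
  rw [zeta_eq_sum, Derivation.map_smul, map_sum]
  simp only [map_sum, Derivation.map_smul, h1, smul_add, smul_ite, smul_zero, Finset.sum_add_distrib,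
    Finset.sum_ite_irrel, Finset.sum_const_zero, Finset.sum_ite_eq, Finset.mem_univ, if_true]
  simp only [fun j => Z_symm a i j]
  rw [← smul_add, ← two_smul ℂ, smul_smul]
  norm_num

lemma isHomogeneous_zeta (a : Idx) : (zeta a).IsHomogeneous 2 := by
  rw [zeta_eq_sum, MvPolynomial.smul_eq_C_mul]
  refine (IsHomogeneous.C_mul ?_ _)
  refine IsHomogeneous.sum _ _ _ fun i _ => IsHomogeneous.sum _ _ _ fun j _ => ?_
  rw [MvPolynomial.smul_eq_C_mul]
  exact IsHomogeneous.C_mul ((isHomogeneous_X ℂ i).mul (isHomogeneous_X ℂ j)) _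

lemma euler_zeta (a : Idx) : ∑ i, X i * pderiv i (zeta a) = (2 : ℂ) • zeta a := by
  rw [(isHomogeneous_zeta a).sum_X_mul_pderiv, two_nsmul, two_smul]

/-! ### The span of the quadrics is the natural module -/

/-- `M` acts on the quadrics as on the standard basis. -/
structure ActsNaturally (M : o10) : Prop where
  act : ∀ c, polyAct (nu M) (zeta c) = ∑ a, (M : Matrix Idx Idx ℂ) a c • zeta a

lemma ActsNaturally.add {A B : o10} (hA : ActsNaturally A) (hB : ActsNaturally B) :
    ActsNaturally (A + B) := by
  refine ⟨fun c => ?_⟩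
  rw [map_add, map_add, LinearMap.add_apply, hA.act, hB.act, ← Finset.sum_add_distrib]
  exact Finset.sum_congr rfl fun a _ => (add_smul _ _ _).symm

lemma ActsNaturally.smul {A : o10} (t : ℂ) (hA : ActsNaturally A) : ActsNaturally (t • A) := by
  refine ⟨fun c => ?_⟩
  rw [map_smul, map_smul, LinearMap.smul_apply, hA.act, Finset.smul_sum]
  exact Finset.sum_congr rfl fun a _ => by rw [smul_o10_apply, mul_smul]

lemma actsNaturally_zero : ActsNaturally 0 := by
  refine ⟨fun c => ?_⟩
  rw [map_zero, map_zero, LinearMap.zero_apply]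
  exact (Finset.sum_eq_zero fun a _ => zero_smul ℂ _).symm

lemma actsNaturally_sum {ι : Type*} [Fintype ι] {f : ι → o10} (h : ∀ i, ActsNaturally (f i)) :
    ActsNaturally (∑ i, f i) :=
  Finset.sum_induction f ActsNaturally (fun _ _ => ActsNaturally.add) actsNaturally_zero
    fun i _ => h i

lemma ActsNaturally.neg {A : o10} (hA : ActsNaturally A) : ActsNaturally (-A) := by
  simpa using hA.smul (-1)

/-- Closure under brackets reduces the natural action to the simple root vectors and their
negatives. -/
lemma ActsNaturally.lie {A B : o10} (hA : ActsNaturally A) (hB : ActsNaturally B) :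
    ActsNaturally ⁅A, B⁆ := by
  refine ⟨fun c => ?_⟩
  rw [polyAct_nu_lie, hA.act, hB.act]
  simp only [map_sum, map_smul, hA.act, hB.act, Finset.smul_sum, smul_smul]
  rw [Finset.sum_comm, Finset.sum_comm (f := fun x k => ((A : Matrix Idx Idx ℂ) x c *
    (B : Matrix Idx Idx ℂ) k x) • zeta k), ← Finset.sum_sub_distrib]
  refine Finset.sum_congr rfl fun a _ => ?_
  rw [lie_o10_coe, Matrix.sub_apply, Matrix.mul_apply, Matrix.mul_apply, sub_smul, Finset.sum_smul,
    Finset.sum_smul]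
  simp only [mul_comm]

lemma ActsNaturally.swap {a b : Idx} (h : ActsNaturally (so a b)) :
    ActsNaturally (so b.swap a.swap) := by
  rw [so_swap]
  exact h.neg

lemma ActsNaturally.trans {p q s : Idx} (h1 : ActsNaturally (so p q)) (h2 : ActsNaturally (so q s))
    (hpq : p ≠ q ∧ p ≠ q.swap) (hqs : q ≠ s ∧ q ≠ s.swap) (hps : s ≠ p) : ActsNaturally (so p s) := by
  have := h1.lie h2
  rwa [so_lie_so hpq hqs, if_neg hps, sub_zero] at this

/-- Symmetrising the coefficients makes the product of linear forms comparable, entry by entry, with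
the symmetric Hessians; the factor 2 avoids denominators. -/
lemma sum_mul_sum_add_self {ι : Type*} [Fintype ι] (z w : ι → ι → ℂ) (x : ι → Poly) :
    (2 : ℂ) • ∑ i, (∑ l, z i l • x l) * (∑ j, w i j • x j) =
      ∑ j, ∑ l, (∑ i, (z i l * w i j + z i j * w i l)) • (x j * x l) := by
  simp only [Finset.sum_mul_sum, smul_mul_smul_comm, Finset.sum_smul, add_smul,
    Finset.sum_add_distrib, two_smul]
  refine congrArg₂ (· + ·) ?_ ?_
  · rw [Finset.sum_comm]
    conv_rhs => rw [Finset.sum_comm]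
    refine Finset.sum_congr rfl fun l _ => ?_
    rw [Finset.sum_comm]
    exact Finset.sum_congr rfl fun j _ => Finset.sum_congr rfl fun i _ => by rw [mul_comm (x l)]
  · rw [Finset.sum_comm]
    refine Finset.sum_congr rfl fun j _ => ?_
    rw [Finset.sum_comm]

lemma two_smul_zeta (a : Idx) : (2 : ℂ) • zeta a = ∑ j, ∑ l, (Z a j l : ℂ) • (X j * X l : Poly) := by
  rw [zeta_eq_sum, smul_smul]
  norm_num

lemma sum_so_smul {M : Type*} [AddCommGroup M] [Module ℂ M] (a b c : Idx) (f : Idx → M) :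
    ∑ x, (so a b : Matrix Idx Idx ℂ) x c • f x =
      (if b = c then f a else 0) - (if a.swap = c then f b.swap else 0) := by
  simp only [so_entry, sub_smul, ite_smul, one_smul, zero_smul, Finset.sum_sub_distrib,
    Finset.sum_ite_eq', Finset.mem_univ, if_true]
  simp only [eq_comm (a := c)]

/-- By the chain rule B(ζ_c) = ∑_i ∂_iζ_c · B(x_i), and `hc` is the equality of the Hessians of the
two sides. -/
lemma actsNaturally_of_coef {a b : Idx} (h : a ≠ b ∧ a ≠ b.swap)
    (hc : ∀ c j l, ∑ i, (Z c i l * rootCoef a b i j + Z c i j * rootCoef a b i l) =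
      (if b = c then Z a j l else 0) - (if a.swap = c then Z b.swap j l else 0)) :
    ActsNaturally (so a b) := by
  refine ⟨fun c => ?_⟩
  have hc' : ∀ j l, ∑ i, ((Z c i l : ℂ) * rootCoef a b i j + (Z c i j : ℂ) * rootCoef a b i l) =
      (if b = c then (Z a j l : ℂ) else 0) - (if a.swap = c then (Z b.swap j l : ℂ) else 0) := by
    intro j l
    have := congrArg (Int.cast : ℤ → ℂ) (hc c j l)
    push_cast at this
    exact this
  have h2 := sum_mul_sum_add_self (fun i l => (Z c i l : ℂ)) (fun i j => (rootCoef a b i j : ℂ))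
    (fun i => (X i : Poly))
  simp only [hc', sub_smul, Finset.sum_sub_distrib, ite_smul, zero_smul, Finset.sum_ite_irrel,
      Finset.sum_const_zero, ← two_smul_zeta] at h2
  rw [sum_so_smul]
  refine smul_right_injective Poly (two_ne_zero : (2 : ℂ) ≠ 0) ?_
  change (2 : ℂ) • _ = (2 : ℂ) • _
  rw [smul_sub, smul_ite, smul_ite, smul_zero, ← h2, polyAct_eq_sum]
  simp only [pderiv_zeta, polyAct_X, phi_nu_so h]

lemma sum_mul_terms (L : List (ℤ × Fin 16 × Fin 16)) (f : Fin 16 → ℤ) (k : Fin 16) :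
    ∑ i, f i * (L.map fun t => if t.2.1 = i then if t.2.2 = k then t.1 else 0 else 0).sum =
      (L.map fun t => if t.2.2 = k then f t.2.1 * t.1 else 0).sum := by
  induction L with
  | nil => simp
  | cons t L ih =>
    simp only [List.map_cons, List.sum_cons, mul_add, Finset.sum_add_distrib, ih, mul_ite, mul_zero,
      Finset.sum_ite_eq, Finset.mem_univ, if_true]

lemma sum_mul_terms_swap (L : List (ℤ × Fin 16 × Fin 16)) (f : Fin 16 → ℤ) (k : Fin 16) :
    ∑ i, f i * (L.map fun t => if t.2.1 = k then if t.2.2 = i then t.1 else 0 else 0).sum =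
      (L.map fun t => if t.2.1 = k then f t.2.2 * t.1 else 0).sum := by
  induction L with
  | nil => simp
  | cons t L ih =>
    simp only [List.map_cons, List.sum_cons, mul_add, Finset.sum_add_distrib, ih, mul_ite, mul_zero,
      Finset.sum_ite_eq, Finset.mem_univ, if_true, Finset.sum_ite_irrel, Finset.sum_const_zero]

lemma simple_ne (k : Fin 5) : simpleFst k ≠ simpleSnd k ∧ simpleFst k ≠ (simpleSnd k).swap := by
  revert k; decide

lemma actsNaturally_simple (k : Fin 5) : ActsNaturally (so (simpleFst k) (simpleSnd k)) := by
  refine actsNaturally_of_coef (simple_ne k) fun c j l => ?_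
  wlog hjl : j ≤ l generalizing j l
  · have := this l j (le_of_not_ge hjl)
    simp only [Z_symm _ j l] at this
    rw [← this]
    exact Finset.sum_congr rfl fun i _ => add_comm _ _
  · rw [← Z_simple k c j l hjl, Finset.sum_add_distrib]
    simp only [rootCoef_simple, sum_mul_terms, List.sum_map_add]

lemma actsNaturally_simple_neg (k : Fin 5) : ActsNaturally (so (simpleSnd k) (simpleFst k)) := by
  have hne := simple_ne k
  refine actsNaturally_of_coef ⟨hne.1.symm, fun h => hne.2 (by rw [h, Sum.swap_swap])⟩
    fun c j l => ?_
  wlog hjl : j ≤ l generalizing j l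
  · have := this l j (le_of_not_ge hjl)
    simp only [Z_symm _ j l] at this
    rw [← this]
    exact Finset.sum_congr rfl fun i _ => add_comm _ _
  · rw [← Z_simple_neg k c j l hjl, Finset.sum_add_distrib]
    simp only [rootCoef_symm_simple, rootCoef_simple, sum_mul_terms_swap, List.sum_map_add]

/-- The pairs of neighbours in the chain 0, 1, 2, 3, 4 generate all pairs by composition in either
direction. -/
lemma forall_ne_of_adjacent (H : Fin 5 → Fin 5 → Prop)
    (key : ∀ x y z : Fin 5, x ≠ y → y ≠ z → z ≠ x → H x y → H y z → H x z)
    (h01 : H 0 1) (h12 : H 1 2) (h23 : H 2 3) (h34 : H 3 4) (h10 : H 1 0) (h21 : H 2 1) (h32 : H 3 2)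
    (h43 : H 4 3) (i j : Fin 5) (h : i ≠ j) : H i j := by
  have h02 := key 0 1 2 (by decide) (by decide) (by decide) h01 h12
  have h13 := key 1 2 3 (by decide) (by decide) (by decide) h12 h23
  have h24 := key 2 3 4 (by decide) (by decide) (by decide) h23 h34
  have h03 := key 0 2 3 (by decide) (by decide) (by decide) h02 h23
  have h14 := key 1 3 4 (by decide) (by decide) (by decide) h13 h34
  have h04 := key 0 3 4 (by decide) (by decide) (by decide) h03 h34
  have h20 := key 2 1 0 (by decide) (by decide) (by decide) h21 h10
  have h31 := key 3 2 1 (by decide) (by decide) (by decide) h32 h21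
  have h42 := key 4 3 2 (by decide) (by decide) (by decide) h43 h32
  have h30 := key 3 2 0 (by decide) (by decide) (by decide) h32 h20
  have h41 := key 4 3 1 (by decide) (by decide) (by decide) h43 h31
  have h40 := key 4 3 0 (by decide) (by decide) (by decide) h43 h30
  fin_cases i <;> fin_cases j <;> first | exact absurd rfl h | assumption

lemma actsNaturally_inl_inl (i j : Fin 5) (h : i ≠ j) : ActsNaturally (so (.inl i) (.inl j)) :=
  forall_ne_of_adjacent (fun i j => ActsNaturally (so (.inl i) (.inl j)))
    (fun x y z hxy hyz hzx h1 h2 => h1.trans h2 (by simpa using hxy) (by simpa using hyz)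
      (by simpa using hzx))
    (actsNaturally_simple 0) (actsNaturally_simple 1) (actsNaturally_simple 2)
    (actsNaturally_simple 3) (actsNaturally_simple_neg 0) (actsNaturally_simple_neg 1)
    (actsNaturally_simple_neg 2) (actsNaturally_simple_neg 3) i j h

/-- Starting from the simple root vector of ε_4 + ε_5, brackets with root vectors of ε_i - ε_j reach
every ε_i + ε_j. -/
lemma actsNaturally_inl_inr (i j : Fin 5) : ActsNaturally (so (.inl i) (.inr j)) := by
  by_cases hij : i = j
  · subst hij
    have : so (.inl i) (.inr i) = 0 := so_self_swap (.inl i)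
    rw [this]
    exact actsNaturally_zero
  have h4 : ∀ i : Fin 5, i ≠ 4 → ActsNaturally (so (.inl i) (.inr 4)) := by
    intro i hi
    have h34 : ActsNaturally (so (.inl 3) (.inr 4)) := actsNaturally_simple 4
    by_cases hi3 : i = 3
    · rw [hi3]
      exact h34
    · exact (actsNaturally_inl_inl i 3 hi3).trans h34 (by simpa using hi3) (by simp) (by simp)
  by_cases hi : i = 4
  · subst hi
    exact (h4 j (Ne.symm hij)).swap
  by_cases hj : j = 4
  · subst hj
    exact h4 i hi
  exact (h4 i hi).trans (actsNaturally_inl_inl j 4 hj).swap (by simpa using hi)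
    (by simpa using Ne.symm hj) (by simp)

lemma actsNaturally_inr_inl (i j : Fin 5) : ActsNaturally (so (.inr i) (.inl j)) := by
  by_cases hij : i = j
  · subst hij
    have : so (.inr i) (.inl i) = 0 := so_self_swap (.inr i)
    rw [this]
    exact actsNaturally_zero
  have h4 : ∀ i : Fin 5, i ≠ 4 → ActsNaturally (so (.inr 4) (.inl i)) := by
    intro i hi
    have h34 : ActsNaturally (so (.inr 4) (.inl 3)) := actsNaturally_simple_neg 4
    by_cases hi3 : i = 3
    · rw [hi3]
      exact h34
    · exact h34.trans (actsNaturally_inl_inl 3 i (Ne.symm hi3)) (by simp)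
        (by simpa using Ne.symm hi3) (by simp)
  by_cases hj : j = 4
  · subst hj
    exact (h4 i hij).swap
  by_cases hi : i = 4
  · subst hi
    exact h4 j hj
  exact (actsNaturally_inl_inl 4 i (Ne.symm hi)).swap.trans (h4 j hj) (by simpa using hi)
    (by simpa using Ne.symm hj) (by simp)

/-- The bracket of opposite root vectors for ε_i - ε_j gives B_{i,i} - B_{j,j}, and for ε_i + ε_j it
gives B_{i,i} + B_{j,j}; half the sum is B_{i,i}. -/
lemma actsNaturally_diag (i : Fin 5) : ActsNaturally (so (.inl i) (.inl i)) := by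
  have h1 : ∀ j : Fin 5, i ≠ j →
      ActsNaturally (so (.inl i) (.inl i) - so (.inl j) (.inl j)) := by
    intro j hij
    have := (actsNaturally_inl_inl i j hij).lie (actsNaturally_inl_inl j i (Ne.symm hij))
    rwa [so_lie_so (by simpa using hij) (by simpa using Ne.symm hij), if_pos rfl] at this
  have h2 : ∀ j : Fin 5, i ≠ j →
      ActsNaturally (so (.inl i) (.inl i) + so (.inl j) (.inl j)) := by
    intro j hij
    have := (actsNaturally_inl_inr i j).lie (actsNaturally_inr_inl j i)
    rw [so_lie_so (by simpa using hij) (by simpa using Ne.symm hij), if_pos rfl] at this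
    have h3 := so_swap (.inl j) (.inl j)
    simp only [Sum.swap_inl] at h3
    rwa [h3, sub_neg_eq_add] at this
  have h0 : ∀ i : Fin 5, ∃ j : Fin 5, i ≠ j := by decide
  obtain ⟨j, hj⟩ := h0 i
  have h3 := ((h1 j hj).add (h2 j hj)).smul (1 / 2)
  have h4 : (1 / 2 : ℂ) • (so (.inl i) (.inl i) - so (.inl j) (.inl j)
      + (so (.inl i) (.inl i) + so (.inl j) (.inl j))) = so (.inl i) (.inl i) := by
    module
  rwa [h4] at h3

lemma actsNaturally_so (a b : Idx) : ActsNaturally (so a b) := by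
  have h : ∀ i j, ActsNaturally (so (.inl i) (.inl j)) := by
    intro i j
    by_cases hij : i = j
    · subst hij
      exact actsNaturally_diag i
    · exact actsNaturally_inl_inl i j hij
  rcases a with i | i <;> rcases b with j | j
  · exact h i j
  · exact actsNaturally_inl_inr i j
  · exact actsNaturally_inr_inl i j
  · exact (h j i).swap

/-- `o(10, ℂ)` acts on the quadrics `ζ_a` as on the standard basis of its natural module. -/
lemma polyAct_nu_zeta (M : o10) (c : Idx) :
    polyAct (nu M) (zeta c) = ∑ a, (M : Matrix Idx Idx ℂ) a c • zeta a := by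
  have h : ActsNaturally M := by
    rw [o10_eq_sum M]
    refine ActsNaturally.smul _ (actsNaturally_sum fun a => actsNaturally_sum fun b => ?_)
    exact (actsNaturally_so a b).smul _
  exact h.act c

end E6Ext
end

noncomputable section

namespace E6Ext

open MvPolynomial

/-! ### The quadratic vector fields -/

lemma quadField_apply (i : Fin 16) (p : Poly) :
    quadField i p = (1 / 2 : ℂ) • ∑ r, X r * polyAct ⁅xi r, eta i⁆ p := by
  rw [quadField]
  simp only [LinearMap.smul_apply, LinearMap.sum_apply]
  rfl

/-- `phi_xi_eta` contracted with x_r x_l: both Kronecker terms give x_i x_j, and each Hessian gives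
2ζ_a, so the factor 1/2 cancels throughout. -/
lemma quadField_X (i j : Fin 16) :
    quadField i (X j) = X i * X j - ∑ a, (Z a i j : ℂ) • zeta a := by
  have h : ∀ r l, phi j l ⁅xi r, eta i⁆ • (X r * X l : Poly) =
      (if r = i then if l = j then X r * X l else 0 else 0)
        + (if l = i then if r = j then X r * X l else 0 else 0)
      - ∑ a, (Z a i j : ℂ) • ((Z a r l : ℂ) • (X r * X l)) := by
    intro r l
    rw [phi_xi_eta, sub_smul, add_smul, Finset.sum_smul]
    simp only [mul_smul, ite_smul, one_smul, zero_smul]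
  have h1 : ∑ r, ∑ l, ∑ a, (Z a i j : ℂ) • ((Z a r l : ℂ) • (X r * X l : Poly)) =
      ∑ a, (Z a i j : ℂ) • ((2 : ℂ) • zeta a) := by
    simp only [two_smul_zeta, Finset.smul_sum]
    conv_rhs => rw [Finset.sum_comm]
    refine Finset.sum_congr rfl fun r _ => ?_
    rw [Finset.sum_comm]
  rw [quadField_apply]
  simp only [polyAct_X, Finset.mul_sum, mul_smul_comm, h, Finset.sum_sub_distrib,
    Finset.sum_add_distrib, Finset.sum_ite_irrel, Finset.sum_const_zero, Finset.sum_ite_eq',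
    Finset.mem_univ, if_true, h1]
  rw [mul_comm (X j), ← two_smul ℂ, smul_sub, smul_smul, Finset.smul_sum]
  have h2 : ∀ x : ℂ, (1 / 2 : ℂ) * (x * 2) = x := fun x => by ring
  simp only [smul_smul, h2]
  norm_num [-Fintype.sum_sum_type]

lemma quadField_eq_sum (i : Fin 16) (p : Poly) :
    quadField i p = ∑ j, pderiv j p * quadField i (X j) := by
  simp only [quadField_apply, mul_smul_comm, ← Finset.smul_sum, Finset.mul_sum]
  rw [Finset.sum_comm]
  refine congrArg _ (Finset.sum_congr rfl fun r _ => ?_)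
  rw [polyAct_eq_sum, Finset.mul_sum]
  exact Finset.sum_congr rfl fun j _ => by ring

lemma quadField_mul (i : Fin 16) (p q : Poly) :
    quadField i (p * q) = quadField i p * q + p * quadField i q := by
  rw [quadField_eq_sum, quadField_eq_sum i p, quadField_eq_sum i q, Finset.sum_mul, Finset.mul_sum,
    ← Finset.sum_add_distrib]
  refine Finset.sum_congr rfl fun j _ => ?_
  rw [pderiv_mul]
  ring

/-- Modulo the quadrics, `P_i` is `x_i` times the Euler vector field. -/
lemma quadField_of_isHomogeneous (i : Fin 16) {n : ℕ} {p : Poly} (hp : p.IsHomogeneous n) :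
    quadField i p = (n : ℂ) • (X i * p) - ∑ a, ∑ j, (Z a i j : ℂ) • (zeta a * pderiv j p) := by
  have h := hp.sum_X_mul_pderiv
  rw [quadField_eq_sum]
  simp only [quadField_X, mul_sub, Finset.sum_sub_distrib, Finset.mul_sum, mul_smul_comm]
  rw [Finset.sum_comm (f := fun j a => (Z a i j : ℂ) • (pderiv j p * zeta a))]
  refine congrArg₂ (· - ·) ?_ ?_
  · calc ∑ j, pderiv j p * (X i * X j) = X i * ∑ j, X j * pderiv j p := by
          rw [Finset.mul_sum]
          exact Finset.sum_congr rfl fun j _ => by ring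
      _ = _ := by rw [h, mul_smul_comm, Nat.cast_smul_eq_nsmul]
  · simp only [mul_comm (zeta _)]

/-- [ξ_r, η_i] splits into its o(10)-part and a multiple of α̂; the latter is present only for r =
i. -/
lemma polyAct_xi_eta (r i : Fin 16) (p : Poly) : polyAct ⁅xi r, eta i⁆ p =
    polyAct (nu (nuInv ⁅xi r, eta i⁆)) p
      + ((if r = i then -1 else 0) / 4 : ℂ) • polyAct (ofH alphaHat) p := by
  rw [nu_nuInv (isDeg_xi_eta r i), map_sub, map_smul, hPart_xi_eta_five]
  simp

/-! ### The radial identity for the quadrics. -/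

/-- The index that `ζ_a` pairs with `i`. -/
def mate : Idx → Fin 16 → Fin 16
  | .inl 0 => ![10, 8, 5, 4, 3, 2, 0, 0, 1, 0, 0, 0, 0, 0, 0, 0]
  | .inl 1 => ![12, 9, 7, 0, 6, 0, 4, 2, 0, 1, 0, 0, 0, 0, 0, 0]
  | .inl 2 => ![13, 11, 0, 7, 0, 6, 5, 3, 0, 0, 0, 1, 0, 0, 0, 0]
  | .inl 3 => ![14, 0, 11, 9, 0, 0, 8, 0, 6, 3, 0, 2, 0, 0, 0, 0]
  | .inl 4 => ![0, 14, 13, 12, 0, 0, 10, 0, 0, 0, 6, 0, 3, 2, 1, 0]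
  | .inr 0 => ![0, 0, 0, 0, 0, 0, 15, 14, 0, 13, 0, 12, 11, 9, 7, 6]
  | .inr 1 => ![0, 0, 0, 15, 0, 14, 0, 0, 13, 0, 11, 10, 0, 8, 5, 3]
  | .inr 2 => ![0, 0, 15, 0, 14, 0, 0, 0, 12, 10, 9, 0, 8, 0, 4, 2]
  | .inr 3 => ![0, 15, 0, 0, 13, 12, 0, 10, 0, 0, 7, 0, 5, 4, 0, 1]
  | .inr 4 => ![15, 0, 0, 0, 11, 9, 0, 8, 7, 5, 0, 4, 0, 0, 0, 0]
/-- The sign of the monomial of `ζ_a` that contains `x_i`, or zero. -/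
def sgn : Idx → Fin 16 → ℤ
  | .inl 0 => ![1, 1, -1, 1, 1, -1, 0, 0, 1, 0, 1, 0, 0, 0, 0, 0]
  | .inl 1 => ![1, 1, -1, 0, 1, 0, 1, -1, 0, 1, 0, 0, 1, 0, 0, 0]
  | .inl 2 => ![1, 1, 0, -1, 0, 1, 1, -1, 0, 0, 0, 1, 0, 1, 0, 0]
  | .inl 3 => ![1, 0, -1, 1, 0, 0, -1, 0, -1, 1, 0, -1, 0, 0, 1, 0]
  | .inl 4 => ![0, -1, -1, 1, 0, 0, -1, 0, 0, 0, -1, 0, 1, -1, -1, 0]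
  | .inr 0 => ![0, 0, 0, 0, 0, 0, 1, 1, 0, 1, 0, -1, -1, 1, 1, 1]
  | .inr 1 => ![0, 0, 0, -1, 0, -1, 0, 0, -1, 0, 1, 1, 0, -1, -1, -1]
  | .inr 2 => ![0, 0, 1, 0, 1, 0, 0, 0, 1, -1, -1, 0, 1, 0, 1, 1]
  | .inr 3 => ![0, 1, 0, 0, -1, 1, 0, -1, 0, 0, -1, 0, 1, -1, 0, 1]
  | .inr 4 => ![1, 0, 0, 0, 1, -1, 0, 1, 1, -1, 0, 1, 0, 0, 0, 1]

/-- Where x_j does not occur in ζ_a, `mate` takes the dummy value 0 and `sgn` vanishes. -/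
lemma Z_eq (a : Idx) (i j : Fin 16) : Z a i j = if i = mate a j then sgn a j else 0 := by
  revert a i j; decide +kernel

/-- Sixteen polynomial identities, verified by expansion. Only ζ_1 is treated explicitly; the other
quadrics are reached by the action of o(10). -/
lemma sum_Z_zeta_first (l : Fin 16) :
    ∑ b, ∑ j, (Z b l j : ℂ) • (zeta b * pderiv j (zeta (.inl 0))) = zeta (.inl 0) * X l := by
  have h1 : ∀ b j, (Z b l j : ℂ) • (zeta b * pderiv j (zeta (.inl 0))) = if j = mate b l then
      ((sgn b l * sgn (.inl 0) j : ℤ) : ℂ) • (X (mate (.inl 0) j) * zeta b) else 0 := by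
    intro b j
    have h2 : pderiv j (zeta (.inl 0)) = (sgn (.inl 0) j : ℂ) • X (mate (.inl 0) j) := by
      rw [pderiv_zeta]
      simp only [fun k => Z_symm (.inl 0) k j, Z_eq, Int.cast_ite, Int.cast_zero, ite_smul, zero_smul,
        Finset.sum_ite_eq', Finset.mem_univ, if_true]
    rw [h2, ← Z_symm, Z_eq]
    split_ifs
    · rw [mul_smul_comm, smul_smul, mul_comm (zeta b)]
      push_cast
      rfl
    · simp
  simp only [h1, Finset.sum_ite_eq', Finset.mem_univ, if_true]
  fin_cases l <;>
    simp [Fintype.sum_sum_type, Fin.sum_univ_five, mate, sgn, zeta, xv] <;> ring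

/-- The difference of the two sides of the radial identity. -/
def radialDefect (a : Idx) (l : Fin 16) : Poly :=
  ∑ b, zeta b * polyAct (nu (so a b)) (X l) - (1 / 2 : ℂ) • (zeta a * X l)

/-- By `nuInv_xi_eta`, the o(10)-part of ∑_r x_r [ξ_r, η_l] applied to ζ_a is ∑_b ζ_b B_{a,b}(x_l).
The central part gives 3/4 = ½ · (-¼) · (-3) · 2, the last factor being the degree of ζ_a. -/
lemma quadField_zeta (l : Fin 16) (a : Idx) : quadField l (zeta a) =
    (1 / 2 : ℂ) • ∑ b, zeta b * polyAct (nu (so a b)) (X l) + (3 / 4 : ℂ) • (zeta a * X l) := by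
  rw [quadField_apply]
  simp only [polyAct_xi_eta, mul_add, Finset.sum_add_distrib, smul_add]
  refine congrArg₂ (· + ·) (congrArg _ ?_) ?_
  · simp only [polyAct_nu_zeta, nuInv_xi_eta, polyAct_X, Finset.mul_sum]
    rw [Finset.sum_comm]
    refine Finset.sum_congr rfl fun b _ => Finset.sum_congr rfl fun r _ => ?_
    rw [mul_smul_comm, mul_smul_comm, mul_comm]
  · rw [polyAct_alphaHat, euler_zeta, Finset.sum_eq_single l, if_pos rfl, mul_comm (X l)]
    · simp only [smul_smul, smul_mul_assoc]
      norm_num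
    · intro r _ hr
      rw [if_neg hr, zero_div, zero_smul, mul_zero]
    · exact fun h => absurd (Finset.mem_univ l) h

/-- Two formulas for P_l(ζ_1) are compared. `quadField_of_isHomogeneous` and `sum_Z_zeta_first` give
(2 - 1) ζ_1 x_l, and subtracting the central ¾ leaves ¼, which is half of the desired ½. -/
lemma radialDefect_first (l : Fin 16) : radialDefect (.inl 0) l = 0 := by
  have h1 := quadField_zeta l (.inl 0)
  rw [quadField_of_isHomogeneous l (isHomogeneous_zeta _), sum_Z_zeta_first] at h1
  rw [radialDefect]
  have h2 : (1 / 2 : ℂ) • ∑ b, zeta b * polyAct (nu (so (.inl 0) b)) (X l) =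
      ((2 : ℕ) : ℂ) • (X l * zeta (.inl 0)) - zeta (.inl 0) * X l
        - (3 / 4 : ℂ) • (zeta (.inl 0) * X l) := by
    rw [h1, add_sub_cancel_right]
  have h3 := congrArg (fun p : Poly => (2 : ℂ) • p) h2
  simp only [smul_smul] at h3
  rw [show (2 : ℂ) * (1 / 2) = 1 by norm_num, one_smul] at h3
  rw [h3, mul_comm (X l)]
  module

/-- The defects transform under o(10) like ζ_a ⊗ x_l, so their vanishing for one a propagates to
other indices. -/
lemma polyAct_radialDefect (M : o10) (a : Idx) (l : Fin 16) : polyAct (nu M) (radialDefect a l) =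
    ∑ c, (M : Matrix Idx Idx ℂ) c a • radialDefect c l + ∑ m, phi l m (nu M) • radialDefect a m := by
  have h1 : ∑ b, zeta b * polyAct (nu ⁅M, so a b⁆) (X l) =
      ∑ c, (M : Matrix Idx Idx ℂ) c a • ∑ b, zeta b * polyAct (nu (so c b)) (X l)
        - ∑ b, polyAct (nu M) (zeta b) * polyAct (nu (so a b)) (X l) := by
    simp only [lie_so, map_sub, map_sum, map_smul, LinearMap.sub_apply, LinearMap.sum_apply,
      LinearMap.smul_apply, mul_sub, Finset.mul_sum, mul_smul_comm, Finset.sum_sub_distrib,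
      Finset.smul_sum, polyAct_nu_zeta, Finset.sum_mul, smul_mul_assoc]
    refine congrArg₂ (· - ·) ?_ ?_
    · rw [Finset.sum_comm]
    · rw [Finset.sum_comm]
  have h2 : ∀ b, polyAct (nu M) (polyAct (nu (so a b)) (X l)) =
      polyAct (nu ⁅M, so a b⁆) (X l) + ∑ m, phi l m (nu M) • polyAct (nu (so a b)) (X m) := by
    intro b
    have h3 := polyAct_nu_lie M (so a b) (X l)
    rw [polyAct_X (nu M), map_sum] at h3
    simp only [map_smul] at h3
    rw [h3]
    abel
  have h3 : ∑ b, zeta b * polyAct (nu M) (polyAct (nu (so a b)) (X l)) =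
      ∑ b, zeta b * polyAct (nu ⁅M, so a b⁆) (X l)
        + ∑ m, phi l m (nu M) • ∑ b, zeta b * polyAct (nu (so a b)) (X m) := by
    simp only [h2, mul_add, Finset.sum_add_distrib, Finset.mul_sum, mul_smul_comm, Finset.smul_sum]
    refine congrArg₂ (· + ·) rfl ?_
    rw [Finset.sum_comm]
  have h4 : polyAct (nu M) (zeta a * X l) =
      ∑ c, (M : Matrix Idx Idx ℂ) c a • (zeta c * X l) + ∑ m, phi l m (nu M) • (zeta a * X m) := by
    rw [polyAct_mul, polyAct_nu_zeta M a, polyAct_X (nu M) l]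
    simp only [Finset.sum_mul, Finset.mul_sum, smul_mul_assoc, mul_smul_comm]
  have h5 : polyAct (nu M) (∑ b, zeta b * polyAct (nu (so a b)) (X l)) =
      ∑ c, (M : Matrix Idx Idx ℂ) c a • ∑ b, zeta b * polyAct (nu (so c b)) (X l)
        + ∑ m, phi l m (nu M) • ∑ b, zeta b * polyAct (nu (so a b)) (X m) := by
    simp only [map_sum, polyAct_mul]
    rw [Finset.sum_add_distrib, h3, h1]
    abel
  have h6 : ∀ (ι : Type) [Fintype ι] (t : ι → ℂ) (f g : ι → Poly),
      ∑ i, t i • (f i - (1 / 2 : ℂ) • g i) = ∑ i, t i • f i - (1 / 2 : ℂ) • ∑ i, t i • g i := by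
    intro ι _ t f g
    rw [Finset.smul_sum, ← Finset.sum_sub_distrib]
    exact Finset.sum_congr rfl fun i _ => by rw [smul_sub, smul_comm]
  unfold radialDefect
  rw [map_sub, map_smul, h4, h5, h6, h6, smul_add]
  abel

/-- B_{c,a} carries the index a to c. For c = a' this is unavailable because B_{a',a} = 0. -/
lemma radialDefect_of_ne {a c : Idx} (h : ∀ l, radialDefect a l = 0) (hc : c ≠ a.swap) (l : Fin 16) :
    radialDefect c l = 0 := by
  have h1 := polyAct_radialDefect (so c a) a l
  simp only [h, map_zero, smul_zero, Finset.sum_const_zero, add_zero] at h1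
  rw [sum_so_smul, if_pos rfl, if_neg (fun h' => hc (by rw [← h', Sum.swap_swap])), sub_zero] at h1
  exact h1.symm

lemma radialDefect_eq_zero (a : Idx) (l : Fin 16) : radialDefect a l = 0 := by
  by_cases ha : a = .inr 0
  · subst ha
    -- The index 1' cannot be reached from 1 directly, so the route passes through 2.
    exact radialDefect_of_ne (a := .inl 1) (fun l => radialDefect_of_ne radialDefect_first (by simp) l)
      (by simp) l
  · exact radialDefect_of_ne radialDefect_first (by simpa using ha) l

/-- The radial identity: `∑_b ζ_b (E_{a,b} - E_{b',a'})` is half of `ζ_a` times the Euler field. -/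
lemma sum_zeta_polyAct (a : Idx) {n : ℕ} {p : Poly} (hp : p.IsHomogeneous n) :
    ∑ b, zeta b * polyAct (nu (so a b)) p = ((n : ℂ) / 2) • (zeta a * p) := by
  have h : ∀ l, ∑ b, zeta b * polyAct (nu (so a b)) (X l) = (1 / 2 : ℂ) • (zeta a * X l) :=
    fun l => by
      have := radialDefect_eq_zero a l
      rwa [radialDefect, sub_eq_zero] at this
  calc ∑ b, zeta b * polyAct (nu (so a b)) p
      = ∑ l, pderiv l p * ∑ b, zeta b * polyAct (nu (so a b)) (X l) := by
        simp only [polyAct_eq_sum _ p, Finset.mul_sum]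
        rw [Finset.sum_comm]
        exact Finset.sum_congr rfl fun l _ => Finset.sum_congr rfl fun b _ => by ring
    _ = (1 / 2 : ℂ) • (zeta a * ∑ l, X l * pderiv l p) := by
        simp only [h, Finset.mul_sum, Finset.smul_sum, mul_smul_comm]
        exact Finset.sum_congr rfl fun l _ => congrArg _ (by ring)
    _ = _ := by
        rw [hp.sum_X_mul_pderiv, mul_smul_comm, ← Nat.cast_smul_eq_nsmul ℂ, smul_smul,
          one_div_mul_eq_div]

end E6Ext
end

noncomputable section

namespace E6Ext

open MvPolynomial

/-! ### Tensor products with `o(10, ℂ)`-modules -/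

section

variable {V : Type*} [AddCommGroup V] [Module ℂ V]

lemma tm_add_left (p q : Poly) (v : V) : tm (p + q) v = tm p v + tm q v :=
  TensorProduct.add_tmul p q v

lemma tm_sub_left (p q : Poly) (v : V) : tm (p - q) v = tm p v - tm q v :=
  TensorProduct.sub_tmul p q v

lemma tm_smul_left (a : ℂ) (p : Poly) (v : V) : tm (a • p) v = a • tm p v :=
  TensorProduct.smul_tmul' a p v

/-- `p ⊗ v` as a linear function of `v`. -/
def tmR (p : Poly) : V →ₗ[ℂ] Tens V := TensorProduct.mk ℂ Poly V p

lemma tmR_apply (p : Poly) (v : V) : tmR p v = tm p v := rfl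

/-- `p ⊗ v` as a linear function of `p`. -/
def tmL (v : V) : Poly →ₗ[ℂ] Tens V := (TensorProduct.mk ℂ Poly V).flip v

lemma tmL_apply (p : Poly) (v : V) : tmL v p = tm p v := rfl

lemma tm_sum_left {ι : Type*} (s : Finset ι) (f : ι → Poly) (v : V) :
    tm (∑ i ∈ s, f i) v = ∑ i ∈ s, tm (f i) v := map_sum (tmL v) f s

lemma tm_sum_right {ι : Type*} (s : Finset ι) (p : Poly) (f : ι → V) :
    tm p (∑ i ∈ s, f i) = ∑ i ∈ s, tm p (f i) := map_sum (tmR p) f s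

lemma tm_smul_right (a : ℂ) (p : Poly) (v : V) : tm p (a • v) = a • tm p v := map_smul (tmR p) a v

lemma tm_add_right (p : Poly) (v w : V) : tm p (v + w) = tm p v + tm p w := map_add (tmR p) v w

/-- A family of polynomials that is a basis of weight vectors of an `o(10, ℂ)`-submodule, on which the
Casimir operator acts as a scalar. -/
structure WeightBasis (ι : Type*) [Fintype ι] [DecidableEq ι] where
  /-- The polynomials. -/
  p : ι → Poly
  /-- The matrix entries of the action. -/
  m : ι → ι → o10 →ₗ[ℂ] ℂ
  act : ∀ B i, polyAct (nu B) (p i) = ∑ j, m i j B • p j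
  lie : ∀ A B i k, m i k ⁅A, B⁆ = ∑ j, (m i j B * m j k A - m i j A * m j k B)
  /-- The weights. -/
  w : ι → Fin 5 → ℚ
  diag : ∀ k i j, m i j (so (.inl k) (.inl k)) = if j = i then (w i k : ℂ) else 0
  /-- The dual basis. -/
  dual : ι → Poly →ₗ[ℂ] ℂ
  dual_p : ∀ i j, dual i (p j) = if j = i then 1 else 0
  /-- The Casimir eigenvalue. -/
  casVal : ℚ
  cas_eq : ∀ i k, (1 / 2 : ℂ) * ∑ a, ∑ b, ∑ j, m i j (so b a) * m j k (so a b) =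
    if k = i then (casVal : ℂ) else 0

namespace WeightBasis

variable {ι : Type*} [Fintype ι] [DecidableEq ι] (D : WeightBasis ι)

/-- The element `∑ p_i ⊗ u_i` of `𝒜 ⊗ V`. -/
def toTens : (ι → V) →ₗ[ℂ] Tens V where
  toFun u := ∑ i, tm (D.p i) (u i)
  map_add' u v := by simp only [Pi.add_apply, tm_add_right, Finset.sum_add_distrib]
  map_smul' a u := by simp only [Pi.smul_apply, tm_smul_right, Finset.smul_sum, RingHom.id_apply]

lemma toTens_apply (u : ι → V) : D.toTens u = ∑ i, tm (D.p i) (u i) := rfl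

lemma toTens_injective : Function.Injective (D.toTens (V := V)) := by
  rw [← LinearMap.ker_eq_bot, LinearMap.ker_eq_bot']
  intro u hu
  funext i
  let f : Tens V →ₗ[ℂ] V := (TensorProduct.lid ℂ V).toLinearMap.comp (LinearMap.rTensor V (D.dual i))
  have hf : ∀ p v, f (tm p v) = D.dual i p • v := fun p v => by
    change (TensorProduct.lid ℂ V) (LinearMap.rTensor V (D.dual i) (p ⊗ₜ[ℂ] v)) = _
    simp
  have h := congrArg f hu
  rw [toTens_apply, map_sum, map_zero] at h
  simpa only [hf, D.dual_p, ite_smul, one_smul, zero_smul, Finset.sum_ite_eq', Finset.mem_univ,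
    if_true, Pi.zero_apply] using h

end WeightBasis

end

section

variable (V : Type*) [AddCommGroup V] [Module ℂ V] [LieRingModule o10 V] [LieModule ℂ o10 V]

/-- The representation of `o(10, ℂ)` on `V`. -/
def endRep : o10 →ₗ[ℂ] Module.End ℂ V := (LieModule.toEnd ℂ o10 V : o10 →ₗ[ℂ] Module.End ℂ V)

variable {V}

@[simp] lemma endRep_apply (B : o10) (v : V) : endRep V B v = ⁅B, v⁆ := rfl

lemma isRep_endRep : IsRep (endRep V) := by
  intro A B
  refine LinearMap.ext fun v => ?_
  rw [com_apply]
  simp only [endRep_apply, lie_lie]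

lemma isIrred_endRep [LieModule.IsIrreducible ℂ o10 V] : IsIrred (endRep V) := by
  intro W hW hne
  let W' : LieSubmodule ℂ o10 V := { W with lie_mem := fun {M w} hw => hW M w hw }
  have h : W' = ⊤ := by
    refine (eq_bot_or_eq_top W').resolve_left fun h => hne ?_
    rw [← LieSubmodule.toSubmodule_eq_bot] at h
    exact h
  rw [← LieSubmodule.toSubmodule_eq_top] at h
  exact h

lemma tensAct_tm (B : o10) (p : Poly) (v : V) :
    tensAct V B (tm p v) = tm (polyAct (nu B) p) v + tm p ⁅B, v⁆ := by
  rw [tensAct, LinearMap.add_apply, opL_tmul, opR_tmul, LieModule.toEnd_apply_apply]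

lemma tensAct_lie (A B : o10) (w : Tens V) :
    tensAct V ⁅A, B⁆ w = tensAct V A (tensAct V B w) - tensAct V B (tensAct V A w) := by
  induction w using Tens_induction with
  | zero => simp
  | add x y hx hy =>
    simp only [map_add, hx, hy]
    abel
  | tmul p v =>
    simp only [tensAct_tm, map_add, polyAct_nu_lie, lie_lie, tm_sub_left]
    rw [← tmR_apply p (⁅A, ⁅B, v⁆⁆ - ⁅B, ⁅A, v⁆⁆), map_sub, tmR_apply, tmR_apply]
    abel

namespace WeightBasis

variable {ι : Type*} [Fintype ι] [DecidableEq ι] (D : WeightBasis ι)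

variable (V) in
/-- The representation on `V^ι`, where `u` stands for `∑ p_i ⊗ u_i`. -/
def rep : o10 →ₗ[ℂ] Module.End ℂ (ι → V) where
  toFun B :=
    { toFun := fun u k => ⁅B, u k⁆ + ∑ i, D.m i k B • u i
      map_add' := fun u v => by
        funext k
        simp only [Pi.add_apply, lie_add, smul_add, Finset.sum_add_distrib]
        abel
      map_smul' := fun a u => by
        funext k
        simp only [Pi.smul_apply, lie_smul, smul_comm _ a, ← Finset.smul_sum, RingHom.id_apply, smul_add] }
  map_add' A B := by
    refine LinearMap.ext fun u => funext fun k => ?_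
    simp only [LinearMap.coe_mk, AddHom.coe_mk, LinearMap.add_apply, Pi.add_apply, add_lie, map_add,
      add_smul, Finset.sum_add_distrib]
    abel
  map_smul' a B := by
    refine LinearMap.ext fun u => funext fun k => ?_
    simp only [LinearMap.coe_mk, AddHom.coe_mk, LinearMap.smul_apply, Pi.smul_apply, smul_lie, map_smul,
      smul_assoc, RingHom.id_apply, smul_add, Finset.smul_sum]

lemma rep_apply (B : o10) (u : ι → V) (k : ι) :
    D.rep V B u k = ⁅B, u k⁆ + ∑ i, D.m i k B • u i := rfl

lemma toTens_rep (B : o10) (u : ι → V) : D.toTens (D.rep V B u) = tensAct V B (D.toTens u) := by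
  simp only [toTens_apply, map_sum, tensAct_tm, rep_apply, D.act, tm_add_right, tm_sum_right, tm_sum_left,
    tm_smul_left, tm_smul_right, Finset.sum_add_distrib]
  rw [add_comm, Finset.sum_comm]

/-- Inherited from `tensAct_lie` through the injection `toTens`. -/
lemma isRep_rep : IsRep (D.rep V) := by
  intro A B
  refine LinearMap.ext fun u => D.toTens_injective ?_
  rw [com_apply, map_sub, toTens_rep, toTens_rep, toTens_rep, toTens_rep, toTens_rep, tensAct_lie]

lemma isSingular_iff (μ : Fin 5 → ℚ) (u : ι → V) :
    IsSingular (tensAct V) μ (D.toTens u) ↔ IsSing (D.rep V) (fun i => (μ i : ℂ)) u := by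
  have h0 : ∀ x : ι → V, D.toTens x = 0 ↔ x = 0 := fun x =>
    map_eq_zero_iff _ D.toTens_injective
  unfold IsSingular IsSing
  simp only [← toTens_rep, h0, ne_eq, ← map_smul, D.toTens_injective.eq_iff]

/-- The height of the weight of `p_i`. -/
def ht (i : ι) : ℚ := ∑ k, halfSum k * D.w i k

lemma m_hElt (i j : ι) : D.m i j hElt = if j = i then (D.ht i : ℂ) else 0 := by
  rw [hElt, map_sum]
  simp only [map_smul, D.diag, smul_eq_mul, mul_ite, mul_zero, ht]
  split_ifs
  · push_cast
    rfl
  · simp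

/-- Compare the two expressions for the entry of [`hElt`, B_{a,b}]: one uses the height of the root,
the other the heights of the two basis elements. -/
lemma m_so_ne_zero {i k : ι} {a b : Idx} (h : D.m i k (so a b) ≠ 0) :
    D.ht k = D.ht i + (hgt a - hgt b : ℤ) := by
  have h1 := D.lie hElt (so a b) i k
  rw [hElt_lie_so, map_smul, Finset.sum_sub_distrib] at h1
  simp only [m_hElt, mul_ite, ite_mul, mul_zero, zero_mul, Finset.sum_ite_eq', Finset.sum_ite_eq,
    Finset.mem_univ, if_true, smul_eq_mul] at h1
  have h2 : D.m i k (so a b) * ((D.ht k : ℂ) - D.ht i - ((hgt a - hgt b : ℤ) : ℂ)) = 0 := by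
    linear_combination -h1
  have h3 := (mul_eq_zero.1 h2).resolve_left h
  have h4 : D.ht k - D.ht i - ((hgt a - hgt b : ℤ) : ℚ) = 0 := by exact_mod_cast h3
  linarith

/-- The weights of singular vectors of the tensor product with an irreducible module. -/
lemma weight_of_isSing [LieModule.IsIrreducible ℂ o10 V] {lam μ : Fin 5 → ℂ} {v : V}
    (hv : IsSing (endRep V) lam v) {u : ι → V} (hu : IsSing (D.rep V) μ u) :
    ∃ i, ∀ k, μ k = lam k + D.w i k := by
  classical
  have hne : (Finset.univ.filter fun i => u i ≠ 0).Nonempty := by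
    by_contra hc
    rw [Finset.not_nonempty_iff_eq_empty, Finset.filter_eq_empty_iff] at hc
    exact hu.1 (funext fun i => not_not.1 (hc (Finset.mem_univ i)))
  -- At a nonzero component of minimal height a raising operator receives nothing from other
  -- components, since contributions come only from lower heights. So u_i is singular in V and has
  -- weight λ.
  obtain ⟨i, hi, hmin⟩ := Finset.exists_min_image _ D.ht hne
  have hi0 : u i ≠ 0 := (Finset.mem_filter.1 hi).2
  have hpos : ∀ a b, hgt b < hgt a → endRep V (so a b) (u i) = 0 := by
    intro a b hab
    have h1 := congrFun (hu.pos a b hab) i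
    rw [rep_apply, Finset.sum_eq_zero, add_zero] at h1
    · exact h1
    · intro j _
      by_cases hj : u j = 0
      · rw [hj, smul_zero]
      · by_cases hm : D.m j i (so a b) = 0
        · rw [hm, zero_smul]
        · have h2 := D.m_so_ne_zero hm
          have h3 := hmin j (Finset.mem_filter.2 ⟨Finset.mem_univ j, hj⟩)
          have h4 : (0 : ℚ) < ((hgt a - hgt b : ℤ) : ℚ) := by
            rw [Int.cast_pos]
            omega
          linarith
  have hdiag : ∀ k, endRep V (so (.inl k) (.inl k)) (u i) = (μ k - D.w i k) • u i := by
    intro k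
    have h1 := congrFun (hu.2.1 k) i
    rw [rep_apply] at h1
    simp only [D.diag, ite_smul, zero_smul, Finset.sum_ite_eq, Finset.mem_univ, if_true,
      Pi.smul_apply] at h1
    rw [sub_smul, ← h1, endRep_apply]
    abel
  have hs : IsSing (endRep V) (fun k => μ k - D.w i k) (u i) := by
    refine ⟨hi0, hdiag, fun a b hab => ⟨hpos _ _ ?_, hpos _ _ ?_⟩⟩ <;>
      simp only [hgt] <;> have := Fin.lt_def.1 hab <;> omega
  have := hv.weight_unique isRep_endRep isIrred_endRep hs
  refine ⟨i, fun k => ?_⟩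
  have h1 := congrFun this k
  linear_combination h1

variable (V) in
/-- The mixed part of the Casimir operator. -/
def mixed : Module.End ℂ (ι → V) where
  toFun u k := (1 / 2 : ℂ) • ∑ a, ∑ b, ∑ i, D.m i k (so a b) • ⁅so b a, u i⁆
  map_add' u v := by
    funext k
    simp only [Pi.add_apply, lie_add, smul_add, Finset.sum_add_distrib]
  map_smul' c u := by
    funext k
    simp only [Pi.smul_apply, lie_smul, smul_comm _ c, ← Finset.smul_sum, RingHom.id_apply]

lemma mixed_apply (u : ι → V) (k : ι) :
    D.mixed V u k = (1 / 2 : ℂ) • ∑ a, ∑ b, ∑ i, D.m i k (so a b) • ⁅so b a, u i⁆ := rfl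

/-- The coproduct of each product B_{a,b} B_{b,a} has two cross terms, which are exchanged by a ↔ b;
together they give twice the mixed part. -/
lemma cas_rep (u : ι → V) (k : ι) : cas (D.rep V) u k =
    cas (endRep V) (u k) + (D.casVal : ℂ) • u k + (2 : ℂ) • D.mixed V u k := by
  have h1 : ∀ A B, D.rep V A (D.rep V B u) k = ⁅A, ⁅B, u k⁆⁆ + ∑ i, D.m i k B • ⁅A, u i⁆
      + ∑ i, D.m i k A • ⁅B, u i⁆ + ∑ i, (∑ j, D.m i j B * D.m j k A) • u i := by
    intro A B
    simp only [rep_apply, lie_add, lie_sum, lie_smul, smul_add, Finset.sum_add_distrib, Finset.smul_sum,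
      smul_smul, Finset.sum_smul]
    rw [Finset.sum_comm (f := fun x y => (D.m x k A * D.m y x B) • u y)]
    simp only [mul_comm (D.m _ k A)]
    abel
  have h2 : (1 / 2 : ℂ) • ∑ a, ∑ b, ∑ i, (∑ j, D.m i j (so b a) * D.m j k (so a b)) • u i =
      (D.casVal : ℂ) • u k := by
    have h3 : ∑ a, ∑ b, ∑ i, (∑ j, D.m i j (so b a) * D.m j k (so a b)) • u i =
        ∑ i, (∑ a, ∑ b, ∑ j, D.m i j (so b a) * D.m j k (so a b)) • u i := by
      simp only [Finset.sum_smul]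
      rw [Finset.sum_comm]
      conv_rhs => rw [Finset.sum_comm]
      rw [Finset.sum_comm]
      refine Finset.sum_congr rfl fun a _ => ?_
      rw [Finset.sum_comm]
    rw [h3, Finset.smul_sum]
    simp only [smul_smul, D.cas_eq, ite_smul, zero_smul, Finset.sum_ite_eq, Finset.mem_univ, if_true]
  have h3 : ∑ a, ∑ b, ∑ i, D.m i k (so b a) • ⁅so a b, u i⁆ =
      ∑ a, ∑ b, ∑ i, D.m i k (so a b) • ⁅so b a, u i⁆ := Finset.sum_comm
  rw [cas, cas, mixed_apply]
  simp only [LinearMap.smul_apply, LinearMap.sum_apply, Pi.smul_apply, Finset.sum_apply,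
    Module.End.mul_apply, h1, Finset.sum_add_distrib, smul_add, endRep_apply, h2, h3]
  module

lemma cas_rep_eq [LieModule.IsIrreducible ℂ o10 V] {lam : Fin 5 → ℂ} {v : V}
    (hv : IsSing (endRep V) lam v) (u : ι → V) :
    cas (D.rep V) u = (casC lam + D.casVal) • u + (2 : ℂ) • D.mixed V u := by
  funext k
  rw [cas_rep, hv.cas_eq isRep_endRep isIrred_endRep, add_smul]
  rfl

/-- The eigenvalue of the mixed part of the Casimir operator at a weight. -/
def mixedVal (lam μ : Fin 5 → ℚ) : ℚ := (casimir μ - casimir lam - D.casVal) / 2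

/-- On a singular vector the full Casimir operator is known from the weight; subtracting the scalars
of the two factors leaves twice the mixed eigenvalue. -/
lemma eq_mixedVal [LieModule.IsIrreducible ℂ o10 V] {lam μ : Fin 5 → ℚ} {v : V}
    (hv : IsSing (endRep V) (fun i => (lam i : ℂ)) v) {u : ι → V}
    (hu : IsSing (D.rep V) (fun i => (μ i : ℂ)) u) {e : ℂ} (he : D.mixed V u = e • u) :
    e = D.mixedVal lam μ := by
  have h := D.cas_rep_eq hv u
  rw [hu.cas_apply D.isRep_rep, he, smul_smul, ← add_smul, casC_cast, casC_cast] at h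
  have h1 := sub_eq_zero.2 h
  rw [← sub_smul] at h1
  have h2 := (smul_eq_zero.1 h1).resolve_right hu.1
  rw [mixedVal]
  push_cast
  linear_combination -h2 / 2

/-- An eigenvalue of the mixed part of the Casimir operator is attained at a singular vector. -/
lemma exists_isSing_of_eigenvalue [FiniteDimensional ℂ V] [LieModule.IsIrreducible ℂ o10 V]
    {lam : Fin 5 → ℚ} {v : V} (hv : IsSing (endRep V) (fun i => (lam i : ℂ)) v) {u : ι → V}
    (hu0 : u ≠ 0) {e : ℂ} (he : D.mixed V u = e • u) :
    ∃ i, ∃ u' : ι → V, IsDominant (lam + D.w i) ∧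
      IsSing (D.rep V) (fun k => ((lam + D.w i) k : ℂ)) u' ∧ D.mixed V u' = e • u' := by
  -- The eigenspaces of the mixed part are eigenspaces of the Casimir operator, hence invariant.
  have hcas : ∀ x : ι → V, D.mixed V x = e • x ↔
      cas (D.rep V) x = (casC (fun i => (lam i : ℂ)) + D.casVal + 2 * e) • x := by
    intro x
    rw [D.cas_rep_eq hv, add_smul _ (2 * e), add_right_inj, mul_smul]
    exact (smul_right_injective (ι → V) (two_ne_zero : (2 : ℂ) ≠ 0)).eq_iff.symm
  obtain ⟨μ, u', hu', hs⟩ := exists_isSing D.isRep_rep ((D.mixed V).eigenspace e)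
    ((Submodule.ne_bot_iff _).2 ⟨u, Module.End.mem_eigenspace_iff.2 he, hu0⟩)
    (fun M x hx => by
      rw [Module.End.mem_eigenspace_iff, hcas] at hx ⊢
      rw [cas_apply_comm D.isRep_rep, hx, map_smul])
  obtain ⟨q, hq, hdom⟩ := hs.dominant D.isRep_rep
  obtain ⟨i, hi⟩ := D.weight_of_isSing hv hs
  have hqi : q = lam + D.w i := by
    funext k
    have h1 := hi k
    rw [hq] at h1
    exact_mod_cast h1
  have hμ : μ = fun k => ((lam + D.w i) k : ℂ) := by
    funext k
    rw [hq, hqi]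
  subst hqi
  rw [hμ] at hs
  exact ⟨i, u', hdom, hs, Module.End.mem_eigenspace_iff.1 hu'⟩

end WeightBasis

end

end E6Ext
end

noncomputable section

namespace E6Ext

open MvPolynomial

/-! ### The spin module and the natural module inside `𝒜` -/

lemma sum_rotate {M α β γ : Type*} [AddCommMonoid M] [Fintype α] [Fintype β] [Fintype γ]
    (f : α → β → γ → M) : ∑ a, ∑ b, ∑ c, f a b c = ∑ c, ∑ a, ∑ b, f a b c := by
  conv_rhs => rw [Finset.sum_comm]
  exact Finset.sum_congr rfl fun a _ => Finset.sum_comm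

/-- Twice the image of a diagonal matrix under `ν`. -/
def nuHTwo : Fin 5 → Lat :=
  ![![2, 1, 2, 2, 1, 0], ![0, 1, 2, 2, 1, 0], ![0, 1, 0, 2, 1, 0], ![0, 1, 0, 0, 1, 0],
    ![0, 1, 0, 0, -1, 0]]

/-- Doubling clears the denominators, so that the weights can be computed over ℤ. -/
lemma hform_nuH (v : Lat) (k : Fin 5) : hform v (nuH k) = (form (nuHTwo k) v : ℂ) / 2 := by
  have h : nuH k = (1 / 2 : ℂ) • toH (nuHTwo k) := by
    funext j
    fin_cases k <;> fin_cases j <;> norm_num [nuH, nuHTwo, toH]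
  rw [h, map_smul, hform_toH, smul_eq_mul]
  ring

/-- The positions of the minus signs in the weight of `x_i`. -/
def spinSign (i : Fin 16) (k : Fin 5) : ZMod 2 := ((form (nuHTwo k) (rt i) + 1) / 2 : ℤ)

lemma form_nuHTwo_rt (i : Fin 16) (k : Fin 5) :
    form (nuHTwo k) (rt i) = -(-1) ^ (spinSign i k).val := by
  revert i k; decide +kernel

lemma sum_spinSign (i : Fin 16) : ∑ k, spinSign i k = 1 := by
  revert i; decide +kernel

/-- The weight of `x_i`. -/
def spinW (i : Fin 16) (k : Fin 5) : ℚ := 1 / 2 * (-1) ^ (spinSign i k).val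

lemma spinW_mem (i : Fin 16) : spinW i ∈ spinWeights := ⟨spinSign i, sum_spinSign i, fun _ => rfl⟩

/-- By `phi_xi_eta` the trace of [ξ_j, η_i] is 1 + 16 - 5 = 12 on the diagonal; removing the central
component subtracts 3/4. -/
lemma sum_phi_nuInv (i k : Fin 16) :
    ∑ j, phi j k (nu (nuInv ⁅xi j, eta i⁆)) = if k = i then ((45 / 4 : ℚ) : ℂ) else 0 := by
  have hd : ∀ j, IsDeg 0 ⁅xi j, eta i⁆ := fun j => by
    simpa using (isDeg_xi j).lie (isDeg_eta i)
  have hZ : ∑ j, ∑ a, (Z a i j : ℂ) * Z a j k = if k = i then 5 else 0 := by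
    rw [Finset.sum_comm]
    exact_mod_cast congrArg (Int.cast : ℤ → ℂ) (sum_Z_Z i k)
  simp only [nu_nuInv (hd _), map_sub, map_smul, phi_xi_eta, hPart_xi_eta_five, phi_alphaHat,
    Finset.sum_sub_distrib, Finset.sum_add_distrib, hZ]
  by_cases h : k = i
  · subst h
    simp
    norm_num
  · simp [h]

/-- By `nuInv_xi_eta_eq_sum` the Casimir operator on the variables is the sum just computed. -/
lemma half_sum_phi (i k : Fin 16) :
    (1 / 2 : ℂ) * ∑ a, ∑ b, ∑ j, phi i j (nu (so b a)) * phi j k (nu (so a b)) =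
      if k = i then ((45 / 4 : ℚ) : ℂ) else 0 := by
  rw [← sum_phi_nuInv]
  simp only [nuInv_xi_eta_eq_sum, map_smul, map_sum, smul_eq_mul, ← Finset.mul_sum]
  rw [sum_rotate]

/-- The span of the variables. -/
def spinBasis : WeightBasis (Fin 16) where
  p := X
  m i j := (phi i j).comp nu
  act B i := polyAct_X (nu B) i
  lie A B i k := by
    simp only [LinearMap.comp_apply, nu_lie]
    exact phi_lie _ _ (isDeg_nu A) (isDeg_nu B) i k
  w := spinW
  diag k i j := by
    rw [LinearMap.comp_apply, nu_so_diag, phi_ofH, hform_nuH, form_nuHTwo_rt]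
    refine if_congr Iff.rfl ?_ rfl
    rw [spinW]
    push_cast
    ring
  dual i := lcoeff ℂ (Finsupp.single i 1)
  dual_p i j := by
    change coeff (Finsupp.single i 1) (X j : Poly) = _
    rw [coeff_X]
    refine if_congr ?_ rfl rfl
    rw [Finsupp.single_left_inj one_ne_zero]
  casVal := 45 / 4
  cas_eq i k := half_sum_phi i k

/-- An entry of a matrix in `o(10, ℂ)` as a linear form. -/
def entry (a b : Idx) : o10 →ₗ[ℂ] ℂ where
  toFun B := (B : Matrix Idx Idx ℂ) a b
  map_add' _ _ := rfl
  map_smul' x B := smul_o10_apply x B a b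

lemma entry_apply (a b : Idx) (B : o10) : entry a b B = (B : Matrix Idx Idx ℂ) a b := rfl

lemma entry_lie (A B : o10) (i k : Idx) : entry k i ⁅A, B⁆ =
    ∑ j, (entry j i B * entry k j A - entry j i A * entry k j B) := by
  simp only [entry_apply, lie_o10_coe, Matrix.sub_apply, Matrix.mul_apply, Finset.sum_sub_distrib,
    mul_comm ((B : Matrix Idx Idx ℂ) _ i), mul_comm ((A : Matrix Idx Idx ℂ) _ i)]

lemma sum_so_entry {M : Type*} [AddCommGroup M] [Module ℂ M] (k j : Idx) (f : Idx → Idx → M) :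
    ∑ a, ∑ b, (so a b : Matrix Idx Idx ℂ) k j • f a b = f k j - f j.swap k.swap := by
  have h : ∀ x y : Idx, x = y.swap ↔ y = x.swap := fun x y => by
    constructor <;> rintro rfl <;> rw [Sum.swap_swap]
  simp only [so_entry, sub_smul, ite_smul, one_smul, zero_smul, Finset.sum_sub_distrib,
    Finset.sum_ite_eq, Finset.mem_univ, if_true, Finset.sum_ite_irrel, Finset.sum_const_zero,
    h k, h j, Finset.sum_ite_eq']

/-- The value 9 is (ε_1 + 2ρ, ε_1) = 1 + 8, the Casimir eigenvalue of the natural module. -/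
lemma half_sum_so (i k : Idx) : (1 / 2 : ℂ) * ∑ a, ∑ b, ∑ j, entry j i (so b a) * entry k j (so a b) =
    if k = i then ((9 : ℚ) : ℂ) else 0 := by
  have h1 : ∑ a, ∑ b, ∑ j, entry j i (so b a) * entry k j (so a b) =
      ∑ j, ((so j k : Matrix Idx Idx ℂ) j i - (so k.swap j.swap : Matrix Idx Idx ℂ) j i) := by
    rw [sum_rotate]
    refine Finset.sum_congr rfl fun j _ => ?_
    rw [← sum_so_entry k j fun a b => (so b a : Matrix Idx Idx ℂ) j i]
    simp only [entry_apply, smul_eq_mul, mul_comm]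
  have h2 : ∀ j, (so k.swap j.swap : Matrix Idx Idx ℂ) j i = -(so j k : Matrix Idx Idx ℂ) j i := by
    intro j
    rw [so_swap]
    rfl
  simp only [h1, h2, sub_neg_eq_add, so_entry, Finset.sum_add_distrib, Finset.sum_sub_distrib]
  by_cases h : k = i
  · subst h
    have h3 : ∀ j : Idx, (if j = k.swap then if k = j.swap then (1 : ℂ) else 0 else 0) =
        if j = k.swap then 1 else 0 := fun j => by
      split_ifs with h4 h5
      · rfl
      · exact absurd (by rw [h4, Sum.swap_swap]) h5
      · rfl
    simp [-Fintype.sum_sum_type, h3]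
    norm_num
  · have h3 : ∀ j : Idx, (if j = k.swap then if i = j.swap then (1 : ℂ) else 0 else 0) = 0 := fun j => by
      split_ifs with h4 h5
      · exact absurd (by rw [h5, h4, Sum.swap_swap]) h
      · rfl
      · rfl
    simp [-Fintype.sum_sum_type, h3, h, Ne.symm h]

/-- The coefficient of `ζ_b` in an element of the span of the `ζ_a`. -/
def zetaDual (b : Idx) : Poly →ₗ[ℂ] ℂ :=
  ((zetaTerms b).headI.1 : ℂ) • (lcoeff ℂ (Finsupp.single (zetaTerms b).headI.2.2 1)).comp
    (pderiv (R := ℂ) (zetaTerms b).headI.2.1).toLinearMap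

/-- The first monomial of ζ_b occurs in no other quadric, and its sign squares to 1; its signed
coefficient is therefore a dual functional. -/
lemma headI_mul_Z (a b : Idx) : (zetaTerms b).headI.1 *
    Z a (zetaTerms b).headI.2.1 (zetaTerms b).headI.2.2 = if a = b then 1 else 0 := by
  revert a b; decide +kernel

lemma zetaDual_zeta (b a : Idx) : zetaDual b (zeta a) = if a = b then 1 else 0 := by
  have h : zetaDual b (zeta a) = (zetaTerms b).headI.1 *
      coeff (Finsupp.single (zetaTerms b).headI.2.2 1) (pderiv (zetaTerms b).headI.2.1 (zeta a)) := rfl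
  rw [h, pderiv_zeta, coeff_sum]
  simp only [coeff_smul, coeff_X, Finsupp.single_left_inj one_ne_zero, smul_eq_mul, mul_ite, mul_one,
    mul_zero, Finset.sum_ite_eq', Finset.mem_univ, if_true]
  exact_mod_cast congrArg (Int.cast : ℤ → ℂ) (headI_mul_Z a b)

/-- The span of the quadrics `ζ_a`. -/
def natBasis : WeightBasis Idx where
  p := zeta
  m i j := entry j i
  act B i := polyAct_nu_zeta B i
  lie A B i k := entry_lie A B i k
  w a k := wt a k
  diag k i j := by
    rw [entry_apply, so_diag_apply, Rat.cast_intCast]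
    split_ifs with h
    · rw [h]
    · rfl
  dual := zetaDual
  dual_p := zetaDual_zeta
  casVal := 9
  cas_eq := half_sum_so

lemma wt_mem_vectorWeights (a : Idx) : (fun k => (wt a k : ℚ)) ∈ vectorWeights := by
  rcases a with i | i
  · refine ⟨i, Or.inl (funext fun k => ?_)⟩
    by_cases h : k = i
    · subst h
      simp [wt]
    · simp [wt, h]
  · refine ⟨i, Or.inr (funext fun k => ?_)⟩
    by_cases h : k = i
    · subst h
      simp [wt]
    · simp [wt, h]

section

variable {V : Type*} [AddCommGroup V] [Module ℂ V] [LieRingModule o10 V] [LieModule ℂ o10 V]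

/-- The right side is the o(10)-part of the x_r-coefficient of ∑_i η_i(1 ⊗ u_i). This is the point
where the action of 𝒢_- becomes a Casimir operator. -/
lemma spinBasis_mixed (u : Fin 16 → V) (r : Fin 16) :
    spinBasis.mixed V u r = ∑ i, ⁅nuInv ⁅xi r, eta i⁆, u i⁆ := by
  have h : ∀ i, ⁅nuInv ⁅xi r, eta i⁆, u i⁆ =
      (1 / 2 : ℂ) • ∑ a, ∑ b, phi i r (nu (so b a)) • ⁅so a b, u i⁆ := fun i => by
    rw [nuInv_xi_eta_eq_sum, smul_lie, sum_lie]
    simp only [sum_lie, smul_lie]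
  rw [WeightBasis.mixed_apply]
  simp only [h, ← Finset.smul_sum]
  refine congrArg _ ?_
  rw [sum_rotate]
  exact Finset.sum_congr rfl fun i _ => Finset.sum_comm

lemma natBasis_mixed (u : Idx → V) (k : Idx) : natBasis.mixed V u k = ∑ i, ⁅so i k, u i⁆ := by
  have h1 : ∑ a, ∑ b, ∑ i, natBasis.m i k (so a b) • ⁅so b a, u i⁆ =
      ∑ i, (⁅so i k, u i⁆ - ⁅so k.swap i.swap, u i⁆) := by
    rw [sum_rotate]
    exact Finset.sum_congr rfl fun i _ => sum_so_entry k i fun a b => ⁅so b a, u i⁆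
  have h2 : ∀ i, ⁅so k.swap i.swap, u i⁆ = -⁅so i k, u i⁆ := fun i => by
    rw [so_swap, neg_lie]
  rw [WeightBasis.mixed_apply, h1]
  simp only [h2, sub_neg_eq_add, Finset.sum_add_distrib]
  module

/-- The operator T' is the mixed Casimir operator, so the numbers ♭_{λ'} are eigenvalues of the
latter. -/
lemma natBasis_toTens_mixed (u : Idx → V) :
    natBasis.toTens (natBasis.mixed V u) = ∑ a, Tprime a (u a) := by
  simp only [WeightBasis.toTens_apply, natBasis_mixed, tm_sum_right, Tprime]
  exact Finset.sum_comm

end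

end E6Ext
end

noncomputable section

namespace E6Ext

/-! ### Eigenvalues of the mixed part of the Casimir operator -/

/-- A set of weights of equal length, any two of which differ by an element of the root lattice
of `D₅`. -/
def IsMinusculeSet (S : Set (Fin 5 → ℚ)) : Prop :=
  ∀ μ ∈ S, ∀ μ' ∈ S, ip μ μ = ip μ' μ' ∧
    ∃ d : Fin 5 → ℤ, Even (∑ i, d i) ∧ ∀ i, μ i - μ' i = d i

/-- Integer vectors with even coordinate sum form the root lattice of D₅, with which λ + ρ pairs
integrally. -/
lemma exists_int_of_even {lam : Fin 5 → ℚ} (hlam : IsDominant lam) {d : Fin 5 → ℤ}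
    (hd : Even (∑ i, d i)) : ∃ n : ℤ, ∑ i, (d i : ℚ) * (lam i + halfSum i) = n := by
  obtain ⟨h, m, hm⟩ := hlam
  obtain ⟨n₀, h₀⟩ := h 0
  obtain ⟨n₁, h₁⟩ := h 1
  obtain ⟨n₂, h₂⟩ := h 2
  obtain ⟨n₃, h₃⟩ := h 3
  obtain ⟨t, ht⟩ := hd
  simp only [Fin.sum_univ_five] at ht
  have ht' : (d 0 : ℚ) + d 1 + d 2 + d 3 + d 4 = t + t := by exact_mod_cast ht
  replace h₀ : lam 0 - lam 1 = n₀ := h₀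
  replace h₁ : lam 1 - lam 2 = n₁ := h₁
  replace h₂ : lam 2 - lam 3 = n₂ := h₂
  replace h₃ : lam 3 - lam 4 = n₃ := h₃
  -- Each coordinate of λ is written as λ_4 plus an integer. The total coefficient of λ_4 is 2t, and
  -- 2λ_4 = (λ_4 - λ_5) + (λ_4 + λ_5) = n₃ + m. The second line is the contribution of ρ.
  refine ⟨t * (n₃ + m) + d 0 * (n₀ + n₁ + n₂) + d 1 * (n₁ + n₂) + d 2 * n₂ - d 4 * n₃
    + 4 * d 0 + 3 * d 1 + 2 * d 2 + d 3, ?_⟩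
  simp only [Fin.sum_univ_five, halfSum, Matrix.cons_val]
  push_cast
  rw [← h₀, ← h₁, ← h₂, ← h₃, ← hm]
  linear_combination lam 3 * ht'

lemma casimir_eq (μ : Fin 5 → ℚ) : casimir μ = ∑ i, (μ i + 2 * halfSum i) * μ i := by
  simp [casimir, ip]

/-- The terms quadratic in μ and μ' cancel by equality of lengths, leaving (μ - μ', λ + ρ). -/
lemma casimir_add_sub (lam μ μ' : Fin 5 → ℚ) (h : ip μ μ = ip μ' μ') :
    (casimir (lam + μ) - casimir (lam + μ')) / 2 = ∑ i, (μ i - μ' i) * (lam i + halfSum i) := by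
  simp only [ip, Fin.sum_univ_five] at h
  simp only [casimir_eq, Fin.sum_univ_five, Pi.add_apply]
  linear_combination h / 2

lemma neg_one_pow_val (k : ZMod 2) : (-1 : ℚ) ^ k.val = 1 - 2 * (k.val : ℤ) := by
  fin_cases k <;> norm_num [ZMod.val]

lemma isMinusculeSet_spinWeights : IsMinusculeSet spinWeights := by
  rintro μ ⟨k, hk, hμ⟩ μ' ⟨k', hk', hμ'⟩
  refine ⟨?_, fun i => (k' i).val - (k i).val, ?_, fun i => ?_⟩
  · simp only [ip, hμ, hμ']
    refine Finset.sum_congr rfl fun i _ => ?_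
    rcases neg_one_pow_eq_or ℚ (k i).val with h | h <;>
      rcases neg_one_pow_eq_or ℚ (k' i).val with h' | h' <;> rw [h, h'] <;> norm_num
  · rw [← ZMod.intCast_eq_zero_iff_even]
    push_cast
    simp only [ZMod.natCast_val, ZMod.cast_id', id_eq, Finset.sum_sub_distrib, hk, hk', sub_self]
  · rw [hμ, hμ', neg_one_pow_val, neg_one_pow_val]
    push_cast
    ring

lemma exists_wt_of_mem_vectorWeights {μ : Fin 5 → ℚ} (h : μ ∈ vectorWeights) :
    ∃ a, μ = fun k => (wt a k : ℚ) := by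
  obtain ⟨i, rfl | rfl⟩ := h
  · refine ⟨.inl i, funext fun k => ?_⟩
    by_cases hk : k = i
    · subst hk
      simp [wt]
    · simp [wt, hk]
  · refine ⟨.inr i, funext fun k => ?_⟩
    by_cases hk : k = i
    · subst hk
      simp [wt]
    · simp [wt, hk]

lemma isMinusculeSet_vectorWeights : IsMinusculeSet vectorWeights := by
  intro μ hμ μ' hμ'
  obtain ⟨a, rfl⟩ := exists_wt_of_mem_vectorWeights hμ
  obtain ⟨b, rfl⟩ := exists_wt_of_mem_vectorWeights hμ'
  refine ⟨?_, fun i => wt a i - wt b i, ?_, fun i => ?_⟩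
  · have h : ∀ a : Idx, ∑ i, wt a i * wt a i = 1 := by decide
    simp only [ip]
    exact_mod_cast congrArg (Int.cast : ℤ → ℚ) ((h a).trans (h b).symm)
  · have h : ∀ a b : Idx, Even (∑ i, (wt a i - wt b i)) := by decide
    exact h a b
  · push_cast
    rfl

lemma finite_spinWeights : spinWeights.Finite := by
  refine (Set.finite_range fun (k : Fin 5 → ZMod 2) (i : Fin 5) =>
    (1 / 2 * (-1) ^ (k i).val : ℚ)).subset ?_
  rintro μ ⟨k, -, hμ⟩
  exact ⟨k, (funext hμ).symm⟩

lemma finite_vectorWeights : vectorWeights.Finite := by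
  refine (Set.finite_range fun (a : Idx) (k : Fin 5) => (wt a k : ℚ)).subset ?_
  intro μ hμ
  obtain ⟨a, rfl⟩ := exists_wt_of_mem_vectorWeights hμ
  exact ⟨a, rfl⟩

namespace WeightBasis

variable {ι : Type*} [Fintype ι] [DecidableEq ι] (D : WeightBasis ι)

/-- The difference of two values is (μ - μ', λ + ρ), an integer because μ - μ' is in the root
lattice. Excluding one progression starting at the minimum therefore excludes all values. -/
lemma exists_nat_of_mixedVal_le {S : Set (Fin 5 → ℚ)} (hS : IsMinusculeSet S) {lam : Fin 5 → ℚ}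
    (hlam : IsDominant lam) {μ μ' : Fin 5 → ℚ} (hμ : μ ∈ S) (hμ' : μ' ∈ S)
    (h : D.mixedVal lam (lam + μ') ≤ D.mixedVal lam (lam + μ)) :
    ∃ n : ℕ, D.mixedVal lam (lam + μ) = D.mixedVal lam (lam + μ') + n := by
  obtain ⟨h1, d, hd, h2⟩ := hS μ hμ μ' hμ'
  obtain ⟨n, hn⟩ := exists_int_of_even hlam hd
  have h3 := casimir_add_sub lam μ μ' h1
  simp only [h2, hn] at h3
  have h4 : D.mixedVal lam (lam + μ) = D.mixedVal lam (lam + μ') + n := by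
    rw [← h3, mixedVal, mixedVal]
    ring
  have h5 : (0 : ℚ) ≤ n := by linarith
  obtain ⟨m, rfl⟩ := Int.eq_ofNat_of_zero_le (by exact_mod_cast h5)
  exact ⟨m, by exact_mod_cast h4⟩

/-- In finite dimension failure of surjectivity gives a kernel vector, so -s is an eigenvalue and is
attained at a singular vector of some dominant weight λ + w_i. -/
lemma mixed_add_smul_surjective {V : Type*} [AddCommGroup V] [Module ℂ V] [LieRingModule o10 V]
    [LieModule ℂ o10 V] [FiniteDimensional ℂ V] [LieModule.IsIrreducible ℂ o10 V]
    {lam : Fin 5 → ℚ} {v : V} (hv : IsSing (endRep V) (fun i => (lam i : ℂ)) v) {s : ℂ}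
    (hs : ∀ i, IsDominant (lam + D.w i) → (D.mixedVal lam (lam + D.w i) : ℂ) ≠ -s) :
    Function.Surjective (D.mixed V + s • LinearMap.id : Module.End ℂ (ι → V)) := by
  rw [← LinearMap.injective_iff_surjective, ← LinearMap.ker_eq_bot, LinearMap.ker_eq_bot']
  intro u hu
  by_contra hu0
  have he : D.mixed V u = (-s) • u := by
    rw [neg_smul, eq_neg_iff_add_eq_zero]
    exact hu
  obtain ⟨i, u', hdom, hs', he'⟩ := D.exists_isSing_of_eigenvalue hv hu0 he
  exact hs i hdom (D.eq_mixedVal hv hs' he').symm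

end WeightBasis

/-! ### The minima ℓ_ω(λ) and ♭(λ), and surjectivity of the shifted operators. -/

lemma isLeast_of_finite {S : Set ℚ} (hS : S.Finite) (hne : S.Nonempty) : ∃ q, IsLeast S q := by
  obtain ⟨q, hq, h⟩ := Set.exists_min_image S id hS hne
  exact ⟨q, hq, h⟩

lemma casimir_spinHighest : casimir spinHighest = 45 / 4 := by
  simp only [casimir_eq, Fin.sum_univ_five, spinHighest, halfSum, Matrix.cons_val]
  norm_num

lemma mem_ellSet_iff {lam : Fin 5 → ℚ} {q : ℚ} : q ∈ ellSet lam ↔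
    ∃ μ ∈ spinWeights, IsDominant (lam + μ) ∧ q = spinBasis.mixedVal lam (lam + μ) := by
  have h : spinBasis.casVal = casimir spinHighest := casimir_spinHighest.symm
  simp only [ellSet, upsilon, WeightBasis.mixedVal, h]
  constructor
  · rintro ⟨_, ⟨μ, hμ, rfl, hd⟩, hq⟩
    exact ⟨μ, hμ, hd, hq⟩
  · rintro ⟨μ, hμ, hd, hq⟩
    exact ⟨_, ⟨μ, hμ, rfl, hd⟩, hq⟩

lemma exists_isLeast_ellSet {lam : Fin 5 → ℚ} (hlam : IsDominant lam) : ∃ l, IsLeast (ellSet lam) l := by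
  refine isLeast_of_finite ((finite_spinWeights.image
    fun μ => spinBasis.mixedVal lam (lam + μ)).subset ?_) ?_
  · intro q hq
    obtain ⟨μ, hμ, -, rfl⟩ := mem_ellSet_iff.1 hq
    exact ⟨μ, hμ, rfl⟩
  · refine ⟨_, mem_ellSet_iff.2 ⟨spinHighest, ⟨![0, 0, 0, 0, 1], by decide, ?_⟩, ⟨?_, ?_⟩, rfl⟩⟩
    · intro i
      fin_cases i <;> norm_num [spinHighest, ZMod.val_one]
    · intro i
      obtain ⟨n, hn⟩ := hlam.1 i
      -- The only nonzero difference of consecutive coordinates of λ_4 is the last one, equal to 1.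
      refine ⟨n + if i = 3 then 1 else 0, ?_⟩
      push_cast
      rw [← hn, Pi.add_apply, Pi.add_apply]
      fin_cases i <;> simp [spinHighest]
      ring
    · obtain ⟨n, hn⟩ := hlam.2
      refine ⟨n, ?_⟩
      rw [← hn, Pi.add_apply, Pi.add_apply]
      simp [spinHighest]
      ring

lemma exists_mixedVal_of_mem_flatSet {V : Type*} [AddCommGroup V] [Module ℂ V] [LieRingModule o10 V]
    [LieModule ℂ o10 V] [LieModule.IsIrreducible ℂ o10 V] {lam : Fin 5 → ℚ} {v : V}
    (hv : IsSing (endRep V) (fun i => (lam i : ℂ)) v) {b : ℂ} (hb : b ∈ flatSet V lam) :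
    ∃ μ ∈ vectorWeights, b = natBasis.mixedVal lam (lam + μ) := by
  obtain ⟨_, ⟨μ, hμ, rfl, -⟩, u, hu, hb⟩ := hb
  refine ⟨μ, hμ, natBasis.eq_mixedVal hv ((natBasis.isSingular_iff _ u).1 hu) ?_⟩
  refine natBasis.toTens_injective ?_
  rw [natBasis_toTens_mixed, hb, map_smul]
  rfl

section

variable {V : Type*} [AddCommGroup V] [Module ℂ V] [LieRingModule o10 V] [LieModule ℂ o10 V]
  [FiniteDimensional ℂ V] [LieModule.IsIrreducible ℂ o10 V]
  {lam : Fin 5 → ℚ} {v : V}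

/-- The eigenspace contains a singular vector of dominant weight, and on it the eigenvalue is one of
the ♭_{λ'}. -/
lemma mem_flatSet_of_eigenvalue (hv : IsSing (endRep V) (fun i => (lam i : ℂ)) v) {u : Idx → V}
    (hu0 : u ≠ 0) {e : ℂ} (he : natBasis.mixed V u = e • u) : e ∈ flatSet V lam := by
  obtain ⟨i, u', hdom, hs, he'⟩ := natBasis.exists_isSing_of_eigenvalue hv hu0 he
  refine ⟨_, ⟨_, wt_mem_vectorWeights i, rfl, hdom⟩, u', (natBasis.isSingular_iff _ u').2 hs, ?_⟩
  rw [← natBasis_toTens_mixed, he', map_smul]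
  rfl

/-- The minimum of `flatSet` refers to the partial order of ℂ, which on rational numbers is the
usual one. -/
lemma ratCast_le_iff (p q : ℚ) : (p : ℂ) ≤ q ↔ p ≤ q := by
  rw [← Complex.ofReal_ratCast, ← Complex.ofReal_ratCast, Complex.real_le_real, Rat.cast_le]

/-- The set is nonempty because the mixed operator has an eigenvalue over ℂ; its elements are
rational and finite in number. -/
lemma exists_isLeast_flatSet (hv : IsSing (endRep V) (fun i => (lam i : ℂ)) v) :
    ∃ b, IsLeast (flatSet V lam) b := by
  have : Nontrivial (Idx → V) := by
    refine ⟨fun _ => v, 0, fun h => hv.1 (congrFun h (.inl 0))⟩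
  obtain ⟨e, he⟩ := Module.End.exists_eigenvalue (natBasis.mixed V)
  obtain ⟨u, hu⟩ := he.exists_hasEigenvector
  have he := mem_flatSet_of_eigenvalue hv hu.2 hu.apply_eq_smul
  obtain ⟨q, hq⟩ := isLeast_of_finite (S := {q : ℚ | (q : ℂ) ∈ flatSet V lam})
    ((finite_vectorWeights.image fun μ => natBasis.mixedVal lam (lam + μ)).subset (by
      intro q hq
      obtain ⟨μ, hμ, h⟩ := exists_mixedVal_of_mem_flatSet hv hq
      exact ⟨μ, hμ, by exact_mod_cast h.symm⟩))
    (by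
      obtain ⟨μ, -, h⟩ := exists_mixedVal_of_mem_flatSet hv he
      exact ⟨_, h ▸ he⟩)
  refine ⟨q, hq.1, fun b hb => ?_⟩
  obtain ⟨μ, -, rfl⟩ := exists_mixedVal_of_mem_flatSet hv hb
  exact (ratCast_le_iff _ _).2 (hq.2 hb)

/-- A kernel would make c/2 - k an eigenvalue, hence of the form ℓ_ω(λ) + n, so c = 2ℓ_ω(λ) + 2(n +
k), which is excluded. -/
lemma spinBasis_surjective (hlam : IsDominant lam) (hv : IsSing (endRep V) (fun i => (lam i : ℂ)) v)
    {l : ℚ} (hl : IsLeast (ellSet lam) l) {c : ℂ} (hc : ∀ n : ℕ, c ≠ 2 * (l : ℂ) + 2 * n) (k : ℕ) :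
    Function.Surjective (spinBasis.mixed V + ((k : ℂ) - c / 2) • LinearMap.id : Module.End ℂ (Fin 16 → V)) := by
  refine spinBasis.mixed_add_smul_surjective hv fun i hi h => ?_
  have h1 := hl.2 (mem_ellSet_iff.2 ⟨_, spinW_mem i, hi, rfl⟩)
  obtain ⟨μ, hμ, -, rfl⟩ := mem_ellSet_iff.1 hl.1
  obtain ⟨n, hn⟩ := spinBasis.exists_nat_of_mixedVal_le isMinusculeSet_spinWeights hlam
    (spinW_mem i) hμ h1
  refine hc (n + k) ?_
  change ((spinBasis.mixedVal lam (lam + spinW i) : ℚ) : ℂ) = _ at h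
  rw [hn] at h
  push_cast at h ⊢
  linear_combination -2 * h

/-- A kernel would make c + 6 - k an eigenvalue, hence of the form ♭(λ) + n, so c = ♭(λ) - 6 + (n +
k), which is excluded. -/
lemma natBasis_surjective (hlam : IsDominant lam) (hv : IsSing (endRep V) (fun i => (lam i : ℂ)) v)
    {b : ℂ} (hb : IsLeast (flatSet V lam) b) {c : ℂ} (hc : ∀ n : ℕ, c ≠ b - 6 + n) (k : ℕ) :
    Function.Surjective (natBasis.mixed V + ((k : ℂ) - 6 - c) • LinearMap.id : Module.End ℂ (Idx → V)) := by
  rw [← LinearMap.injective_iff_surjective, ← LinearMap.ker_eq_bot, LinearMap.ker_eq_bot']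
  intro u hu
  by_contra hu0
  have he : natBasis.mixed V u = (-((k : ℂ) - 6 - c)) • u := by
    rw [neg_smul, eq_neg_iff_add_eq_zero]
    exact hu
  have he := mem_flatSet_of_eigenvalue hv hu0 he
  have h1 := hb.2 he
  obtain ⟨μ, hμ, h2⟩ := exists_mixedVal_of_mem_flatSet hv he
  obtain ⟨μ', hμ', rfl⟩ := exists_mixedVal_of_mem_flatSet hv hb.1
  rw [h2, ratCast_le_iff] at h1
  obtain ⟨n, hn⟩ := natBasis.exists_nat_of_mixedVal_le isMinusculeSet_vectorWeights hlam hμ hμ' h1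
  refine hc (n + k) ?_
  rw [hn] at h2
  push_cast at h2 ⊢
  linear_combination h2

end

end E6Ext
end

noncomputable section

namespace E6Ext

open MvPolynomial

/-! ### The action of `𝒢_-` -/

/-- Duality (`nuInv_xi_eta_eq_sum`) replaces x_r by B_{d,c}(x_i). The sum over i is then
B_{d,c}(ζ_a) by the chain rule, and this is the natural action. A general bilinear L serves both the
action on 𝒜 and that on V. -/
lemma sum_pderiv_zeta_nuInv {M : Type*} [AddCommGroup M] [Module ℂ M] (a : Idx)
    (L : Poly →ₗ[ℂ] o10 →ₗ[ℂ] M) :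
    ∑ i, ∑ r, L (pderiv i (zeta a) * X r) (nuInv ⁅xi r, eta i⁆) = ∑ b, L (zeta b) (so a b) := by
  have h1 : ∀ i, ∑ r, L (pderiv i (zeta a) * X r) (nuInv ⁅xi r, eta i⁆) =
      (1 / 2 : ℂ) • ∑ c, ∑ d, L (pderiv i (zeta a) * polyAct (nu (so d c)) (X i)) (so c d) := by
    intro i
    simp only [nuInv_xi_eta_eq_sum, map_smul, map_sum, polyAct_X, Finset.mul_sum, mul_smul_comm,
      LinearMap.sum_apply, LinearMap.smul_apply, ← Finset.smul_sum]
    exact congrArg _ (sum_rotate _).symm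
  have h2 : ∀ d c, ∑ i, pderiv i (zeta a) * polyAct (nu (so d c)) (X i) =
      ∑ b, (so d c : Matrix Idx Idx ℂ) b a • zeta b := fun d c => by
    rw [← polyAct_eq_sum, polyAct_nu_zeta]
  have h3 : ∀ b, L (zeta b) (so b.swap a.swap) = -L (zeta b) (so a b) := fun b => by
    rw [so_swap, map_neg]
  simp only [h1, ← Finset.smul_sum]
  rw [← sum_rotate]
  simp only [← LinearMap.sum_apply, ← map_sum, h2]
  simp only [map_sum, map_smul, LinearMap.sum_apply, LinearMap.smul_apply]
  rw [sum_rotate]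
  have h4 : ∀ b, ∑ c, ∑ d, (so d c : Matrix Idx Idx ℂ) b a • L (zeta b) (so c d) =
      (2 : ℂ) • L (zeta b) (so a b) := fun b => by
    rw [Finset.sum_comm, sum_so_entry b a fun d c => L (zeta b) (so c d), h3, sub_neg_eq_add, two_smul]
  simp only [h4, ← Finset.smul_sum, smul_smul]
  norm_num [-Fintype.sum_sum_type]

/-- The o(10)-part contributes ½ · n/2 by the radial identity, and the central part (3/8) n · 2 by
Euler's formula for ζ_a; the total is n. -/
lemma sum_pderiv_zeta_quadField (a : Idx) {n : ℕ} {g : Poly} (hg : g.IsHomogeneous n) :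
    ∑ i, pderiv i (zeta a) * quadField i g = (n : ℂ) • (zeta a * g) := by
  have h1 : ∀ i, pderiv i (zeta a) * quadField i g =
      (1 / 2 : ℂ) • ∑ r, pderiv i (zeta a) * X r * polyAct (nu (nuInv ⁅xi r, eta i⁆)) g
        + ((3 / 8 : ℂ) * n) • (X i * pderiv i (zeta a) * g) := by
    intro i
    rw [quadField_apply]
    simp only [polyAct_xi_eta, polyAct_alphaHat, hg.sum_X_mul_pderiv, mul_add, Finset.sum_add_distrib,
      smul_add, mul_smul_comm, Finset.mul_sum, mul_assoc]
    refine congrArg₂ (· + ·) rfl ?_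
    rw [Finset.sum_eq_single i]
    · simp only [if_true, smul_smul, ← Nat.cast_smul_eq_nsmul ℂ, mul_left_comm (X i)]
      refine congrArg₂ (· • ·) ?_ rfl
      ring
    · intro r _ hr
      rw [if_neg hr, zero_div, zero_smul]
    · exact fun h => absurd (Finset.mem_univ i) h
  have h2 := sum_pderiv_zeta_nuInv a (LinearMap.mk₂ ℂ (fun (p : Poly) (B : o10) => p * polyAct (nu B) g)
    (fun p q B => add_mul _ _ _) (fun x p B => smul_mul_assoc _ _ _)
    (fun p A B => by rw [map_add, map_add, LinearMap.add_apply, mul_add])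
    (fun x p B => by rw [map_smul, map_smul, LinearMap.smul_apply, mul_smul_comm]))
  simp only [LinearMap.mk₂_apply, sum_zeta_polyAct a hg] at h2
  simp only [h1, Finset.sum_add_distrib, ← Finset.smul_sum, h2, ← Finset.sum_mul, euler_zeta,
    smul_mul_assoc, smul_smul, ← add_smul]
  refine congrArg₂ (· • ·) ?_ rfl
  ring

/-- The term x_i x_j of P_i(x_j) gives 2ζ_a and the Hessian term gives -8ζ_a. This is the origin of
the 6 in the theorem. -/
lemma sum_Z_smul_quadField_X (a : Idx) :
    ∑ i, ∑ j, (Z a i j : ℂ) • quadField i (X j) = (-6 : ℂ) • zeta a := by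
  have h : ∑ i, ∑ j, ∑ b, ((Z a i j : ℂ) * Z b i j) • zeta b = (8 : ℂ) • zeta a := by
    rw [sum_rotate]
    simp only [← Finset.sum_smul]
    have h1 : ∀ b, ∑ i, ∑ j, (Z a i j : ℂ) * Z b i j = if a = b then 8 else 0 := fun b => by
      exact_mod_cast congrArg (Int.cast : ℤ → ℂ) (sum_Z_mul_Z a b)
    simp only [h1, ite_smul, zero_smul, Finset.sum_ite_eq, Finset.mem_univ, if_true]
  simp only [quadField_X, smul_sub, Finset.sum_sub_distrib, ← two_smul_zeta, Finset.smul_sum, smul_smul, h]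
  rw [← sub_smul]
  norm_num

section

variable {V : Type*} [AddCommGroup V] [Module ℂ V] [LieRingModule o10 V] [LieModule ℂ o10 V] {c : ℂ}

/-- The central component of [ξ_i, η_i] is -α̂/4, and α̂ acts on V as 2c; this yields -c/2. -/
lemma iota_eta_tm (i : Fin 16) (g : Poly) (v : V) : iota c V (eta i) (tm g v) =
    tm (quadField i g) v + ∑ r, tm (X r * g) ⁅nuInv ⁅xi r, eta i⁆, v⁆ - (c / 2) • tm (X i * g) v := by
  have h : ∀ r, opL V (mulX r) (opR V (rho c V ⁅xi r, eta i⁆) (tm g v)) =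
      tm (X r * g) ⁅nuInv ⁅xi r, eta i⁆, v⁆ + (if r = i then -(c / 2) • tm (X i * g) v else 0) := by
    intro r
    rw [opR_tmul, opL_tmul, rho_apply, hPart_xi_eta_five, LinearMap.add_apply, tm_add_right]
    refine congrArg₂ (· + ·) rfl ?_
    split_ifs with hr
    · subst hr
      rw [LinearMap.smul_apply, tm_smul_right]
      refine congrArg₂ (· • ·) ?_ rfl
      ring
    · rw [mul_zero, zero_smul, LinearMap.zero_apply]
      exact map_zero (tmR _)
  rw [iota_eta, etaOp, LinearMap.add_apply, LinearMap.sum_apply, opL_tmul]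
  simp only [Module.End.mul_apply, h, Finset.sum_add_distrib, Finset.sum_ite_eq', Finset.mem_univ, if_true]
  rw [neg_smul, ← sub_eq_add_neg, add_sub_assoc]

/-- Applying P_i to x_j contributes -6, applying it to g contributes n, and the central term
contributes -c because ∑ Z^a_{ij} x_i x_j = 2ζ_a. What remains is the mixed Casimir operator of the
natural module. -/
lemma sum_Z_smul_iota_eta (a : Idx) {n : ℕ} {g : Poly} (hg : g.IsHomogeneous n) (v : V) :
    ∑ i, ∑ j, (Z a i j : ℂ) • iota c V (eta i) (tm (X j * g) v) =
      ∑ b, tm (zeta b * g) ⁅so a b, v⁆ + ((n : ℂ) - 6 - c) • tm (zeta a * g) v := by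
  have hZ : ∀ i, ∑ j, (Z a i j : ℂ) • (X j : Poly) = pderiv i (zeta a) := fun i => (pderiv_zeta a i).symm
  have h1 : ∑ i, ∑ j, (Z a i j : ℂ) • tm (quadField i (X j * g)) v =
      ((n : ℂ) - 6) • tm (zeta a * g) v := by
    have h : ∑ i, ∑ j, (Z a i j : ℂ) • quadField i (X j * g) = ((n : ℂ) - 6) • (zeta a * g) := by
      simp only [quadField_mul, smul_add, Finset.sum_add_distrib, ← smul_mul_assoc, ← Finset.sum_mul,
        sum_Z_smul_quadField_X, hZ]
      rw [sum_pderiv_zeta_quadField a hg, smul_mul_assoc, smul_mul_assoc, ← add_smul]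
      refine congrArg₂ (· • ·) ?_ rfl
      ring
    rw [← tm_smul_left, ← h]
    simp only [tm_sum_left, tm_smul_left]
  have h2 : ∑ i, ∑ j, (Z a i j : ℂ) • ∑ r, tm (X r * (X j * g)) ⁅nuInv ⁅xi r, eta i⁆, v⁆ =
      ∑ b, tm (zeta b * g) ⁅so a b, v⁆ := by
    have h := sum_pderiv_zeta_nuInv a (LinearMap.mk₂ ℂ (fun (p : Poly) (B : o10) => tm (p * g) ⁅B, v⁆)
      (fun p q B => by rw [add_mul, tm_add_left]) (fun x p B => by rw [smul_mul_assoc, tm_smul_left])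
      (fun p A B => by rw [add_lie, tm_add_right])
      (fun x p B => by rw [smul_lie, tm_smul_right]))
    simp only [LinearMap.mk₂_apply] at h
    rw [← h]
    refine Finset.sum_congr rfl fun i _ => ?_
    simp only [Finset.smul_sum]
    rw [Finset.sum_comm]
    refine Finset.sum_congr rfl fun r _ => ?_
    rw [← hZ, Finset.sum_mul, Finset.sum_mul, tm_sum_left]
    refine Finset.sum_congr rfl fun j _ => ?_
    rw [smul_mul_assoc, smul_mul_assoc, tm_smul_left, mul_left_comm, mul_assoc]
  have h3 : ∑ i, ∑ j, (Z a i j : ℂ) • (c / 2) • tm (X i * (X j * g)) v = c • tm (zeta a * g) v := by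
    have h : ∑ i, ∑ j, (Z a i j : ℂ) • tm (X i * (X j * g)) v = (2 : ℂ) • tm (zeta a * g) v := by
      rw [← tm_smul_left, ← smul_mul_assoc, two_smul_zeta]
      simp only [Finset.sum_mul, tm_sum_left, smul_mul_assoc, tm_smul_left, mul_assoc]
    have h' : ∀ i j, (Z a i j : ℂ) • (c / 2) • tm (X i * (X j * g)) v =
        (c / 2) • (Z a i j : ℂ) • tm (X i * (X j * g)) v := fun i j => smul_comm _ _ _
    simp only [h', ← Finset.smul_sum, h]
    rw [smul_smul]
    refine congrArg₂ (· • ·) ?_ rfl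
    ring
  simp only [iota_eta_tm, smul_add, smul_sub, Finset.sum_add_distrib, Finset.sum_sub_distrib, h1, h2, h3]
  module

end

/-! ### Submodules of `𝒜 ⊗ V` -/

section

variable {V : Type*} [AddCommGroup V] [Module ℂ V] {N : Submodule ℂ (Tens V)}

lemma exists_degree_bound (w : Tens V) : ∃ d : ℕ, ∀ m : Fin 16 →₀ ℕ, d < m.degree → cf m w = 0 := by
  induction w using Tens_induction with
  | zero => exact ⟨0, fun m _ => map_zero _⟩
  | add x y hx hy =>
    obtain ⟨d, hd⟩ := hx
    obtain ⟨e, he⟩ := hy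
    refine ⟨max d e, fun m hm => ?_⟩
    rw [map_add, hd m (lt_of_le_of_lt (le_max_left _ _) hm), he m (lt_of_le_of_lt (le_max_right _ _) hm),
      add_zero]
  | tmul p v =>
    refine ⟨p.totalDegree, fun m hm => ?_⟩
    rw [cf_tmul, coeff_eq_zero_of_totalDegree_lt, zero_smul]
    rwa [Finsupp.degree_apply] at hm

lemma eq_tm_one_of_cf {w : Tens V} (h : ∀ m, m ≠ 0 → cf m w = 0) : w = tm 1 (cf 0 w) := by
  rw [← sub_eq_zero]
  refine eq_zero_of_cf _ fun m => ?_
  rw [map_sub, cf_tmul, coeff_one]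
  split_ifs with hm
  · rw [← hm, one_smul, sub_self]
  · rw [h m (Ne.symm hm), zero_smul, sub_zero]

/-- All `f ⊗ v` with `f` homogeneous of degree `k` lie in `N`. -/
def ContainsDegree (N : Submodule ℂ (Tens V)) (k : ℕ) : Prop :=
  ∀ f : Poly, f.IsHomogeneous k → ∀ v : V, tm f v ∈ N

/-- By Euler's identity a form of degree k + 1 is a combination of products x_i g with g of degree
k. -/
lemma containsDegree_succ {k : ℕ} (h : ∀ g : Poly, g.IsHomogeneous k → ∀ i, ∀ v : V, tm (X i * g) v ∈ N) :
    ContainsDegree N (k + 1) := by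
  intro f hf v
  have h1 : ((k + 1 : ℕ) : ℂ) • f = ∑ i, X i * pderiv i f := by
    rw [hf.sum_X_mul_pderiv, Nat.cast_smul_eq_nsmul]
  have h2 : ((k + 1 : ℕ) : ℂ) • tm f v ∈ N := by
    rw [← tm_smul_left, h1, tm_sum_left]
    exact N.sum_mem fun i _ => h _ hf.pderiv i v
  exact (N.smul_mem_iff (by exact_mod_cast Nat.succ_ne_zero k)).1 h2

lemma eq_top_of_containsDegree (h : ∀ k, ContainsDegree N k) : N = ⊤ := by
  rw [eq_top_iff]
  intro w _
  induction w using Tens_induction with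
  | zero => exact N.zero_mem
  | add x y hx hy => exact N.add_mem (hx trivial) (hy trivial)
  | tmul p v =>
    rw [← sum_homogeneousComponent p, tm_sum_left]
    exact N.sum_mem fun k _ => h k _ (homogeneousComponent_isHomogeneous k p) v

end

/-! ### Submodules that are stable under the action of 𝒢. -/

section

variable {V : Type*} [AddCommGroup V] [Module ℂ V] [LieRingModule o10 V] [LieModule ℂ o10 V] {c : ℂ}
  {N : Submodule ℂ (Tens V)}

lemma iota_nu_tm_one (B : o10) (v : V) : iota c V (nu B) (tm 1 v) = tm 1 ⁅B, v⁆ := by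
  rw [iota_deg_zero _ (isDeg_nu B), zeroOp_apply, LinearMap.add_apply, opL_tmul, opR_tmul, rho_apply,
    nuInv_nu, hPart_nu_five, mul_zero, zero_smul, add_zero, polyAct_eq_sum]
  simp only [pderiv_one, zero_mul, Finset.sum_const_zero]
  rw [← tmL_apply, map_zero, zero_add]
  rfl

/-- The ξ_r act as derivatives and lower the degree. If they all kill w, then w has only a constant
term. -/
lemma exists_tm_one_mem (hN : ∀ u, ∀ w ∈ N, iota c V u w ∈ N) (d : ℕ) :
    ∀ w ∈ N, w ≠ 0 → (∀ m : Fin 16 →₀ ℕ, d < m.degree → cf m w = 0) → ∃ v : V, v ≠ 0 ∧ tm 1 v ∈ N := by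
  have key : ∀ w ∈ N, w ≠ 0 → (∀ m, m ≠ 0 → cf m w = 0) → ∃ v : V, v ≠ 0 ∧ tm 1 v ∈ N := by
    intro w hw hw0 h
    have h1 := eq_tm_one_of_cf h
    refine ⟨cf 0 w, fun h0 => hw0 ?_, h1 ▸ hw⟩
    rw [h1, h0]
    exact map_zero (tmR 1)
  induction d with
  | zero =>
    intro w hw hw0 hd
    refine key w hw hw0 fun m hm => hd m ?_
    rw [Nat.pos_iff_ne_zero, Ne, Finsupp.degree_eq_zero_iff]
    exact hm
  | succ d ih =>
    intro w hw hw0 hd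
    by_cases h : ∀ r, opL V (dX r) w = 0
    · refine key w hw hw0 fun m hm => ?_
      obtain ⟨r, hr⟩ := Finsupp.ne_iff.1 hm
      have h1 := cf_dX (m - Finsupp.single r 1) r w
      rw [h r, map_zero, tsub_add_cancel_of_le] at h1
      · refine (smul_eq_zero.1 h1.symm).resolve_left ?_
        exact Nat.cast_add_one_ne_zero _
      · rw [Finsupp.single_le_iff]
        exact Nat.one_le_iff_ne_zero.2 hr
    · rw [not_forall] at h
      obtain ⟨r, hr⟩ := h
      refine ih _ ?_ hr fun m hm => ?_
      · rw [← iota_xi (c := c)]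
        exact hN _ _ hw
      · rw [cf_dX, hd, smul_zero]
        rw [map_add, Finsupp.degree_single]
        omega

/-- The vectors v with 1 ⊗ v in N form a nonzero o(10)-submodule of the irreducible module V. -/
lemma containsDegree_zero [LieModule.IsIrreducible ℂ o10 V] (hN : ∀ u, ∀ w ∈ N, iota c V u w ∈ N)
    {v : V} (hv : v ≠ 0) (hvN : tm 1 v ∈ N) : ContainsDegree N 0 := by
  have h : N.comap (tmR 1) = ⊤ := by
    refine isIrred_endRep (V := V) _ (fun B w hw => ?_) ?_
    · rw [Submodule.mem_comap, tmR_apply] at hw ⊢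
      rw [endRep_apply, ← iota_nu_tm_one (c := c)]
      exact hN _ _ hw
    · exact (Submodule.ne_bot_iff _).2 ⟨v, hvN, hv⟩
  intro f hf w
  have hw : w ∈ N.comap (tmR 1) := h ▸ Submodule.mem_top
  rw [Submodule.mem_comap, tmR_apply] at hw
  rw [(totalDegree_eq_zero_iff_eq_C (p := f)).1 (Nat.le_zero.1 hf.totalDegree_le), ← mul_one (C _),
    ← smul_eq_C_mul, tm_smul_left]
  exact N.smul_mem _ hw

/-- Surjectivity provides u for which the Hessian contractions of the η_i(x_j g ⊗ u_a), summed over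
a, add up to exactly ζ_a g ⊗ v. The elements x_j g ⊗ u_a have degree n + 1, so they lie in N. -/
lemma tm_zeta_mul_mem (hN : ∀ u, ∀ w ∈ N, iota c V u w ∈ N) {n : ℕ} (h : ContainsDegree N (n + 1))
    (hs : Function.Surjective
      (natBasis.mixed V + ((n : ℂ) - 6 - c) • LinearMap.id : Module.End ℂ (Idx → V)))
    {g : Poly} (hg : g.IsHomogeneous n) (a : Idx) (v : V) : tm (zeta a * g) v ∈ N := by
  obtain ⟨u, hu⟩ := hs (Pi.single a v)
  have h1 : ∀ b, ∑ a, ⁅so a b, u a⁆ + ((n : ℂ) - 6 - c) • u b = (Pi.single a v : Idx → V) b := fun b => by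
    rw [← natBasis_mixed, ← hu]
    rfl
  have h2 : ∑ b, tm (zeta b * g) ((Pi.single a v : Idx → V) b) = tm (zeta a * g) v := by
    rw [Finset.sum_eq_single a, Pi.single_eq_same]
    · intro b _ hb
      rw [Pi.single_eq_of_ne hb]
      exact map_zero (tmR _)
    · exact fun h => absurd (Finset.mem_univ a) h
  have h3 : tm (zeta a * g) v =
      ∑ a, ∑ i, ∑ j, (Z a i j : ℂ) • iota c V (eta i) (tm (X j * g) (u a)) := by
    rw [← h2]
    simp only [← h1, sum_Z_smul_iota_eta _ hg, tm_add_right, tm_sum_right, tm_smul_right,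
      Finset.sum_add_distrib]
    rw [Finset.sum_comm]
  rw [h3]
  refine N.sum_mem fun b _ => N.sum_mem fun i _ => N.sum_mem fun j _ => N.smul_mem _ (hN _ _ (h _ ?_ _))
  rw [add_comm]
  exact (isHomogeneous_X ℂ j).mul hg

/-- Up to the quadric terms in `hz`, ∑_i η_i(g ⊗ u_i) is the shifted mixed Casimir operator of the
spin module applied to u; surjectivity makes x_i g ⊗ v its value. -/
lemma tm_X_mul_mem (hN : ∀ u, ∀ w ∈ N, iota c V u w ∈ N) {k : ℕ} (h : ContainsDegree N k)
    (hz : ∀ a j, ∀ g : Poly, g.IsHomogeneous k → ∀ v : V, tm (zeta a * pderiv j g) v ∈ N)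
    (hs : Function.Surjective
      (spinBasis.mixed V + ((k : ℂ) - c / 2) • LinearMap.id : Module.End ℂ (Fin 16 → V)))
    {g : Poly} (hg : g.IsHomogeneous k) (i : Fin 16) (v : V) : tm (X i * g) v ∈ N := by
  obtain ⟨u, hu⟩ := hs (Pi.single i v)
  have h1 : ∀ r, ∑ i, ⁅nuInv ⁅xi r, eta i⁆, u i⁆ + ((k : ℂ) - c / 2) • u r =
      (Pi.single i v : Fin 16 → V) r := fun r => by
    rw [← spinBasis_mixed, ← hu]
    rfl
  have h2 : ∑ r, tm (X r * g) ((Pi.single i v : Fin 16 → V) r) = tm (X i * g) v := by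
    rw [Finset.sum_eq_single i, Pi.single_eq_same]
    · intro b _ hb
      rw [Pi.single_eq_of_ne hb]
      exact map_zero (tmR _)
    · exact fun h => absurd (Finset.mem_univ i) h
  have h3 : ∀ i w, iota c V (eta i) (tm g w) + ∑ a, ∑ j, (Z a i j : ℂ) • tm (zeta a * pderiv j g) w =
      ∑ r, tm (X r * g) ⁅nuInv ⁅xi r, eta i⁆, w⁆ + ((k : ℂ) - c / 2) • tm (X i * g) w := by
    intro i w
    rw [iota_eta_tm, quadField_of_isHomogeneous i hg]
    simp only [tm_sub_left, tm_sum_left, tm_smul_left]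
    module
  have h4 : tm (X i * g) v = ∑ i, (iota c V (eta i) (tm g (u i))
      + ∑ a, ∑ j, (Z a i j : ℂ) • tm (zeta a * pderiv j g) (u i)) := by
    rw [← h2]
    simp only [← h1, h3, tm_add_right, tm_sum_right, tm_smul_right, Finset.sum_add_distrib]
    rw [Finset.sum_comm]
  rw [h4]
  exact N.sum_mem fun j _ => N.add_mem (hN _ _ (h g hg _)) (N.sum_mem fun a _ => N.sum_mem fun l _ =>
    N.smul_mem _ (hz a l g hg _))

lemma containsDegree_of_surjective (hN : ∀ u, ∀ w ∈ N, iota c V u w ∈ N) (h0 : ContainsDegree N 0)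
    (hs : ∀ k : ℕ, Function.Surjective
      (spinBasis.mixed V + ((k : ℂ) - c / 2) • LinearMap.id : Module.End ℂ (Fin 16 → V)))
    (hn : ∀ k : ℕ, Function.Surjective
      (natBasis.mixed V + ((k : ℂ) - 6 - c) • LinearMap.id : Module.End ℂ (Idx → V)))
    (k : ℕ) : ContainsDegree N k := by
  induction k with
  | zero => exact h0
  | succ k ih =>
    refine containsDegree_succ fun g hg i v => tm_X_mul_mem hN ih (fun a j f hf w => ?_) (hs k) hg i v
    -- The quadric terms involve ∂_j g, of degree one less than g. They vanish when g is constant;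
    -- otherwise the shift n in `tm_zeta_mul_mem` is the degree of ∂_j g.
    rcases k with _ | k
    · rw [(totalDegree_eq_zero_iff_eq_C (p := f)).1 (Nat.le_zero.1 hf.totalDegree_le), pderiv_C, mul_zero,
        ← tmL_apply, map_zero]
      exact N.zero_mem
    · exact tm_zeta_mul_mem hN ih (hn k) hf.pderiv a w

end

end E6Ext
end


/-! ### The irreducibility theorem. -/

theorem theorem6p4 (V : Type*) [AddCommGroup V] [Module ℂ V] [LieRingModule E6Ext.o10 V]
    [LieModule ℂ E6Ext.o10 V] [FiniteDimensional ℂ V] [LieModule.IsIrreducible ℂ E6Ext.o10 V]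
    (lam : Fin 5 → ℚ) (hlam : E6Ext.IsDominant lam)
    (hV : ∃ v : V, E6Ext.IsSingular (LieModule.toEnd ℂ E6Ext.o10 V) lam v) :
    ∃ (b : ℂ) (l : ℚ), IsLeast (E6Ext.flatSet V lam) b ∧ IsLeast (E6Ext.ellSet lam) l ∧
      ∀ c : ℂ, (∀ n : ℕ, c ≠ b - 6 + n) → (∀ n : ℕ, c ≠ 2 * (l : ℂ) + 2 * n) →
        LieModule.IsIrreducible ℂ E6Ext.E6 (E6Ext.Ext c V) := by
  obtain ⟨v, hv⟩ := hV
  -- The two notions of singular vector agree definitionally.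
  replace hv : E6Ext.IsSing (E6Ext.endRep V) (fun i => (lam i : ℂ)) v := hv
  obtain ⟨b, hb⟩ := E6Ext.exists_isLeast_flatSet hv
  obtain ⟨l, hl⟩ := E6Ext.exists_isLeast_ellSet hlam
  refine ⟨b, l, hb, hl, fun c hc hc' => ?_⟩
  have hnt : Nontrivial (E6Ext.Ext c V) := by
    refine ⟨(E6Ext.tm 1 v : E6Ext.Tens V), 0, fun h => hv.1 ?_⟩
    have h1 := congrArg (E6Ext.cf 0 : E6Ext.Tens V → V) h
    rw [E6Ext.cf_tmul] at h1
    simpa using h1.trans (map_zero (E6Ext.cf (V := V) 0))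
  refine LieModule.IsIrreducible.mk fun W hW => ?_
  let N : Submodule ℂ (E6Ext.Tens V) := W.toSubmodule
  have hN : ∀ u, ∀ w ∈ N, E6Ext.iota c V u w ∈ N := fun u w hw => W.lie_mem (x := u) (m := w) hw
  obtain ⟨w, hw, hw0⟩ := (Submodule.ne_bot_iff N).1 fun h => hW ((LieSubmodule.toSubmodule_eq_bot W).1 h)
  obtain ⟨d, hd⟩ := E6Ext.exists_degree_bound (V := V) w
  obtain ⟨v', hv', hvN⟩ := E6Ext.exists_tm_one_mem hN d w hw hw0 hd
  have hT : N = ⊤ := E6Ext.eq_top_of_containsDegree (E6Ext.containsDegree_of_surjective hN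
    (E6Ext.containsDegree_zero hN hv' hvN) (E6Ext.spinBasis_surjective hlam hv hl hc')
    (E6Ext.natBasis_surjective hlam hv hb hc))
  rw [← LieSubmodule.toSubmodule_eq_top]
  exact hT
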